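/- Let $N\ge 2$, $\gamma\in(0,1)$, let $0=\mu_0\le\mu_1\le\mu_2\le\dots$ be the eigenvalues of $-\Delta_{\mathbb S^{N-1}}$ repeated according to multiplicity, fix $m\ge 0$, put $$A_m=\tfrac12+\tfrac\gamma2+\tfrac12\sqrt{(\tfrac N2-1)^2+\mu_m},\qquad B_m=\tfrac12-\tfrac\gamma2+\tfrac12\sqrt{(\tfrac N2-1)^2+\mu_m},$$ $$\Theta_m(z)=2^{2\gamma}\frac{\Gamma(A_m+\frac z2 i)\Gamma(A_m-\frac z2 i)}{\Gamma(B_m+\frac z2 i)\Gamma(B_m-\frac z2 i)}\quad(z\in\mathbb C),\qquad \Lambda_{N,\gamma}=2^{2\gamma}\frac{\Gamma(\frac{N+2\gamma}4)^2}{\Gamma(\frac{N-2\gamma}4)^2},$$ and let $0\le\kappa<\Lambda_{N,\gamma}$. Write $\hat v(\xi)=\frac1{\sqrt{2\pi}}\int_{\mathbb R}e^{-i\xi t}v(t)\,dt$, and let $P_\gamma^m$ be the Fourier multiplier with symbol $\Theta_m$. We say that $w$ solves $$P_\gamma^m w-\kappa w=h \qquad(1)$$ on the line $\mathbb R+i\vartheta$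 if $e^{\vartheta t}w$ and $e^{\vartheta t}(\kappa w+h)$ are tempered (absolutely integrable against every Schwartz function) and $\Theta_m(\xi+i\vartheta)\,\widehat{e^{\vartheta\cdot}w}(\xi)=\widehat{e^{\vartheta\cdot}(\kappa w+h)}(\xi)$ in the sense of tempered distributions, that is, $\int e^{\vartheta t}w\,\hat\chi\,dt=\int e^{\vartheta t}(\kappa w+h)\,\hat\varphi\,dt$ for all Schwartz functions $\varphi,\chi$ with $\chi(\xi)=\Theta_m(\xi+i\vartheta)\varphi(\xi)$ for a.e. $\xi$; for $\vartheta=0$ this is the usual Fourier form of (1). Then there are real sequences $(\tau_j),(\sigma_j),(d_j),(d_j')$, $j\ge0$, depending only on $N,\gamma,m,\kappa$, with the following properties. **i.** The function $\frac1{\Theta_m(z)-\kappa}$ is meromorphic in $\mathbb C$. Its poles are exactly the points $\tau_j\pm i\sigma_j$ and $-\tau_j\pm i\sigma_j$, $j\ge0$, where the pairs $(\tau_j,\sigma_j)$ are distinct and listed so that $\sigma_0\le\sigma_1\le\dots$. Here $\sigma_j>\sigma_0>0$ for $j\ge1$, $\tau_j\ge0$ for all $j$, $\tau_0=0$, and $\tau_j=0$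 for $j$ large enough; for such $j$ the sequence $\sigma_j$ is strictly increasing, and $\sigma_j\to\infty$ (no accumulation points). The constants are given by the residue $\rho_j$ of $\frac1{\Theta_m-\kappa}$ at $\tau_j+i\sigma_j$: $d_j-i d_j'=i\rho_j$ if $\tau_j=0$, and $d_j-id_j'=2i\rho_j$ if $\tau_j\ne0$. Put $M_j(t)=e^{-\sigma_jt}[d_j\cos(\tau_jt)+d_j'\sin(\tau_jt)]$. **ii.** The series $$\mathcal G_m(t)=d_0e^{-\sigma_0|t|}+\sum_{j=1}^\infty e^{-\sigma_j|t|}[d_j\cos(\tau_j|t|)+d_j'\sin(\tau_j|t|)]$$ converges for $t\ne0$; $\mathcal G_m$ is even, $\mathcal C^\infty$ on $\mathbb R\setminus\{0\}$, integrable, and $\int_{\mathbb R}e^{-i\xi t}\mathcal G_m(t)\,dt=\frac1{\Theta_m(\xi)-\kappa}$ for all $\xi\in\mathbb R$. If $h:\mathbb R\to\mathbb R$ is locally integrable, $h(t)=O(e^{-\delta t})$ as $t\to+\infty$ and $h(t)=O(e^{\delta_0t})$ as $t\to-\infty$ with $\delta>0$, $\delta_0\ge0$, then $w(t)=\int_{\mathbb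 R}h(t')\mathcal G_m(t-t')\,dt'$ (absolutely convergent for a.e. $t$) is a solution of (1) (on the line $\vartheta=0$). **iii.** Let $J\ge0$ and put $$\widetilde{\mathcal G}_m(t)=\sum_{j=J+1}^\infty M_j(t)\ \ (t>0),\qquad \widetilde{\mathcal G}_m(t)=\mathcal G_m(t)-\sum_{j=0}^J M_j(t)\ \ (t<0).$$ The series converges, $\widetilde{\mathcal G}_m$ is $\mathcal C^\infty$ on $\mathbb R\setminus\{0\}$, and for $\sigma_J<\vartheta<\sigma_{J+1}$ the function $e^{\vartheta t}\widetilde{\mathcal G}_m(t)$ is integrable with $\int_{\mathbb R}e^{-i(\xi+i\vartheta)t}\widetilde{\mathcal G}_m(t)\,dt=\frac1{\Theta_m(\xi+i\vartheta)-\kappa}$ for a.e. $\xi\in\mathbb R$. Let $h:\mathbb R\to\mathbb R$ be locally integrable with $h(t)=O(e^{-\delta t})$ as $t\to+\infty$, $h(t)=O(e^{\delta_0t})$ as $t\to-\infty$, where $\delta,\delta_0\in\mathbb R$, $\delta+\delta_0\ge0$ and $\sigma_J<\delta<\sigma_{J+1}$ (thus $\delta_0>-\sigma_{J+1}$). Then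 $w(t)=\int_{\mathbb R}h(t')\widetilde{\mathcal G}_m(t-t')\,dt'$ (absolutely convergent for a.e. $t$) is a solution of (1) on every line $\mathbb R+i\vartheta$ with $\sigma_J<\vartheta<\sigma_{J+1}$, $-\delta_0\le\vartheta\le\delta$, and $$w(t)=O(e^{-\delta t})\ \text{ as }t\to+\infty,\qquad w(t)=\sum_{j=0}^JD_j(t)e^{-\sigma_jt}+R(t),$$ where, as $t\to-\infty$, $R(t)=O(e^{\delta_0t})$ if $\delta_0<\sigma_0$, $R(t)=O(|t|e^{\sigma_0t})$ if $\delta_0=\sigma_0$, $R(t)=O(e^{\sigma_0t})$ if $\delta_0>\sigma_0$, and $$\begin{aligned}D_j(t)=&-d_j\Big[\cos(\tau_jt)\int_t^{\infty}e^{\sigma_jt'}\cos(\tau_jt')h(t')\,dt'+\sin(\tau_jt)\int_t^{\infty}e^{\sigma_jt'}\sin(\tau_jt')h(t')\,dt'\Big]\\&-d_j'\Big[\sin(\tau_jt)\int_t^{\infty}e^{\sigma_jt'}\cos(\tau_jt')h(t')\,dt'-\cos(\tau_jt)\int_t^{\infty}e^{\sigma_jt'}\sin(\tau_jt')h(t')\,dt'\Big]\end{aligned}$$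 (the integrals converge absolutely). If $j\le J$, $\tau_j=0$ and $e^{\sigma_jt'}h(t')$ is integrable on $\mathbb R$, which is the case for every $j\le J$ with $\delta_0>-\sigma_j$, then $D_j(t)\to-d_j\int_{\mathbb R}e^{\sigma_jt'}h(t')\,dt'$ as $t\to-\infty$. -/

import Mathlib

open MeasureTheory Filter Topology Asymptotics
open scoped SchwartzMap

noncomputable section

namespace HardyCylinder

/-- Dimension of the space of spherical harmonics of degree `l` on the unit sphere of
`ℝ ^ N` (for `2 ≤ N`). -/
def harmonicDim (N : ℕ) : ℕ → ℕ
  | 0 => 1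
  | 1 => N
  | l + 2 => (N + l + 1).choose (l + 2) - (N + l - 1).choose l

/-- Degree of the `m`-th spherical harmonic (`m = 0, 1, 2, …`), when the spherical harmonics are
listed by increasing degree, each degree `l` being repeated `harmonicDim N l` times. -/
def harmonicDegree (N m : ℕ) : ℕ :=
  sInf {l : ℕ | m < ∑ i ∈ Finset.range (l + 1), harmonicDim N i}

/-- `μ_m`: the `m`-th eigenvalue of `-Δ` on the unit sphere of `ℝ ^ N`, repeated according to
multiplicity; a spherical harmonic of degree `l` has eigenvalue `l (l + N - 2)`. -/
def sphereEigenvalue (N m : ℕ) : ℝ :=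
  (harmonicDegree N m : ℝ) * ((harmonicDegree N m : ℝ) + (N : ℝ) - 2)

/-- The constant `A_m`. -/
def constA (N : ℕ) (γ : ℝ) (m : ℕ) : ℝ :=
  1 / 2 + γ / 2 + 1 / 2 * √(((N : ℝ) / 2 - 1) ^ 2 + sphereEigenvalue N m)

/-- The constant `B_m`. -/
def constB (N : ℕ) (γ : ℝ) (m : ℕ) : ℝ :=
  1 / 2 - γ / 2 + 1 / 2 * √(((N : ℝ) / 2 - 1) ^ 2 + sphereEigenvalue N m)

/-- The symbol `Θ_m`, extended to the complex plane. (At the poles of the numerator the value is a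
convention without importance: the theorem only uses notions that ignore a discrete set.) -/
def symbol (N : ℕ) (γ : ℝ) (m : ℕ) (z : ℂ) : ℂ :=
  (((2 : ℝ) ^ (2 * γ) : ℝ) : ℂ) *
    (Complex.Gamma (constA N γ m + z / 2 * Complex.I) *
      Complex.Gamma (constA N γ m - z / 2 * Complex.I)) /
    (Complex.Gamma (constB N γ m + z / 2 * Complex.I) *
      Complex.Gamma (constB N γ m - z / 2 * Complex.I))

/-- The sharp constant `Λ_{N,γ}` of the fractional Hardy inequality in `ℝ ^ N`. -/
def hardyConst (N : ℕ) (γ : ℝ) : ℝ :=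
  (2 : ℝ) ^ (2 * γ) * Real.Gamma (((N : ℝ) + 2 * γ) / 4) ^ 2 /
    Real.Gamma (((N : ℝ) - 2 * γ) / 4) ^ 2

/-- The inverted symbol `1 / (Θ_m - κ)`. -/
def resolventSymbol (N : ℕ) (γ : ℝ) (m : ℕ) (κ : ℝ) (z : ℂ) : ℂ :=
  1 / (symbol N γ m z - κ)

/-- `ρ` is the residue of `f` at `c`: the integral of `f` over every small positively oriented
circle around `c` is `2 π i ρ`. -/
def HasResidue (f : ℂ → ℂ) (c ρ : ℂ) : Prop :=
  ∀ᶠ r : ℝ in 𝓝[>] 0, (∮ z in C(c, r), f z) = 2 * Real.pi * Complex.I * ρ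

/-- The one-dimensional Fourier transform, in the unitary normalization. -/
def fourierHat (φ : ℝ → ℂ) (ξ : ℝ) : ℂ :=
  ((1 / √(2 * Real.pi) : ℝ) : ℂ) * ∫ t : ℝ, Complex.exp (-(Complex.I * ξ * t)) * φ t

/-- `f` pairs absolutely with every Schwartz function (and so defines a tempered distribution). -/
def IsTemperedFun (f : ℝ → ℝ) : Prop :=
  ∀ φ : 𝓢(ℝ, ℂ), Integrable (fun t : ℝ => (f t : ℂ) * φ t)

/-- `P_γ^m w = g`, where `P_γ^m` is the Fourier multiplier with symbol `Θ_m`, read on the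
horizontal line `ℝ + iϑ`. The Fourier transform of `w` on that line is that of `e^{ϑ t} w(t)`,
so the relation is `Θ_m(ξ + iϑ) (e^{ϑ ·} w)^(ξ) = (e^{ϑ ·} g)^(ξ)`, as tempered distributions in
`ξ`: a test function `φ` on the right is paired with `χ = Θ_m(· + iϑ) φ` on the left, and
`⟨v^, χ⟩ = ⟨v, χ^⟩`. For `ϑ = 0` this is the usual Fourier multiplier. -/
def IsFracOp (N : ℕ) (γ : ℝ) (m : ℕ) (ϑ : ℝ) (w g : ℝ → ℝ) : Prop :=
  IsTemperedFun (fun t => Real.exp (ϑ * t) * w t) ∧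
  IsTemperedFun (fun t => Real.exp (ϑ * t) * g t) ∧
  ∀ φ χ : 𝓢(ℝ, ℂ),
    (∀ᵐ ξ : ℝ, χ ξ = symbol N γ m ((ξ : ℂ) + ϑ * Complex.I) * φ ξ) →
    ∫ t : ℝ, ((Real.exp (ϑ * t) * w t : ℝ) : ℂ) * fourierHat χ t =
      ∫ t : ℝ, ((Real.exp (ϑ * t) * g t : ℝ) : ℂ) * fourierHat φ t

/-- `w` solves `P_γ^m w - κ w = h`, the operator being read on the line `ℝ + iϑ`. -/
def IsSolution (N : ℕ) (γ : ℝ) (m : ℕ) (κ ϑ : ℝ) (w h : ℝ → ℝ) : Prop :=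
  IsFracOp N γ m ϑ w (fun t => κ * w t + h t)

/-- `e^{-σ_j t} [d_j cos (τ_j t) + d_j' sin (τ_j t)]`. -/
def mode (τ σ d d' : ℕ → ℝ) (j : ℕ) (t : ℝ) : ℝ :=
  Real.exp (-(σ j * t)) * (d j * Real.cos (τ j * t) + d' j * Real.sin (τ j * t))

/-- The Green's function `𝒢_m`. -/
def green (τ σ d d' : ℕ → ℝ) (t : ℝ) : ℝ :=
  d 0 * Real.exp (-(σ 0 * |t|)) + ∑' j : ℕ, mode τ σ d d' (j + 1) |t|

/-- The Green's function of the line lying between the `J`-th and the `J + 1`-st poles. -/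
def shiftedGreen (τ σ d d' : ℕ → ℝ) (J : ℕ) (t : ℝ) : ℝ :=
  if 0 < t then ∑' j : ℕ, mode τ σ d d' (J + 1 + j) t
  else green τ σ d d' t - ∑ j ∈ Finset.range (J + 1), mode τ σ d d' j t

/-- `∫ h(t') k(t - t') dt'`. -/
def convolve (h k : ℝ → ℝ) (t : ℝ) : ℝ := ∫ s : ℝ, h s * k (t - s)

/-- The coefficient functions `D_j(t)` of the multipole expansion. -/
def multipole (τ σ d d' : ℕ → ℝ) (h : ℝ → ℝ) (j : ℕ) (t : ℝ) : ℝ :=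
  -(d j *
      (Real.cos (τ j * t) * (∫ s in Set.Ioi t, Real.exp (σ j * s) * Real.cos (τ j * s) * h s) +
        Real.sin (τ j * t) * ∫ s in Set.Ioi t, Real.exp (σ j * s) * Real.sin (τ j * s) * h s) +
    d' j *
      (Real.sin (τ j * t) * (∫ s in Set.Ioi t, Real.exp (σ j * s) * Real.cos (τ j * s) * h s) -
        Real.cos (τ j * t) * ∫ s in Set.Ioi t, Real.exp (σ j * s) * Real.sin (τ j * s) * h s))

end HardyCylinder

end

noncomputable section

namespace HardyCylinder

/-! ### Partial fractions for interlacing products -/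

/-! The theorem rests on one structural fact: for `0 ≤ κ < Λ` all poles of `1 / (Θ_m - κ)` are
simple and purely imaginary, and the expansion `1 / (Θ_m(z) - κ) = ∑ d_j / (σ_j + i z) + ∑ d_j /
(σ_j - i z)` holds with `d_j > 0` and `∑ d_j / σ_j < ∞`. Hence every `τ_j` and `d_j'` vanishes, and
the Green's function is a sum of positive decaying exponentials. This is what `IsExpansion` records.

To prove it, Euler's limit for Γ exhibits `Θ_m` as a limit of rational functions of `x = z²` with
zeros `-4(B+k)²` and poles `-4(A+k)²`, which interlace because `A - B = γ` lies in `(0,1)`. Since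
`κ` is below the value at `x = 0`, the intermediate value theorem finds a root of "approximant `=
κ`" in each gap; these are as many as the degree, so there are no other roots, and interlacing makes
all partial fraction coefficients nonnegative (`exists_partial_fractions`). Normalized by their
value at `0`, the expansions have uniformly bounded mass, so roots and coefficients converge along a
subsequence (`exists_expansion_limit`). As `Θ_m → ∞` along the real axis, no constant term survives
(`exists_expansion_nonneg`). Finally `exists_symbol_root` finds a genuine root of `Θ_m = κ` in each
gap, which identifies the limiting nodes and forces the coefficients to be positive
(`exists_isExpansion`). The condition `κ < Λ` enters through monotonicity in `B` of the value at `0`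
(`gammaQuot_zero_mono`).

From the expansion, poles and residues are read off with the Weierstrass test, and the Green's
function is recovered by termwise Laplace transforms. Passing to the strip between two poles moves
the exponentials of the poles crossed from the right half-line to the left one, with opposite sign
(`stripKernel`, `fourier_stripKernel`). Convolution with an integrable weighted kernel solves the
equation by Fubini, the kernel being moved onto the test function. In the multipole expansion, the
moved exponentials produce exactly the terms `D_j`; what remains is convolution with a positive
kernel of rate `σ_0` on the left (`convolve_add_multipoles`), and splitting that integral gives the
three growth regimes. -/

theorem exists_root_of_mul_nonpos {f : ℝ → ℝ} {u v : ℝ} (huv : u ≤ v)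
    (hf : ContinuousOn f (Set.Icc u v)) (h : f u * f v ≤ 0) : ∃ x ∈ Set.Icc u v, f x = 0 := by
  rcases le_total (f u) 0 with hu | hu
  · rcases le_total 0 (f v) with hv | hv
    · exact intermediate_value_Icc huv hf ⟨hu, hv⟩
    · have : f u = 0 ∨ f v = 0 := by
        rw [← mul_eq_zero]; exact le_antisymm h (mul_nonneg_of_nonpos_of_nonpos hu hv)
      rcases this with h | h
      · exact ⟨u, ⟨le_rfl, huv⟩, h⟩
      · exact ⟨v, ⟨huv, le_rfl⟩, h⟩
  · rcases le_total (f v) 0 with hv | hv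
    · exact intermediate_value_Icc' huv hf ⟨hv, hu⟩
    · have : f u = 0 ∨ f v = 0 := by
        rw [← mul_eq_zero]; exact le_antisymm h (mul_nonneg hu hv)
      rcases this with h | h
      · exact ⟨u, ⟨le_rfl, huv⟩, h⟩
      · exact ⟨v, ⟨huv, le_rfl⟩, h⟩

section interlacing

variable {b p l : ℕ → ℝ}

theorem lower_strictMono (hl : ∀ k, l k < b k) (hb : ∀ k, b k < p k)
    (hs : ∀ k, l (k + 1) = p k) : StrictMono l :=
  strictMono_nat_of_lt_succ fun k => by rw [hs]; exact (hl k).trans (hb k)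

theorem upper_le_lower (hl : ∀ k, l k < b k) (hb : ∀ k, b k < p k)
    (hs : ∀ k, l (k + 1) = p k) {i k : ℕ} (h : i < k) : p i ≤ l k := by
  rw [← hs]; exact (lower_strictMono hl hb hs).monotone h

/-- At `b k` the first product vanishes, at `l (k + 1) = p k` the second, and at `l 0 = 0` the
hypothesis `hpos` decides the sign. Interlacing then gives values of opposite sign (or a zero) at
the two ends of `[l k, b k]`. The value at the left end is nonzero, whence the strict inequality
there. -/
theorem exists_interlacing_root (h0 : l 0 = 0) (hl : ∀ k, l k < b k) (hb : ∀ k, b k < p k)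
    (hs : ∀ k, l (k + 1) = p k) {κ : ℝ} (hκ : 0 ≤ κ) (n : ℕ)
    (hpos : κ * ∏ i ∈ Finset.range (n + 1), p i < ∏ i ∈ Finset.range (n + 1), b i)
    {k : ℕ} (hk : k < n + 1) :
    ∃ a, l k < a ∧ a ≤ b k ∧ ∏ i ∈ Finset.range (n + 1), (b i - a) =
      κ * ∏ i ∈ Finset.range (n + 1), (p i - a) := by
  set f : ℝ → ℝ := fun x => ∏ i ∈ Finset.range (n + 1), (b i - x) -
      κ * ∏ i ∈ Finset.range (n + 1), (p i - x) with hf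
  have hfb : f (b k) = -(κ * ∏ i ∈ Finset.range (n + 1), (p i - b k)) := by
    have : ∏ i ∈ Finset.range (n + 1), (b i - b k) = 0 :=
      Finset.prod_eq_zero (Finset.mem_range.2 hk) (sub_self _)
    simp [hf, this]
  have key : f (l k) * f (b k) ≤ 0 ∧ f (l k) ≠ 0 := by
    rcases k with _ | k
    · have h1 : 0 < f (l 0) := by simp only [hf, h0, sub_zero]; linarith
      have h2 : f (b 0) ≤ 0 := by
        rw [hfb, neg_nonpos]
        refine mul_nonneg hκ (Finset.prod_nonneg fun i _ => ?_)
        rcases i with _ | i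
        · linarith [hb 0]
        · linarith [hb 0, upper_le_lower hl hb hs (Nat.succ_pos i), hl (i + 1), hb (i + 1)]
      exact ⟨mul_nonpos_of_nonneg_of_nonpos h1.le h2, h1.ne'⟩
    · have hfl : f (l (k + 1)) = ∏ i ∈ Finset.range (n + 1), (b i - l (k + 1)) := by
        have : ∏ i ∈ Finset.range (n + 1), (p i - l (k + 1)) = 0 :=
          Finset.prod_eq_zero (Finset.mem_range.2 (by omega : k < n + 1)) (by rw [hs]; simp)
        simp [hf, this]
      refine ⟨?_, ?_⟩
      -- The two surviving products are multiplied factor by factor: in each pair both factors are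
      -- nonpositive for `i ≤ k` and nonnegative for `i > k`.
      · have : f (l (k + 1)) * f (b (k + 1)) =
            -(κ * ∏ i ∈ Finset.range (n + 1), ((b i - l (k + 1)) * (p i - b (k + 1)))) := by
          rw [hfl, hfb, Finset.prod_mul_distrib]; ring
        rw [this, neg_nonpos]
        refine mul_nonneg hκ (Finset.prod_nonneg fun i _ => ?_)
        rcases lt_or_ge i (k + 1) with h | h
        · have := upper_le_lower hl hb hs h
          exact mul_nonneg_of_nonpos_of_nonpos (by linarith [hb i]) (by linarith [hl (k + 1)])
        · have h1 : l (k + 1) ≤ l i := (lower_strictMono hl hb hs).monotone h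
          have h2 : b (k + 1) ≤ p i := by
            rcases eq_or_lt_of_le h with h | h
            · rw [← h]; exact (hb _).le
            · linarith [upper_le_lower hl hb hs h, hb (k + 1), hb i, hl i]
          exact mul_nonneg (by linarith [hl i]) (by linarith)
      · rw [hfl, Finset.prod_ne_zero_iff]
        intro i _
        rcases lt_or_ge i (k + 1) with h | h
        · have := upper_le_lower hl hb hs h
          exact ne_of_lt (by linarith [hb i])
        · have h1 : l (k + 1) ≤ l i := (lower_strictMono hl hb hs).monotone h
          exact ne_of_gt (by linarith [hl i])
  obtain ⟨a, ⟨ha1, ha2⟩, ha⟩ := exists_root_of_mul_nonpos (hl k).le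
    (by fun_prop : Continuous f).continuousOn key.1
  refine ⟨a, lt_of_le_of_ne ha1 fun h => key.2 (h ▸ ha), ha2, by simpa [hf, sub_eq_zero] using ha⟩

open Polynomial in
theorem degree_prod_sub_prod_lt (u v : ℕ → ℂ) (n : ℕ) :
    (∏ i ∈ Finset.range n, (X - C (u i)) - ∏ i ∈ Finset.range n, (X - C (v i))).degree < (n : WithBot ℕ) := by
  have h := fun w : ℕ → ℂ => monic_prod_X_sub_C w (Finset.range n)
  have hd : ∀ w : ℕ → ℂ, (∏ i ∈ Finset.range n, (X - C (w i))).degree = (n : WithBot ℕ) := fun w => by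
    rw [degree_prod]; simp
  have := degree_sub_lt_left (p := ∏ i ∈ Finset.range n, (X - C (u i)))
    (q := ∏ i ∈ Finset.range n, (X - C (v i))) (by rw [hd, hd]) (h u).ne_zero
    (by rw [(h u).leadingCoeff, (h v).leadingCoeff])
  rwa [hd] at this

open Polynomial in
/-- The partial fraction expansion of `1 / (∏ (x + b i) / (x + p i) - κ)`, for interlacing zeros
and poles. -/
theorem exists_partial_fractions (h0 : l 0 = 0) (hl : ∀ k, l k < b k) (hb : ∀ k, b k < p k)
    (hs : ∀ k, l (k + 1) = p k) {κ : ℝ} (hκ : 0 ≤ κ) (hκ1 : κ < 1) (n : ℕ)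
    (hpos : κ * ∏ i ∈ Finset.range (n + 1), p i < ∏ i ∈ Finset.range (n + 1), b i) :
    ∃ (a c : ℕ → ℝ), (∀ k, l k < a k ∧ a k ≤ b k) ∧ (∀ k, 0 ≤ c k) ∧
      ∀ x : ℂ, (∀ k, x ≠ -(p k : ℂ)) → (∀ k, x ≠ -(a k : ℂ)) →
        (∏ i ∈ Finset.range (n + 1), (b i + x) / (p i + x) - κ) *
          (1 / (1 - κ) + ∑ i ∈ Finset.range (n + 1), c i / (x + a i)) = 1 := by
  have hex : ∀ k, ∃ a, l k < a ∧ a ≤ b k ∧ (k < n + 1 → ∏ i ∈ Finset.range (n + 1), (b i - a) =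
      κ * ∏ i ∈ Finset.range (n + 1), (p i - a)) := fun k => by
    by_cases hk : k < n + 1
    · obtain ⟨a, h1, h2, h3⟩ := exists_interlacing_root h0 hl hb hs hκ n hpos hk
      exact ⟨a, h1, h2, fun _ => h3⟩
    · exact ⟨b k, hl k, le_rfl, fun h => absurd h hk⟩
  choose a ha1 ha2 ha3 using hex
  have hmono : StrictMono a := strictMono_nat_of_lt_succ fun k => by
    linarith [ha2 k, hb k, hs k, ha1 (k + 1)]
  -- This is the residue at `-a j` of `∏ (x + p k) / ∏ (x + a k)`. It is nonnegative because `a k -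
  -- a j` and `p k - a j` have the same sign for `k ≠ j`.
  set w : ℕ → ℝ := fun j => (∏ k ∈ (Finset.range (n + 1)).erase j, (a k - a j)⁻¹) *
    ∏ k ∈ Finset.range (n + 1), (p k - a j) with hw
  have hwpos : ∀ j ∈ Finset.range (n + 1), 0 ≤ w j := fun j hj => by
    have : w j = (p j - a j) * ∏ k ∈ (Finset.range (n + 1)).erase j,
        ((a k - a j)⁻¹ * (p k - a j)) := by
      simp only [hw]
      rw [Finset.prod_mul_distrib, ← Finset.mul_prod_erase _ _ hj]; ring
    rw [this]
    refine mul_nonneg (by linarith [ha2 j, hb j]) (Finset.prod_nonneg fun k hk => ?_)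
    rcases lt_or_gt_of_ne (Finset.ne_of_mem_erase hk) with h | h
    · have h1 := upper_le_lower hl hb hs h
      exact mul_nonneg_of_nonpos_of_nonpos (inv_nonpos.2 (by linarith [hmono h]))
        (by linarith [ha1 j])
    · have h1 := hmono h
      exact mul_nonneg (inv_nonneg.2 (by linarith)) (by linarith [ha2 k, hb k])
  refine ⟨a, fun j => if j < n + 1 then w j / (1 - κ) else 0, fun k => ⟨ha1 k, ha2 k⟩,
    fun k => ?_, fun x hxp hxa => ?_⟩
  · beta_reduce
    split_ifs with h
    · exact div_nonneg (hwpos k (Finset.mem_range.2 h)) (by linarith)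
    · exact le_rfl
  set P : ℂ[X] := ∏ i ∈ Finset.range (n + 1), (X - C (-(b i : ℂ)))
  set Q : ℂ[X] := ∏ i ∈ Finset.range (n + 1), (X - C (-(p i : ℂ)))
  set A : ℂ[X] := ∏ i ∈ Finset.range (n + 1), (X - C (-(a i : ℂ)))
  have hPe : ∀ y, P.eval y = ∏ i ∈ Finset.range (n + 1), (b i + y) := fun y => by
    simp [P, eval_prod, add_comm]
  have hQe : ∀ y, Q.eval y = ∏ i ∈ Finset.range (n + 1), (p i + y) := fun y => by
    simp [Q, eval_prod, add_comm]
  have hAe : ∀ y, A.eval y = ∏ i ∈ Finset.range (n + 1), (a i + y) := fun y => by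
    simp [A, eval_prod, add_comm]
  have hinj : Set.InjOn (fun j => -(a j : ℂ)) (Finset.range (n + 1) : Finset ℕ) := fun i _ j _ h =>
    hmono.injective (by simpa using h)
  have hAroot : ∀ i ∈ Finset.range (n + 1), A.eval (-(a i : ℂ)) = 0 := fun i hi => by
    rw [hAe]; exact Finset.prod_eq_zero hi (by ring)
  -- Both sides have leading coefficient `1 - κ` and vanish at the `n + 1` points `-a i`; their
  -- difference has degree below `n + 1`. Hence the inverse sought is `Q / ((1 - κ) A)`.
  have hR : P - C (κ : ℂ) * Q = C (1 - κ : ℂ) * A := by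
    rw [← sub_eq_zero]
    have e : P - C (κ : ℂ) * Q - C (1 - κ : ℂ) * A = (P - A) - C (κ : ℂ) * (Q - A) := by
      simp only [C_sub, C_1]; ring
    refine eq_zero_of_degree_lt_of_eval_index_eq_zero (Finset.range (n + 1)) hinj ?_ ?_
    · rw [e, Finset.card_range]
      refine (degree_sub_le _ _).trans_lt (max_lt (degree_prod_sub_prod_lt _ _ _) ?_)
      refine lt_of_le_of_lt ?_ (degree_prod_sub_prod_lt (fun i => -(p i : ℂ)) (fun i => -(a i : ℂ)) _)
      rw [← smul_eq_C_mul]; exact degree_smul_le _ _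
    · intro i hi
      have h1 := ha3 i (Finset.mem_range.1 hi)
      have h2 : P.eval (-(a i : ℂ)) = κ * Q.eval (-(a i : ℂ)) := by
        rw [hPe, hQe]
        simp only [← sub_eq_add_neg]
        exact_mod_cast congrArg (Complex.ofReal) h1
      simp [hAroot i hi, h2]
  -- Lagrange interpolation of `Q - A` at the roots of `A` is the partial fraction expansion of `Q /
  -- A - 1`.
  have hE : Q - A = Lagrange.interpolate (Finset.range (n + 1)) (fun j => -(a j : ℂ))
      (fun j => Q.eval (-(a j : ℂ))) := by
    refine Lagrange.eq_interpolate_of_eval_eq _ hinj ?_ ?_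
    · rw [Finset.card_range]; exact degree_prod_sub_prod_lt _ _ _
    · intro i hi; simp [hAroot i hi]
  have hEx := Lagrange.eval_interpolate_not_at_node (s := Finset.range (n + 1))
    (v := fun j => -(a j : ℂ)) (fun j => Q.eval (-(a j : ℂ))) (x := x) (fun i _ => hxa i)
  rw [← hE, Lagrange.eval_nodal] at hEx
  have hsum : ∑ i ∈ Finset.range (n + 1), Lagrange.nodalWeight (Finset.range (n + 1))
      (fun j => -(a j : ℂ)) i * (x - -(a i : ℂ))⁻¹ * Q.eval (-(a i : ℂ)) =
      ∑ i ∈ Finset.range (n + 1), (w i : ℂ) / (x + a i) := by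
    refine Finset.sum_congr rfl fun i _ => ?_
    rw [hQe, hw, Lagrange.nodalWeight]
    push_cast
    simp only [← sub_eq_add_neg, sub_neg_eq_add]
    rw [div_eq_mul_inv]
    have : ∀ j, (-(a i : ℂ) + a j) = a j - a i := fun j => by ring
    simp only [this]
    ring
  have hnod : ∏ i ∈ Finset.range (n + 1), (x - -(a i : ℂ)) = A.eval x := by
    rw [hAe]; exact Finset.prod_congr rfl fun i _ => by ring
  rw [hsum, hnod, eval_sub] at hEx
  have hQ0 : Q.eval x ≠ 0 := by
    rw [hQe, Finset.prod_ne_zero_iff]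
    intro i _ h; exact hxp i (by linear_combination h)
  have hA0 : A.eval x ≠ 0 := by
    rw [hAe, Finset.prod_ne_zero_iff]
    intro i _ h; exact hxa i (by linear_combination h)
  have hκ' : (1 - κ : ℂ) ≠ 0 := by
    rw [sub_ne_zero]; exact_mod_cast hκ1.ne'
  have hc : ∑ i ∈ Finset.range (n + 1), ((if i < n + 1 then w i / (1 - κ) else 0 : ℝ) : ℂ) /
      (x + a i) = (∑ i ∈ Finset.range (n + 1), (w i : ℂ) / (x + a i)) / (1 - κ) := by
    rw [Finset.sum_div]
    refine Finset.sum_congr rfl fun i hi => ?_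
    rw [if_pos (Finset.mem_range.1 hi)]; push_cast; ring
  have hRx := congrArg (Polynomial.eval x) hR
  simp only [eval_sub, eval_mul, eval_C] at hRx
  rw [hc, Finset.prod_div_distrib, ← hPe, ← hQe]
  generalize (∑ i ∈ Finset.range (n + 1), (w i : ℂ) / (x + a i)) = T at *
  have : P.eval x / Q.eval x - κ = (1 - κ) * A.eval x / Q.eval x := by
    rw [← hRx]; field_simp
  rw [this]
  field_simp
  linear_combination -hEx

end interlacing

/-! ### Rational approximation of the symbol -/

/-- Quotient of Gamma functions, as a function of `A` and `B`. -/
def gammaQuot (A B γ : ℝ) (z : ℂ) : ℂ :=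
  (((2 : ℝ) ^ (2 * γ) : ℝ) : ℂ) *
    (Complex.Gamma (A + z / 2 * Complex.I) * Complex.Gamma (A - z / 2 * Complex.I)) /
    (Complex.Gamma (B + z / 2 * Complex.I) * Complex.Gamma (B - z / 2 * Complex.I))

/-- The rational functions of `z ^ 2` that come from Euler's limit for the Gamma function. -/
def approx (A B γ : ℝ) (n : ℕ) (x : ℂ) : ℂ :=
  (((2 * n : ℝ) ^ (2 * γ) : ℝ) : ℂ) *
    ∏ k ∈ Finset.range (n + 1), (((4 * (B + k) ^ 2 : ℝ) : ℂ) + x) / (((4 * (A + k) ^ 2 : ℝ) : ℂ) + x)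

theorem prod_gammaSeq_factors (A : ℝ) (z : ℂ) (n : ℕ) :
    (∏ j ∈ Finset.range (n + 1), (A + z / 2 * Complex.I + j)) *
      (∏ j ∈ Finset.range (n + 1), (A - z / 2 * Complex.I + j)) =
      (4 ^ (n + 1))⁻¹ * ∏ k ∈ Finset.range (n + 1), (((4 * (A + k) ^ 2 : ℝ) : ℂ) + z ^ 2) := by
  rw [← Finset.prod_mul_distrib]
  have : (4 ^ (n + 1) : ℂ)⁻¹ = ∏ k ∈ Finset.range (n + 1), (4 : ℂ)⁻¹ := by simp
  rw [this, ← Finset.prod_mul_distrib]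
  refine Finset.prod_congr rfl fun k _ => ?_
  push_cast
  linear_combination (-z ^ 2 / 4) * Complex.I_sq

theorem gammaSeq_mul_gammaSeq (A : ℝ) (z : ℂ) {n : ℕ} (hn : n ≠ 0) :
    Complex.GammaSeq (A + z / 2 * Complex.I) n * Complex.GammaSeq (A - z / 2 * Complex.I) n =
      (((n : ℝ) ^ (2 * A) : ℝ) : ℂ) * (n.factorial ^ 2 * 4 ^ (n + 1)) *
        (∏ k ∈ Finset.range (n + 1), (((4 * (A + k) ^ 2 : ℝ) : ℂ) + z ^ 2))⁻¹ := by
  have hn' : (n : ℂ) ≠ 0 := Nat.cast_ne_zero.2 hn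
  have h1 : (n : ℂ) ^ (A + z / 2 * Complex.I) * (n : ℂ) ^ (A - z / 2 * Complex.I) =
      (((n : ℝ) ^ (2 * A) : ℝ) : ℂ) := by
    rw [← Complex.cpow_add _ _ hn', Complex.ofReal_cpow (Nat.cast_nonneg n)]
    congr 1
    push_cast; ring
  have h2 := prod_gammaSeq_factors A z n
  rw [Complex.GammaSeq, Complex.GammaSeq, div_mul_div_comm, h2, div_eq_mul_inv, mul_inv, inv_inv,
    ← h1]
  ring

/-- The factorials and powers of `4` cancel in the quotient, and the powers of `n` combine to `n ^
(2A - 2B) = n ^ (2γ)`, independent of `z`. -/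
theorem gammaSeq_quot_eq_approx {A B γ : ℝ} (hAB : A = B + γ) (z : ℂ) {n : ℕ} (hn : n ≠ 0) :
    (((2 : ℝ) ^ (2 * γ) : ℝ) : ℂ) *
      (Complex.GammaSeq (A + z / 2 * Complex.I) n * Complex.GammaSeq (A - z / 2 * Complex.I) n) /
      (Complex.GammaSeq (B + z / 2 * Complex.I) n * Complex.GammaSeq (B - z / 2 * Complex.I) n) =
      approx A B γ n (z ^ 2) := by
  have hn' : (0 : ℝ) < n := Nat.cast_pos.2 (Nat.pos_of_ne_zero hn)
  rw [gammaSeq_mul_gammaSeq A z hn, gammaSeq_mul_gammaSeq B z hn, approx, Finset.prod_div_distrib,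
    Real.mul_rpow zero_le_two hn'.le]
  have h1 : (n : ℝ) ^ (2 * A) = n ^ (2 * γ) * n ^ (2 * B) := by
    rw [← Real.rpow_add hn', hAB]; ring_nf
  have h2 : (((n : ℝ) ^ (2 * B) : ℝ) : ℂ) ≠ 0 := by
    exact_mod_cast (Real.rpow_pos_of_pos hn' _).ne'
  have h3 : ((n.factorial : ℂ) ^ 2 * 4 ^ (n + 1)) ≠ 0 := by
    have : (n.factorial : ℂ) ≠ 0 := by exact_mod_cast n.factorial_ne_zero
    exact mul_ne_zero (pow_ne_zero _ this) (pow_ne_zero _ (by norm_num))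
  rw [h1]
  generalize ∏ k ∈ Finset.range (n + 1), (((4 * (A + k) ^ 2 : ℝ) : ℂ) + z ^ 2) = PA
  generalize ∏ k ∈ Finset.range (n + 1), (((4 * (B + k) ^ 2 : ℝ) : ℂ) + z ^ 2) = PB
  rw [div_eq_mul_inv, div_eq_mul_inv, mul_inv, mul_inv, inv_inv]
  push_cast
  calc _ = (((2 : ℝ) ^ (2 * γ) : ℝ) : ℂ) * (((n : ℝ) ^ (2 * γ) : ℝ) : ℂ) *
        ((((n : ℝ) ^ (2 * B) : ℝ) : ℂ) * (((n : ℝ) ^ (2 * B) : ℝ) : ℂ)⁻¹) *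
        (((n.factorial : ℂ) ^ 2 * 4 ^ (n + 1)) * ((n.factorial : ℂ) ^ 2 * 4 ^ (n + 1))⁻¹) *
        (PB * PA⁻¹) := by ring
    _ = _ := by rw [mul_inv_cancel₀ h2, mul_inv_cancel₀ h3]; ring

theorem approx_eventually_zero {A B γ : ℝ} {x : ℂ} {k : ℕ}
    (h : ((4 * (B + k) ^ 2 : ℝ) : ℂ) + x = 0) : ∀ᶠ n in atTop, approx A B γ n x = 0 := by
  filter_upwards [eventually_ge_atTop k] with n hn
  rw [approx, Finset.prod_eq_zero (Finset.mem_range.2 (Nat.lt_succ_of_le hn)), mul_zero]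
  rw [h, zero_div]

theorem tendsto_approx {A B γ : ℝ} (hAB : A = B + γ) (z : ℂ) :
    Tendsto (fun n => approx A B γ n (z ^ 2)) atTop (𝓝 (gammaQuot A B γ z)) := by
  -- `Complex.Gamma` is `0` at its poles, so a zero of the symbol appears here as a division by `0`.
  -- The value `0` is the right one: the approximants eventually contain the vanishing factor.
  by_cases h : Complex.Gamma (B + z / 2 * Complex.I) * Complex.Gamma (B - z / 2 * Complex.I) = 0
  · have hz : gammaQuot A B γ z = 0 := by rw [gammaQuot, h, div_zero]
    rw [hz]
    have : ∃ k : ℕ, ((4 * (B + k) ^ 2 : ℝ) : ℂ) + z ^ 2 = 0 := by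
      rcases mul_eq_zero.1 h with h | h <;> rw [Complex.Gamma_eq_zero_iff] at h <;>
        obtain ⟨k, hk⟩ := h <;> refine ⟨k, ?_⟩ <;> push_cast
      · have : (B + k : ℂ) = -(z / 2 * Complex.I) := by linear_combination hk
        rw [this]; linear_combination z ^ 2 * Complex.I_sq
      · have : (B + k : ℂ) = z / 2 * Complex.I := by linear_combination hk
        rw [this]; linear_combination z ^ 2 * Complex.I_sq
    obtain ⟨k, hk⟩ := this
    exact tendsto_const_nhds.congr' ((approx_eventually_zero hk).mono fun n hn => hn.symm)
  · have := ((tendsto_const_nhds (x := (((2 : ℝ) ^ (2 * γ) : ℝ) : ℂ))).mul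
      ((Complex.GammaSeq_tendsto_Gamma (A + z / 2 * Complex.I)).mul
        (Complex.GammaSeq_tendsto_Gamma (A - z / 2 * Complex.I)))).div
      ((Complex.GammaSeq_tendsto_Gamma (B + z / 2 * Complex.I)).mul
        (Complex.GammaSeq_tendsto_Gamma (B - z / 2 * Complex.I))) h
    refine this.congr' ?_
    filter_upwards [eventually_ne_atTop 0] with n hn
    exact gammaSeq_quot_eq_approx hAB z hn

/-- Real version of `approx`, at nonnegative arguments. -/
def approxReal (A B γ : ℝ) (n : ℕ) (x : ℝ) : ℝ :=
  (2 * n : ℝ) ^ (2 * γ) *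
    ∏ k ∈ Finset.range (n + 1), (4 * (B + k) ^ 2 + x) / (4 * (A + k) ^ 2 + x)

theorem approx_ofReal (A B γ : ℝ) (n : ℕ) (x : ℝ) :
    approx A B γ n x = (approxReal A B γ n x : ℂ) := by
  simp [approx, approxReal]

theorem tendsto_approxReal {A B γ : ℝ} (hAB : A = B + γ) (y : ℝ) :
    Tendsto (fun n => approxReal A B γ n (y ^ 2)) atTop (𝓝 (gammaQuot A B γ y).re) := by
  have := (Complex.continuous_re.tendsto _).comp (tendsto_approx hAB (y : ℂ))
  refine this.congr fun n => ?_
  have := approx_ofReal A B γ n (y ^ 2)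
  push_cast at this
  simp [this]

theorem gammaQuot_zero {A B γ : ℝ} :
    gammaQuot A B γ 0 = ((2 ^ (2 * γ) * Real.Gamma A ^ 2 / Real.Gamma B ^ 2 : ℝ) : ℂ) := by
  simp only [gammaQuot, zero_div, zero_mul, add_zero, sub_zero, Complex.Gamma_ofReal]
  push_cast; ring

/-- At `0` the approximants are products of `((B + k) / (B + γ + k)) ^ 2`, each increasing in `B`.
This reduces the bound on `κ` for all spherical modes to a single constant. -/
theorem gammaQuot_zero_mono {B B' γ : ℝ} (hB : 0 < B) (hγ : 0 ≤ γ) (h : B ≤ B') :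
    (gammaQuot (B + γ) B γ 0).re ≤ (gammaQuot (B' + γ) B' γ 0).re := by
  have h1 := tendsto_approxReal (rfl : B + γ = B + γ) 0
  have h2 := tendsto_approxReal (rfl : B' + γ = B' + γ) 0
  refine le_of_tendsto_of_tendsto' h1 h2 fun n => ?_
  unfold approxReal
  have hB' : 0 < B' := hB.trans_le h
  refine mul_le_mul_of_nonneg_left (Finset.prod_le_prod (fun k _ => by positivity) fun k _ => ?_)
    (by positivity)
  simp only [ne_eq, OfNat.ofNat_ne_zero, not_false_eq_true, zero_pow, add_zero]
  have hk : (0 : ℝ) ≤ k := Nat.cast_nonneg k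
  rw [mul_div_mul_left _ _ four_ne_zero, mul_div_mul_left _ _ four_ne_zero, ← div_pow, ← div_pow]
  refine pow_le_pow_left₀ (by positivity) ?_ 2
  rw [div_le_div_iff₀ (by positivity) (by positivity)]
  nlinarith

/-- The approximant at `0` is `(2n) ^ (2γ)` divided by this product and has a positive limit, so the
product grows like `n ^ (2γ)`. -/
theorem prod_poles_div_zeros_tendsto {B γ : ℝ} (hB : 0 < B) (hγ : 0 < γ) :
    Tendsto (fun n : ℕ => ∏ k ∈ Finset.range (n + 1),
      ((4 * (B + γ + k) ^ 2 : ℝ) / (4 * (B + k) ^ 2))) atTop atTop := by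
  have h1 := tendsto_approxReal (rfl : B + γ = B + γ) 0
  have hpos : 0 < (gammaQuot (B + γ) B γ ((0 : ℝ) : ℂ)).re := by
    rw [Complex.ofReal_zero, gammaQuot_zero, Complex.ofReal_re]
    have := Real.Gamma_pos_of_pos hB
    have := Real.Gamma_pos_of_pos (add_pos hB hγ)
    positivity
  have h2 : Tendsto (fun n : ℕ => (2 * n : ℝ) ^ (2 * γ)) atTop atTop :=
    (tendsto_rpow_atTop (by positivity : 0 < 2 * γ)).comp
      (tendsto_natCast_atTop_atTop.const_mul_atTop (by norm_num))
  have h3 := h2.atTop_mul_pos (inv_pos.2 hpos) (h1.inv₀ hpos.ne')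
  refine h3.congr' ?_
  filter_upwards [eventually_ne_atTop 0] with n hn
  have : (0 : ℝ) < n := Nat.cast_pos.2 (Nat.pos_of_ne_zero hn)
  have : (0 : ℝ) < (2 * n : ℝ) ^ (2 * γ) := by positivity
  simp only [approxReal, ne_eq, OfNat.ofNat_ne_zero, not_false_eq_true, zero_pow, add_zero, mul_inv]
  rw [mul_inv_cancel_left₀ this.ne', ← Finset.prod_inv_distrib]
  simp only [inv_div]

/-- The symbol tends to infinity along the real axis. -/
theorem exists_gammaQuot_gt {B γ : ℝ} (hB : 0 < B) (hγ : 0 < γ) (M : ℝ) :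
    ∃ Y : ℝ, ∀ y ≥ Y, M < (gammaQuot (B + γ) B γ y).re := by
  -- The `k`-th factor relative to its value at `0`. It is at least `1` and tends to pole over zero
  -- as `x → ∞`, so finitely many factors already make the symbol exceed `M`, and the others may be
  -- dropped.
  set q : ℕ → ℝ → ℝ := fun k x => ((4 * (B + k) ^ 2 + x) / (4 * (B + γ + k) ^ 2 + x)) /
    ((4 * (B + k) ^ 2) / (4 * (B + γ + k) ^ 2)) with hq
  have hq1 : ∀ k x, 0 ≤ x → 1 ≤ q k x := fun k x hx => by
    have h1 : (0 : ℝ) < 4 * (B + k) ^ 2 := by positivity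
    have h2 : 4 * (B + k) ^ 2 ≤ 4 * (B + γ + k) ^ 2 := by
      have : (0 : ℝ) ≤ k := Nat.cast_nonneg k
      gcongr; linarith
    rw [hq]
    dsimp only
    rw [one_le_div (by positivity), div_le_div_iff₀ (by positivity) (by positivity)]
    nlinarith
  have hlim : ∀ k, Tendsto (fun y : ℝ => q k (y ^ 2)) atTop
      (𝓝 ((4 * (B + γ + k) ^ 2) / (4 * (B + k) ^ 2))) := fun k => by
    have h1 : (0 : ℝ) < 4 * (B + k) ^ 2 := by positivity
    have h2 : (0 : ℝ) < 4 * (B + γ + k) ^ 2 := by positivity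
    have ht : Tendsto (fun y : ℝ => (4 * (B + γ + k) ^ 2 + y ^ 2)) atTop atTop :=
      tendsto_atTop_add_const_left _ _ (tendsto_pow_atTop two_ne_zero)
    have := (((tendsto_const_nhds (x := 4 * (B + k) ^ 2 - 4 * (B + γ + k) ^ 2)).div_atTop
      ht).const_add 1).div_const ((4 * (B + k) ^ 2) / (4 * (B + γ + k) ^ 2))
    rw [add_zero, one_div_div] at this
    refine this.congr fun y => ?_
    rw [hq]
    dsimp only
    congr 1
    have : 4 * (B + γ + k) ^ 2 + y ^ 2 ≠ 0 := by positivity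
    field_simp
    ring
  have h1 := tendsto_approxReal (rfl : B + γ = B + γ) 0
  set F0 := (gammaQuot (B + γ) B γ ((0 : ℝ) : ℂ)).re with hF0
  have hpos : 0 < F0 := by
    rw [hF0, Complex.ofReal_zero, gammaQuot_zero, Complex.ofReal_re]
    have := Real.Gamma_pos_of_pos hB
    have := Real.Gamma_pos_of_pos (add_pos hB hγ)
    positivity
  obtain ⟨K, hK⟩ := ((prod_poles_div_zeros_tendsto hB hγ).eventually
    (eventually_gt_atTop (M / F0))).exists
  have hprod := tendsto_finsetProd (Finset.range (K + 1)) fun k _ => hlim k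
  obtain ⟨Y, hY⟩ := eventually_atTop.1 (hprod.eventually (eventually_gt_nhds hK))
  refine ⟨Y, fun y hy => ?_⟩
  have h2 := tendsto_approxReal (rfl : B + γ = B + γ) y
  have hle : F0 * ∏ k ∈ Finset.range (K + 1), q k (y ^ 2) ≤ (gammaQuot (B + γ) B γ y).re := by
    refine le_of_tendsto_of_tendsto (h1.mul_const _) h2 ?_
    filter_upwards [eventually_ge_atTop K] with n hn
    have e : approxReal (B + γ) B γ n (y ^ 2) =
        approxReal (B + γ) B γ n (0 ^ 2) * ∏ k ∈ Finset.range (n + 1), q k (y ^ 2) := by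
      simp only [approxReal, mul_assoc, hq]
      rw [← Finset.prod_mul_distrib]
      congr 1
      refine Finset.prod_congr rfl fun k _ => ?_
      have : (4 * (B + k) ^ 2) / (4 * (B + γ + k) ^ 2) ≠ 0 := by positivity
      simp only [ne_eq, OfNat.ofNat_ne_zero, not_false_eq_true, zero_pow, add_zero]
      field_simp
    rw [e]
    have hnn : 0 ≤ approxReal (B + γ) B γ n (0 ^ 2) := by
      unfold approxReal
      exact mul_nonneg (by positivity) (Finset.prod_nonneg fun k _ => by positivity)
    refine mul_le_mul_of_nonneg_left ?_ hnn
    refine Finset.prod_le_prod_of_subset_of_one_le ?_ ?_ ?_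
    · exact Finset.range_subset_range.2 (by omega)
    · exact fun k _ => zero_le_one.trans (hq1 k _ (sq_nonneg y))
    · exact fun k _ _ => hq1 k _ (sq_nonneg y)
  refine lt_of_lt_of_le ?_ hle
  have := hY y hy
  rw [div_lt_iff₀ hpos] at this
  linarith

/-! ### The partial fraction expansion of the inverted symbol -/

/-- The squares of the zero and of the poles of the symbol: left ends of the intervals in which
the roots lie. -/
def lowerEnd (A : ℝ) : ℕ → ℝ
  | 0 => 0
  | k + 1 => 4 * (A + k) ^ 2

/-- Quadratic growth of the nodes, uniform over the approximants: the source of the dominated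
convergence below. -/
theorem sq_le_lowerEnd {A : ℝ} (hA : 1 / 2 ≤ A) (k : ℕ) : (k : ℝ) ^ 2 ≤ lowerEnd A k := by
  rcases k with _ | k
  · simp [lowerEnd]
  · have hk : (0 : ℝ) ≤ k := Nat.cast_nonneg k
    simp only [lowerEnd]
    push_cast
    nlinarith

theorem lowerEnd_lt {B γ : ℝ} (hB : 0 < B) (hγ1 : γ < 1) (hA : 0 < B + γ) (k : ℕ) :
    lowerEnd (B + γ) k < 4 * (B + k) ^ 2 := by
  rcases k with _ | k
  · simp only [lowerEnd]; positivity
  · have hk : (0 : ℝ) ≤ k := Nat.cast_nonneg k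
    simp only [lowerEnd]
    push_cast
    gcongr 4 * ?_ ^ 2
    linarith

theorem zero_lt_pole {B γ : ℝ} (hB : 0 < B) (hγ : 0 < γ) (k : ℕ) :
    4 * (B + k) ^ 2 < 4 * (B + γ + k) ^ 2 := by
  have hk : (0 : ℝ) ≤ k := Nat.cast_nonneg k
  gcongr 4 * ?_ ^ 2
  linarith

/-- The prefactor `M = (2n) ^ (2γ)` is divided out, so the threshold becomes `κ / M`. Rewriting `c /
(x + a)` as `c / a - x c / (a (x + a))` isolates the value at `x = 0`; the coefficients `e = c / (a
M)` then have total mass at most that value, a bound that survives `n → ∞`. -/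
theorem exists_expansion_approx {B γ κ : ℝ} (hB : 0 < B) (hγ : 0 < γ) (hγ1 : γ < 1) (hκ : 0 ≤ κ)
    {n : ℕ} (hn : n ≠ 0) (hF : κ < approxReal (B + γ) B γ n 0) :
    ∃ a e : ℕ → ℝ, (∀ k, lowerEnd (B + γ) k < a k ∧ a k ≤ 4 * (B + k) ^ 2) ∧ (∀ k, 0 ≤ e k) ∧
      (∀ s : Finset ℕ, ∑ k ∈ s, e k ≤ 1 / (approxReal (B + γ) B γ n 0 - κ)) ∧
      ∀ x : ℂ, (∀ k : ℕ, x ≠ -((4 * (B + γ + k) ^ 2 : ℝ) : ℂ)) → (∀ k, x ≠ -(a k : ℂ)) →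
        (approx (B + γ) B γ n x - κ) *
          (((1 / (approxReal (B + γ) B γ n 0 - κ) : ℝ) : ℂ) - x * ∑' k, e k / (x + a k)) = 1 := by
  have hn' : (0 : ℝ) < n := Nat.cast_pos.2 (Nat.pos_of_ne_zero hn)
  have hA : 0 < B + γ := add_pos hB hγ
  set M : ℝ := (2 * n : ℝ) ^ (2 * γ) with hM
  have hMpos : 0 < M := by positivity
  set b : ℕ → ℝ := fun k => 4 * (B + k) ^ 2 with hb
  set p : ℕ → ℝ := fun k => 4 * (B + γ + k) ^ 2 with hp
  have hbp : ∀ k, b k < p k := fun k => zero_lt_pole hB hγ k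
  have hbpos : ∀ k, 0 < b k := fun k => by simp only [hb]; positivity
  have hppos : ∀ k, 0 < p k := fun k => (hbpos k).trans (hbp k)
  have hprodp : 0 < ∏ i ∈ Finset.range (n + 1), p i := Finset.prod_pos fun i _ => hppos i
  have hF' : approxReal (B + γ) B γ n 0 = M * ∏ i ∈ Finset.range (n + 1), b i / p i := by
    simp [approxReal, hM, hb, hp]
  have hlt1 : ∏ i ∈ Finset.range (n + 1), b i / p i ≤ 1 :=
    Finset.prod_le_one (fun i _ => (div_pos (hbpos i) (hppos i)).le)
      fun i _ => (div_le_one (hppos i)).2 (hbp i).le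
  have hκM : κ / M < ∏ i ∈ Finset.range (n + 1), b i / p i := by
    rw [div_lt_iff₀ hMpos]; rw [hF'] at hF; linarith
  have hκ1 : κ / M < 1 := hκM.trans_le hlt1
  obtain ⟨a, c, ha, hc, hid⟩ := exists_partial_fractions (b := b) (p := p) (l := lowerEnd (B + γ))
    rfl (lowerEnd_lt hB hγ1 hA) hbp (fun k => rfl) (div_nonneg hκ hMpos.le) hκ1 n (by
      rwa [Finset.prod_div_distrib, lt_div_iff₀ hprodp] at hκM)
  have hapos : ∀ k, 0 < a k := fun k => lt_of_le_of_lt (by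
    rcases k with _ | k
    · exact le_rfl
    · simp only [lowerEnd]; positivity) (ha k).1
  set G0 : ℝ := 1 / (1 - κ / M) + ∑ i ∈ Finset.range (n + 1), c i / a i with hG0
  have h0 : ((∏ i ∈ Finset.range (n + 1), b i / p i) - κ / M) * G0 = 1 := by
    have := hid 0 (fun k h => by
        have := hppos k; rw [eq_comm, neg_eq_zero] at h
        exact this.ne' (by exact_mod_cast h)) (fun k h => by
        have := hapos k; rw [eq_comm, neg_eq_zero] at h
        exact this.ne' (by exact_mod_cast h))
    simp only [add_zero, zero_add] at this
    rw [hG0]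
    exact_mod_cast this
  have hH : 1 / (approxReal (B + γ) B γ n 0 - κ) = G0 / M := by
    have : approxReal (B + γ) B γ n 0 - κ = M * ((∏ i ∈ Finset.range (n + 1), b i / p i) - κ / M) := by
      rw [hF']; field_simp
    have h1 : (∏ i ∈ Finset.range (n + 1), b i / p i) - κ / M ≠ 0 := left_ne_zero_of_mul_eq_one h0
    rw [this, ← eq_inv_of_mul_eq_one_right h0 |>.symm]
    field_simp
  rw [hH]
  set e : ℕ → ℝ := fun k => if k < n + 1 then c k / (a k * M) else 0 with he
  have he0 : ∀ k, 0 ≤ e k := fun k => by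
    simp only [he]; split_ifs
    · exact div_nonneg (hc k) (mul_nonneg (hapos k).le hMpos.le)
    · exact le_rfl
  have hesum : ∑ k ∈ Finset.range (n + 1), e k =
      (∑ i ∈ Finset.range (n + 1), c i / a i) / M := by
    rw [Finset.sum_div]
    refine Finset.sum_congr rfl fun i hi => ?_
    simp only [he, if_pos (Finset.mem_range.1 hi), div_div]
  refine ⟨a, e, ha, he0, fun s => ?_, fun x hxp hxa => ?_⟩
  · calc ∑ k ∈ s, e k ≤ ∑ k ∈ s ∪ Finset.range (n + 1), e k :=
        Finset.sum_le_sum_of_subset_of_nonneg Finset.subset_union_left fun k _ _ => he0 k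
      _ = ∑ k ∈ Finset.range (n + 1), e k := by
        refine (Finset.sum_subset Finset.subset_union_right fun k _ hk => ?_).symm
        simp only [he, if_neg fun h => hk (Finset.mem_range.2 h)]
      _ ≤ G0 / M := by
        rw [hesum, hG0]
        have : 0 ≤ 1 / (1 - κ / M) := one_div_nonneg.2 (by linarith)
        gcongr; linarith
  · have h1 := hid x hxp hxa
    have hts : ∑' k, (e k : ℂ) / (x + a k) =
        (∑ i ∈ Finset.range (n + 1), (c i : ℂ) / (a i * (x + a i))) / M := by
      rw [tsum_eq_sum (s := Finset.range (n + 1)), Finset.sum_div]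
      · refine Finset.sum_congr rfl fun i hi => ?_
        simp only [he, if_pos (Finset.mem_range.1 hi)]
        push_cast
        rw [div_div, div_div]; ring_nf
      · intro k hk
        simp only [he, if_neg fun h => hk (Finset.mem_range.2 h)]
        simp
    have hGx : (1 / (1 - ((κ / M : ℝ) : ℂ)) + ∑ i ∈ Finset.range (n + 1), (c i : ℂ) / (x + a i)) =
        G0 - x * ∑ i ∈ Finset.range (n + 1), (c i : ℂ) / (a i * (x + a i)) := by
      rw [hG0]
      push_cast
      rw [add_sub_assoc, Finset.mul_sum, ← Finset.sum_sub_distrib]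
      congr 1
      refine Finset.sum_congr rfl fun i _ => ?_
      have h1 : (a i : ℂ) ≠ 0 := by exact_mod_cast (hapos i).ne'
      have h2 : x + a i ≠ 0 := fun h => hxa i (by linear_combination h)
      field_simp
      ring
    have hap : approx (B + γ) B γ n x =
        M * ∏ i ∈ Finset.range (n + 1), ((b i : ℂ) + x) / (p i + x) := by
      simp [approx, hM, hb, hp]
    have hM' : (M : ℂ) ≠ 0 := by exact_mod_cast hMpos.ne'
    rw [hts, hap, ← h1, hGx]
    push_cast
    field_simp

/-- Nodes and coefficients lie in a countable product of compact intervals, so a subsequence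
converges coordinatewise. The series converge by domination, since `‖x + a k‖ ≥ k² / 2` once `k ≥
2‖x‖ + 1`. Strict inequalities for the nodes become weak in the limit. -/
theorem exists_expansion_limit {B γ κ : ℝ} (hB : 0 < B) (hγ : 0 < γ) (hγ1 : γ < 1)
    (hA : 1 / 2 ≤ B + γ) (hκ : 0 ≤ κ) (hF : κ < (gammaQuot (B + γ) B γ 0).re) :
    ∃ a e : ℕ → ℝ, (∀ k, lowerEnd (B + γ) k ≤ a k ∧ a k ≤ 4 * (B + k) ^ 2) ∧ (∀ k, 0 ≤ e k) ∧
      (∀ s : Finset ℕ, ∑ k ∈ s, e k ≤ 1 / ((gammaQuot (B + γ) B γ 0).re - κ)) ∧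
      ∀ z : ℂ, (∀ k : ℕ, z ^ 2 ≠ -((4 * (B + γ + k) ^ 2 : ℝ) : ℂ)) →
        (∀ k, z ^ 2 ≠ -(a k : ℂ)) →
        (gammaQuot (B + γ) B γ z - κ) *
          (((1 / ((gammaQuot (B + γ) B γ 0).re - κ) : ℝ) : ℂ) -
            z ^ 2 * ∑' k, e k / (z ^ 2 + a k)) = 1 := by
  have hlim0 : Tendsto (fun n => approxReal (B + γ) B γ n 0) atTop
      (𝓝 (gammaQuot (B + γ) B γ 0).re) := by
    simpa using tendsto_approxReal (rfl : B + γ = B + γ) 0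
  set H0 : ℝ := 1 / ((gammaQuot (B + γ) B γ 0).re - κ) with hH0
  have hlimH : Tendsto (fun n => 1 / (approxReal (B + γ) B γ n 0 - κ)) atTop (𝓝 H0) :=
    (tendsto_const_nhds).div (hlim0.sub_const κ) (sub_pos.2 hF).ne'
  obtain ⟨n₀, hn₀⟩ := eventually_atTop.1 ((eventually_ne_atTop 0).and
    ((hlim0.eventually (eventually_gt_nhds hF)).and
      (hlimH.eventually (eventually_lt_nhds (lt_add_one H0)))))
  have hex := fun n => exists_expansion_approx hB hγ hγ1 hκ (hn₀ (n₀ + n) (by omega)).1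
    (hn₀ (n₀ + n) (by omega)).2.1
  choose a e ha he hes hid using hex
  have hHle := fun n => (hn₀ (n₀ + n) (by omega)).2.2
  have hele : ∀ n k, e n k ≤ H0 + 1 := fun n k => by
    have := hes n {k}
    rw [Finset.sum_singleton] at this
    linarith [hHle n]
  set lo := lowerEnd (B + γ)
  have hcomp : IsCompact (Set.univ.pi fun k : ℕ =>
      Set.Icc (lo k) (4 * (B + k) ^ 2) ×ˢ Set.Icc (0 : ℝ) (H0 + 1)) :=
    isCompact_univ_pi fun k => isCompact_Icc.prod isCompact_Icc
  obtain ⟨L, hL, φ, hφ, hlim⟩ := hcomp.tendsto_subseq (x := fun n k => (a n k, e n k))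
    fun n k _ => ⟨⟨(ha n k).1.le, (ha n k).2⟩, he n k, hele n k⟩
  rw [tendsto_pi_nhds] at hlim
  have hlima : ∀ k, Tendsto (fun n => a (φ n) k) atTop (𝓝 (L k).1) := fun k =>
    (continuous_fst.tendsto _).comp (hlim k)
  have hlime : ∀ k, Tendsto (fun n => e (φ n) k) atTop (𝓝 (L k).2) := fun k =>
    (continuous_snd.tendsto _).comp (hlim k)
  have hsh : Tendsto (fun n => n₀ + φ n) atTop atTop :=
    tendsto_atTop_mono (fun n => Nat.le_add_left _ _) hφ.tendsto_atTop
  refine ⟨fun k => (L k).1, fun k => (L k).2, fun k => (hL k trivial).1,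
    fun k => (hL k trivial).2.1, fun s => ?_, fun z hzp hza => ?_⟩
  · exact le_of_tendsto_of_tendsto' (tendsto_finsetSum s fun k _ => hlime k)
      (hlimH.comp hsh) fun n => hes (φ n) s
  · set x := z ^ 2
    have hterm : ∀ k, Tendsto (fun n => (e (φ n) k : ℂ) / (x + a (φ n) k)) atTop
        (𝓝 (((L k).2 : ℂ) / (x + (L k).1))) := fun k => by
      refine Tendsto.div ?_ (tendsto_const_nhds.add ?_) fun h => hza k (by linear_combination h)
      · exact (Complex.continuous_ofReal.tendsto _).comp (hlime k)
      · exact (Complex.continuous_ofReal.tendsto _).comp (hlima k)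
    obtain ⟨k₀, hk₀⟩ := exists_nat_ge (2 * ‖x‖ + 1)
    have hlarge : ∀ k ≥ k₀, ∀ n, ‖(e (φ n) k : ℂ) / (x + a (φ n) k)‖ ≤
        (2 * (H0 + 1)) * (1 / (k : ℝ) ^ 2) := fun k hk n => by
      have hk' : 2 * ‖x‖ + 1 ≤ k := hk₀.trans (by exact_mod_cast hk)
      have hx := norm_nonneg x
      have h1 : (k : ℝ) ^ 2 ≤ a (φ n) k := (sq_le_lowerEnd hA k).trans (ha (φ n) k).1.le
      have h2 : (k : ℝ) ^ 2 / 2 ≤ ‖x + a (φ n) k‖ := by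
        have h3 : ‖(a (φ n) k : ℂ)‖ ≤ ‖x + a (φ n) k‖ + ‖x‖ := by
          have := norm_sub_le (x + a (φ n) k) x
          rwa [add_sub_cancel_left] at this
        rw [Complex.norm_real, Real.norm_of_nonneg ((sq_nonneg _).trans h1)] at h3
        nlinarith
      have hkpos : 0 < (k : ℝ) ^ 2 := by nlinarith
      rw [norm_div, Complex.norm_real, Real.norm_of_nonneg (he _ _)]
      calc e (φ n) k / ‖x + a (φ n) k‖ ≤ (H0 + 1) / ((k : ℝ) ^ 2 / 2) :=
            div_le_div₀ ((he (φ n) k).trans (hele _ _)) (hele _ _) (by linarith) h2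
        _ = _ := by ring
    have hts : Tendsto (fun n => ∑' k, (e (φ n) k : ℂ) / (x + a (φ n) k)) atTop
        (𝓝 (∑' k, ((L k).2 : ℂ) / (x + (L k).1))) := by
      refine tendsto_tsum_of_dominated_convergence
        (bound := fun k => if k < k₀ then ‖((L k).2 : ℂ) / (x + (L k).1)‖ + 1
          else (2 * (H0 + 1)) * (1 / (k : ℝ) ^ 2)) ?_ hterm ?_
      · refine Summable.congr_cofinite (f := fun k : ℕ => (2 * (H0 + 1)) * (1 / (k : ℝ) ^ 2))
          ((Real.summable_one_div_nat_pow.2 one_lt_two).mul_left _) ?_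
        rw [Nat.cofinite_eq_atTop]
        filter_upwards [eventually_ge_atTop k₀] with k hk
        rw [if_neg (not_lt.2 hk)]
      · have : ∀ᶠ n in atTop, ∀ k ∈ Finset.range k₀, ‖(e (φ n) k : ℂ) / (x + a (φ n) k)‖ ≤
            ‖((L k).2 : ℂ) / (x + (L k).1)‖ + 1 :=
          (Finset.eventually_all _).2 fun k _ =>
            (hterm k).norm.eventually (eventually_le_nhds (lt_add_one _))
        filter_upwards [this] with n hn k
        split_ifs with h
        · exact hn k (Finset.mem_range.2 h)
        · exact hlarge k (not_lt.1 h) n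
    -- Convergence keeps finitely many denominators away from `0`; for larger `k` the node exceeds
    -- `‖x‖`.
    have hana : ∀ᶠ n in atTop, ∀ k, x ≠ -(a (φ n) k : ℂ) := by
      have : ∀ᶠ n in atTop, ∀ k ∈ Finset.range k₀, x + a (φ n) k ≠ 0 :=
        (Finset.eventually_all _).2 fun k _ => by
          have h1 : Tendsto (fun n => x + a (φ n) k) atTop (𝓝 (x + (L k).1)) :=
            tendsto_const_nhds.add ((Complex.continuous_ofReal.tendsto _).comp (hlima k))
          exact h1.eventually_ne fun h => hza k (by linear_combination h)
      filter_upwards [this] with n hn k h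
      rcases lt_or_ge k k₀ with hk | hk
      · exact hn k (Finset.mem_range.2 hk) (by rw [h]; ring)
      · have hk' : 2 * ‖x‖ + 1 ≤ k := hk₀.trans (by exact_mod_cast hk)
        have h1 : (k : ℝ) ^ 2 ≤ a (φ n) k := (sq_le_lowerEnd hA k).trans (ha (φ n) k).1.le
        have h2 : ‖x‖ = a (φ n) k := by
          rw [h, norm_neg, Complex.norm_real, Real.norm_of_nonneg ((sq_nonneg _).trans h1)]
        nlinarith [norm_nonneg x]
    have hfin := (((tendsto_approx (rfl : B + γ = B + γ) z).comp hsh).sub_const (κ : ℂ)).mul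
      (((Complex.continuous_ofReal.tendsto _).comp (hlimH.comp hsh)).sub (hts.const_mul x))
    refine tendsto_nhds_unique hfin (tendsto_const_nhds.congr' ?_)
    filter_upwards [hana] with n hn
    exact (hid (φ n) x hzp hn).symm

/-- For real `y`, `y² ∑ e k / (y² + a k) ≤ ∑ e k`. If `∑ e k` were smaller than the constant `H0`,
the inverted symbol would stay above a positive number on the real axis, against
`exists_gammaQuot_gt`. With equality, the constant is absorbed through `e - x e / (x + a) = e a / (x
+ a)`. -/
theorem exists_expansion_nonneg {B γ κ : ℝ} (hB : 0 < B) (hγ : 0 < γ) (hγ1 : γ < 1)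
    (hA : 1 / 2 ≤ B + γ) (hκ : 0 ≤ κ) (hF : κ < (gammaQuot (B + γ) B γ 0).re) :
    ∃ a e : ℕ → ℝ, (∀ k, lowerEnd (B + γ) k ≤ a k ∧ a k ≤ 4 * (B + k) ^ 2) ∧ (∀ k, 0 ≤ e k) ∧
      Summable e ∧
      ∀ z : ℂ, (∀ k : ℕ, z ^ 2 ≠ -((4 * (B + γ + k) ^ 2 : ℝ) : ℂ)) →
        (∀ k, z ^ 2 ≠ -(a k : ℂ)) →
        (gammaQuot (B + γ) B γ z - κ) * ∑' k, ((e k * a k : ℝ) : ℂ) / (z ^ 2 + a k) = 1 := by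
  obtain ⟨a, e, ha, he, hes, hid⟩ := exists_expansion_limit hB hγ hγ1 hA hκ hF
  set H0 : ℝ := 1 / ((gammaQuot (B + γ) B γ 0).re - κ)
  have hsum : Summable e := summable_of_sum_le he hes
  have hle : ∑' k, e k ≤ H0 := hsum.tsum_le_of_sum_le hes
  have ha0 : ∀ k, 0 ≤ a k := fun k => ((sq_nonneg _).trans (sq_le_lowerEnd hA k)).trans (ha k).1
  have hEq : ∑' k, e k = H0 := by
    by_contra hne
    have hc : 0 < H0 - ∑' k, e k := sub_pos.2 (lt_of_le_of_ne hle hne)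
    obtain ⟨Y, hY⟩ := exists_gammaQuot_gt hB hγ (κ + 1 / (H0 - ∑' k, e k))
    set y := max Y 1
    have hy : 0 < y := lt_of_lt_of_le one_pos (le_max_right _ _)
    have hFy := hY y (le_max_left _ _)
    have hneg : ∀ r : ℝ, 0 ≤ r → ((y : ℂ)) ^ 2 ≠ -(r : ℂ) := fun r hr h => by
      have : y ^ 2 = -r := by exact_mod_cast h
      nlinarith
    have h1 := hid y (fun k => hneg _ (by positivity)) fun k => hneg _ (ha0 k)
    have h2 : (((H0 : ℝ) : ℂ) - (y : ℂ) ^ 2 * ∑' k, (e k : ℂ) / ((y : ℂ) ^ 2 + a k)) =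
        ((H0 - y ^ 2 * ∑' k, e k / (y ^ 2 + a k) : ℝ) : ℂ) := by
      push_cast; rfl
    rw [h2] at h1
    have h3 := congrArg Complex.re h1
    rw [Complex.re_mul_ofReal, Complex.sub_re, Complex.ofReal_re, Complex.one_re] at h3
    have h4 : y ^ 2 * ∑' k, e k / (y ^ 2 + a k) ≤ ∑' k, e k := by
      rw [← tsum_mul_left]
      have hterm : ∀ k, y ^ 2 * (e k / (y ^ 2 + a k)) ≤ e k := fun k => by
        have := ha0 k
        rw [mul_div_assoc', div_le_iff₀ (by positivity)]
        nlinarith [mul_nonneg (he k) this]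
      exact Summable.tsum_le_tsum hterm (Summable.of_nonneg_of_le (fun k => by
        have := ha0 k; have := he k; positivity) hterm hsum) hsum
    have h5 : 1 / (H0 - ∑' k, e k) * (H0 - ∑' k, e k) = 1 := one_div_mul_cancel hc.ne'
    have h6 : 1 / (H0 - ∑' k, e k) < (gammaQuot (B + γ) B γ y).re - κ := by linarith
    have h7 := mul_lt_mul_of_pos_right h6 hc
    have h8 := mul_le_mul_of_nonneg_left (sub_le_sub_left h4 H0)
      ((one_div_pos.2 hc).trans h6).le
    linarith
  refine ⟨a, e, ha, he, hsum, fun z hzp hza => ?_⟩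
  have h1 := hid z hzp hza
  rw [← h1]
  congr 1
  have hne : ∀ k, z ^ 2 + a k ≠ 0 := fun k h => hza k (by linear_combination h)
  have hsplit : ∀ k, ((e k * a k : ℝ) : ℂ) / (z ^ 2 + a k) =
      (e k : ℂ) - z ^ 2 * (e k / (z ^ 2 + a k)) := fun k => by
    have := hne k
    push_cast
    field_simp
    ring
  have hsumC : Summable fun k => (e k : ℂ) := Complex.summable_ofReal.2 hsum
  have hdiv : Summable fun k => (e k : ℂ) / (z ^ 2 + a k) := by
    obtain ⟨k₀, hk₀⟩ := exists_nat_ge (‖z ^ 2‖ + 1)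
    refine Summable.of_norm_bounded_eventually hsum ?_
    rw [Nat.cofinite_eq_atTop]
    filter_upwards [eventually_ge_atTop k₀] with k hk
    have hk' : ‖z ^ 2‖ + 1 ≤ k := hk₀.trans (by exact_mod_cast hk)
    have h1 : (k : ℝ) ^ 2 ≤ a k := (sq_le_lowerEnd hA k).trans (ha k).1
    have h3 : ‖(a k : ℂ)‖ ≤ ‖z ^ 2 + a k‖ + ‖z ^ 2‖ := by
      have := norm_sub_le (z ^ 2 + a k) (z ^ 2)
      rwa [add_sub_cancel_left] at this
    rw [Complex.norm_real, Real.norm_of_nonneg (ha0 k)] at h3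
    rw [norm_div, Complex.norm_real, Real.norm_of_nonneg (he k)]
    exact div_le_self (he k) (by nlinarith [norm_nonneg (z ^ 2)])
  rw [tsum_congr hsplit, hsumC.tsum_sub (hdiv.mul_left _), tsum_mul_left, ← hEq,
    Complex.ofReal_tsum]

/-! ### Roots on the imaginary axis -/

theorem gamma_sign (j : ℕ) : ∀ s : ℝ, -(j : ℝ) < s → s < 1 - j → 0 < (-1) ^ j * Real.Gamma s := by
  induction j with
  | zero => intro s h1 _; simpa using Real.Gamma_pos_of_pos (by simpa using h1)
  | succ j ih =>
    intro s h1 h2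
    push_cast at h1 h2
    have hs : s < 0 := by have : (0 : ℝ) ≤ j := Nat.cast_nonneg j; linarith
    have h := ih (s + 1) (by linarith) (by linarith)
    rw [Real.Gamma_add_one hs.ne] at h
    have : (-1 : ℝ) ^ (j + 1) * Real.Gamma s = ((-1) ^ j * (s * Real.Gamma s)) / (-s) := by
      rw [eq_div_iff (neg_ne_zero.2 hs.ne), pow_succ]; ring
    rw [this]
    exact div_pos h (by linarith)

theorem continuous_inv_realGamma : Continuous fun s : ℝ => (Real.Gamma s)⁻¹ := by
  have := Complex.continuous_re.comp
    (Complex.differentiable_one_div_Gamma.continuous.comp Complex.continuous_ofReal)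
  refine this.congr fun s => ?_
  simp only [Function.comp, Complex.Gamma_ofReal]
  rw [← Complex.ofReal_inv, Complex.ofReal_re]

theorem gamma_arg_ne {A : ℝ} {z : ℂ} (hz : ∀ k : ℕ, z ^ 2 ≠ -((4 * (A + k) ^ 2 : ℝ) : ℂ)) (m : ℕ) :
    A + z / 2 * Complex.I ≠ -m ∧ A - z / 2 * Complex.I ≠ -m := by
  refine ⟨fun h => hz m ?_, fun h => hz m ?_⟩ <;> push_cast
  · have : (A + m : ℂ) = -(z / 2 * Complex.I) := by linear_combination h
    rw [this]; linear_combination z ^ 2 * Complex.I_sq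
  · have : (A + m : ℂ) = z / 2 * Complex.I := by linear_combination h
    rw [this]; linear_combination z ^ 2 * Complex.I_sq

theorem continuousAt_gammaQuot {A B γ : ℝ} {z : ℂ}
    (hz : ∀ k : ℕ, z ^ 2 ≠ -((4 * (A + k) ^ 2 : ℝ) : ℂ)) :
    ContinuousAt (gammaQuot A B γ) z := by
  have h1 : ContinuousAt (fun z : ℂ => Complex.Gamma (A + z / 2 * Complex.I)) z :=
    ContinuousAt.comp (f := fun z : ℂ => A + z / 2 * Complex.I)
      (Complex.differentiableAt_Gamma _ fun m => (gamma_arg_ne hz m).1).continuousAt (by fun_prop)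
  have h2 : ContinuousAt (fun z : ℂ => Complex.Gamma (A - z / 2 * Complex.I)) z :=
    ContinuousAt.comp (f := fun z : ℂ => A - z / 2 * Complex.I)
      (Complex.differentiableAt_Gamma _ fun m => (gamma_arg_ne hz m).2).continuousAt (by fun_prop)
  have h3 : Continuous (fun z : ℂ => (Complex.Gamma (B + z / 2 * Complex.I))⁻¹) :=
    Complex.differentiable_one_div_Gamma.continuous.comp (by fun_prop)
  have h4 : Continuous (fun z : ℂ => (Complex.Gamma (B - z / 2 * Complex.I))⁻¹) :=
    Complex.differentiable_one_div_Gamma.continuous.comp (by fun_prop)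
  have := (continuousAt_const (y := (((2 : ℝ) ^ (2 * γ) : ℝ) : ℂ))).mul (h1.mul h2) |>.mul
    (h3.continuousAt.mul h4.continuousAt (x := z))
  refine this.congr (Eventually.of_forall fun w => ?_)
  simp only [gammaQuot, div_eq_mul_inv, mul_inv, Pi.mul_apply]

theorem gammaQuot_imag (A B γ y : ℝ) : gammaQuot A B γ (y * Complex.I) =
    ((2 ^ (2 * γ) * (Real.Gamma (A - y / 2) * Real.Gamma (A + y / 2)) /
      (Real.Gamma (B - y / 2) * Real.Gamma (B + y / 2)) : ℝ) : ℂ) := by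
  have h1 : ∀ A : ℝ, (A : ℂ) + y * Complex.I / 2 * Complex.I = ((A - y / 2 : ℝ) : ℂ) := fun A => by
    push_cast; linear_combination (y / 2 : ℂ) * Complex.I_sq
  have h2 : ∀ A : ℝ, (A : ℂ) - y * Complex.I / 2 * Complex.I = ((A + y / 2 : ℝ) : ℂ) := fun A => by
    push_cast; linear_combination -(y / 2 : ℂ) * Complex.I_sq
  rw [gammaQuot, h1, h1, h2, h2]
  simp only [Complex.Gamma_ofReal]
  push_cast
  rfl

/-- On the imaginary axis the equation `Θ = κ` is real; multiplied out with the entire function `1 /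
Γ` it has no singularities, and the intermediate value theorem applies in each gap. At each end of a
gap with `k ≥ 1` one of the two terms vanishes, as does the first at every right end. `Real.Gamma`
being `0` at its poles, its `⁻¹` takes the correct value there. -/
theorem exists_symbol_root {B γ κ : ℝ} (hB : 0 < B) (hγ : 0 < γ) (hγ1 : γ < 1) (hκ : 0 ≤ κ)
    (hF : κ < (gammaQuot (B + γ) B γ 0).re) (k : ℕ) :
    ∃ y : ℝ, 0 < y ∧ lowerEnd (B + γ) k < y ^ 2 ∧ y ^ 2 ≤ 4 * (B + k) ^ 2 ∧
      gammaQuot (B + γ) B γ (y * Complex.I) = κ := by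
  set A := B + γ with hAdef
  have hA : 0 < A := add_pos hB hγ
  have hk : (0 : ℝ) ≤ k := Nat.cast_nonneg k
  have h2γ : (0 : ℝ) < 2 ^ (2 * γ) := by positivity
  set f : ℝ → ℝ := fun y => 2 ^ (2 * γ) * ((Real.Gamma (B - y / 2))⁻¹ * (Real.Gamma (B + y / 2))⁻¹) -
    κ * ((Real.Gamma (A - y / 2))⁻¹ * (Real.Gamma (A + y / 2))⁻¹) with hf
  have hfc : Continuous f := by
    have h := continuous_inv_realGamma
    have h1 : ∀ C : ℝ, Continuous fun y : ℝ => (Real.Gamma (C - y / 2))⁻¹ := fun C =>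
      h.comp (f := fun y : ℝ => C - y / 2) (by fun_prop)
    have h2 : ∀ C : ℝ, Continuous fun y : ℝ => (Real.Gamma (C + y / 2))⁻¹ := fun C =>
      h.comp (f := fun y : ℝ => C + y / 2) (by fun_prop)
    exact (((h1 B).mul (h2 B)).const_mul _).sub (((h1 A).mul (h2 A)).const_mul _)
  have hright : f (2 * (B + k)) =
      -(κ * ((Real.Gamma (γ - k))⁻¹ * (Real.Gamma (A + B + k))⁻¹)) := by
    have h1 : B - 2 * (B + k) / 2 = -(k : ℝ) := by ring
    have h2 : A - 2 * (B + k) / 2 = γ - k := by rw [hAdef]; ring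
    have h3 : A + 2 * (B + k) / 2 = A + B + k := by ring
    simp only [hf, h1, h2, h3, Real.Gamma_neg_nat_eq_zero]
    simp
  have hΓAB : 0 < Real.Gamma (A + B + k) := Real.Gamma_pos_of_pos (by positivity)
  obtain ⟨u, hu0, huk, hul, hfu, hfu0⟩ : ∃ u : ℝ, 0 ≤ u ∧ u ≤ 2 * (B + k) ∧
      u ^ 2 = lowerEnd A k ∧ f u * f (2 * (B + k)) ≤ 0 ∧ f u ≠ 0 := by
    rcases k with _ | k
    · have hf0 : 0 < f 0 := by
        have hGA := Real.Gamma_pos_of_pos hA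
        have hGB := Real.Gamma_pos_of_pos hB
        rw [gammaQuot_zero, Complex.ofReal_re, lt_div_iff₀ (by positivity)] at hF
        simp only [hf, zero_div, sub_zero, add_zero]
        rw [sub_pos, ← mul_inv, ← mul_inv, ← div_eq_mul_inv, ← div_eq_mul_inv,
          div_lt_div_iff₀ (by positivity) (by positivity)]
        nlinarith
      refine ⟨0, le_rfl, by positivity, by simp [lowerEnd], ?_, hf0.ne'⟩
      refine mul_nonpos_of_nonneg_of_nonpos hf0.le ?_
      rw [hright, neg_nonpos]
      have := Real.Gamma_pos_of_pos (by simpa using hγ : 0 < γ - ((0 : ℕ) : ℝ))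
      positivity
    · have hk : (0 : ℝ) ≤ k := Nat.cast_nonneg k
      have h1 : B - 2 * (A + k) / 2 = 1 - γ - (k + 1 : ℕ) := by rw [hAdef]; push_cast; ring
      have h2 : A - 2 * (A + k) / 2 = -(k : ℝ) := by ring
      have h3 : B + 2 * (A + k) / 2 = A + B + k := by ring
      have hleft : f (2 * (A + k)) = 2 ^ (2 * γ) *
          ((Real.Gamma (1 - γ - (k + 1 : ℕ)))⁻¹ * (Real.Gamma (A + B + k))⁻¹) := by
        simp only [hf, h1, h2, h3, Real.Gamma_neg_nat_eq_zero]
        simp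
      have hs1 := gamma_sign (k + 1) (1 - γ - (k + 1 : ℕ)) (by linarith) (by linarith)
      have hs2 := gamma_sign (k + 1) (γ - (k + 1 : ℕ)) (by linarith) (by linarith)
      have hp : 0 < Real.Gamma (A + B + k) := Real.Gamma_pos_of_pos (by positivity)
      refine ⟨2 * (A + k), by positivity, ?_, ?_, ?_, ?_⟩
      · rw [hAdef]; push_cast; linarith
      · simp only [lowerEnd]; ring
      · rw [hleft, hright]
        -- Both arguments lie in the interval `(-(k + 1), -k)`, on which Γ has constant sign.
        have hprod : 0 < Real.Gamma (1 - γ - (k + 1 : ℕ)) * Real.Gamma (γ - (k + 1 : ℕ)) := by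
          have := mul_pos hs1 hs2
          rw [mul_mul_mul_comm, ← pow_add, ← two_mul, pow_mul] at this
          simpa using this
        have : 2 ^ (2 * γ) * ((Real.Gamma (1 - γ - (k + 1 : ℕ)))⁻¹ * (Real.Gamma (A + B + k))⁻¹) *
            -(κ * ((Real.Gamma (γ - (k + 1 : ℕ)))⁻¹ * (Real.Gamma (A + B + (k + 1 : ℕ)))⁻¹)) =
            -(2 ^ (2 * γ) * κ * (Real.Gamma (1 - γ - (k + 1 : ℕ)) * Real.Gamma (γ - (k + 1 : ℕ)))⁻¹ *
              ((Real.Gamma (A + B + k))⁻¹ * (Real.Gamma (A + B + (k + 1 : ℕ)))⁻¹)) := by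
          rw [mul_inv]; ring
        rw [this, neg_nonpos]
        positivity
      · rw [hleft]
        have : Real.Gamma (1 - γ - (k + 1 : ℕ)) ≠ 0 := right_ne_zero_of_mul hs1.ne'
        exact mul_ne_zero h2γ.ne' (mul_ne_zero (inv_ne_zero this) (inv_ne_zero hp.ne'))
  obtain ⟨y, ⟨hy1, hy2⟩, hy⟩ := exists_root_of_mul_nonpos huk hfc.continuousOn hfu
  have huy : u < y := lt_of_le_of_ne hy1 fun h => hfu0 (h ▸ hy)
  have hy0 : 0 < y := hu0.trans_lt huy
  have hly : lowerEnd A k < y ^ 2 := by rw [← hul]; nlinarith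
  have hyb : y ^ 2 ≤ 4 * (B + k) ^ 2 := by nlinarith
  refine ⟨y, hy0, hly, hyb, ?_⟩
  rw [gammaQuot_imag]
  congr 1
  have hGp : 0 < Real.Gamma (A + y / 2) := Real.Gamma_pos_of_pos (by positivity)
  -- The root lies strictly between two consecutive poles of the symbol (or between `0` and the
  -- first), so the denominators may be restored.
  have hGm : Real.Gamma (A - y / 2) ≠ 0 := by
    refine Real.Gamma_ne_zero fun j hj => ?_
    have hyj : y ^ 2 = 4 * (A + j) ^ 2 := by
      have : y = 2 * (A + j) := by linarith
      rw [this]; ring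
    rcases lt_or_ge j k with h | h
    · have := upper_le_lower (lowerEnd_lt hB hγ1 hA) (fun k => zero_lt_pole hB hγ k)
        (fun k => rfl) h
      linarith
    · have h1 := zero_lt_pole hB hγ k
      have h2 : (k : ℝ) ≤ j := by exact_mod_cast h
      have h3 : 4 * (A + k) ^ 2 ≤ 4 * (A + j) ^ 2 := by gcongr
      linarith
  have hroot : 2 ^ (2 * γ) * ((Real.Gamma (B - y / 2))⁻¹ * (Real.Gamma (B + y / 2))⁻¹) =
    κ * ((Real.Gamma (A - y / 2))⁻¹ * (Real.Gamma (A + y / 2))⁻¹) := by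
    simpa [hf, sub_eq_zero] using hy
  calc _ = (2 ^ (2 * γ) * ((Real.Gamma (B - y / 2))⁻¹ * (Real.Gamma (B + y / 2))⁻¹)) *
        (Real.Gamma (A - y / 2) * Real.Gamma (A + y / 2)) := by
        rw [div_eq_mul_inv, mul_inv]; ring
    _ = κ := by rw [hroot, mul_assoc, ← mul_inv, inv_mul_cancel₀ (mul_ne_zero hGm hGp.ne'), mul_one]

/-! ### Stieltjes sums -/

/-- The sum of the simple fractions `d j / (s j + w)`. -/
def simpleFractions (d s : ℕ → ℝ) (w : ℂ) : ℂ := ∑' j, (d j : ℂ) / (s j + w)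

/-- For large `j`, `s j` dominates `‖w‖`; for the finitely many others continuity suffices, the
indices with a pole at `w₀` being excepted. The bound gives the majorant `η⁻¹ d j / s j` for the
Weierstrass test. -/
theorem exists_uniform_gap {s : ℕ → ℝ} (hs : ∀ j, 0 < s j) (hlim : Tendsto s atTop atTop) (w₀ : ℂ) :
    ∃ η > 0, ∀ᶠ w in 𝓝 w₀, ∀ j, (s j : ℂ) + w₀ ≠ 0 → η * s j ≤ ‖(s j : ℂ) + w‖ := by
  obtain ⟨k₀, hk₀⟩ := eventually_atTop.1 (hlim.eventually (eventually_ge_atTop (2 * (‖w₀‖ + 1))))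
  have h1 : ∀ᶠ η in 𝓝[>] (0 : ℝ), ∀ j ∈ Finset.range k₀, (s j : ℂ) + w₀ ≠ 0 →
      η * s j ≤ ‖(s j : ℂ) + w₀‖ / 2 := by
    refine (Finset.eventually_all _).2 fun j _ => ?_
    by_cases h : (s j : ℂ) + w₀ = 0
    · exact Eventually.of_forall fun _ h' => absurd h h'
    have h2 : 0 < ‖(s j : ℂ) + w₀‖ / 2 / s j := div_pos (half_pos (norm_pos_iff.2 h)) (hs j)
    filter_upwards [nhdsWithin_le_nhds (eventually_le_nhds h2)] with η hη _
    rwa [le_div_iff₀ (hs j)] at hη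
  obtain ⟨η, hη1, hη2, hη0⟩ := (h1.and (((eventually_le_nhds
    (half_pos one_pos)).filter_mono nhdsWithin_le_nhds).and self_mem_nhdsWithin)).exists
  refine ⟨η, hη0, ?_⟩
  have h3 : ∀ᶠ w in 𝓝 w₀, ∀ j ∈ Finset.range k₀, (s j : ℂ) + w₀ ≠ 0 →
      ‖(s j : ℂ) + w₀‖ / 2 ≤ ‖(s j : ℂ) + w‖ := by
    refine (Finset.eventually_all _).2 fun j _ => ?_
    by_cases h : (s j : ℂ) + w₀ = 0
    · exact Eventually.of_forall fun _ h' => absurd h h'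
    have hc : Tendsto (fun w : ℂ => ‖(s j : ℂ) + w‖) (𝓝 w₀) (𝓝 ‖(s j : ℂ) + w₀‖) :=
      (by fun_prop : Continuous fun w : ℂ => ‖(s j : ℂ) + w‖).tendsto w₀
    filter_upwards [hc.eventually (eventually_ge_nhds (half_lt_self (norm_pos_iff.2 h)))] with w hw _
    exact hw
  have h4 : ∀ᶠ w in 𝓝 w₀, ‖w‖ ≤ ‖w₀‖ + 1 :=
    (continuous_norm.tendsto w₀).eventually (eventually_le_nhds (lt_add_one _))
  filter_upwards [h3, h4] with w hw1 hw2 j hj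
  rcases lt_or_ge j k₀ with h | h
  · exact (hη1 j (Finset.mem_range.2 h) hj).trans (hw1 j (Finset.mem_range.2 h) hj)
  · have h5 := hk₀ j h
    have h6 : ‖(s j : ℂ)‖ ≤ ‖(s j : ℂ) + w‖ + ‖w‖ := by
      have := norm_sub_le ((s j : ℂ) + w) w
      rwa [add_sub_cancel_right] at this
    rw [Complex.norm_real, Real.norm_of_nonneg (hs j).le] at h6
    have : η * s j ≤ 1 / 2 * s j := mul_le_mul_of_nonneg_right hη2 (hs j).le
    linarith

theorem norm_fraction_le {d s : ℕ → ℝ} (hs : ∀ j, 0 < s j) (hd : ∀ j, 0 ≤ d j) {η : ℝ} (hη : 0 < η)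
    {w : ℂ} {j : ℕ} (h : η * s j ≤ ‖(s j : ℂ) + w‖) :
    ‖(d j : ℂ) / (s j + w)‖ ≤ η⁻¹ * (d j / s j) := by
  rw [norm_div, Complex.norm_real, Real.norm_of_nonneg (hd j)]
  calc d j / ‖(s j : ℂ) + w‖ ≤ d j / (η * s j) :=
        div_le_div_of_nonneg_left (hd j) (mul_pos hη (hs j)) h
    _ = η⁻¹ * (d j / s j) := by rw [← div_div, div_div, div_mul_eq_div_div]; field_simp

theorem summable_fractions {d s : ℕ → ℝ} (hs : ∀ j, 0 < s j) (hlim : Tendsto s atTop atTop)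
    (hd : ∀ j, 0 ≤ d j) (hsum : Summable fun j => d j / s j) (w : ℂ) :
    Summable fun j => (d j : ℂ) / (s j + w) := by
  obtain ⟨η, hη, h⟩ := exists_uniform_gap hs hlim w
  refine Summable.of_norm_bounded (hsum.mul_left η⁻¹) fun j => ?_
  by_cases hj : (s j : ℂ) + w = 0
  · rw [hj, div_zero, norm_zero]
    exact mul_nonneg (inv_nonneg.2 hη.le) (div_nonneg (hd j) (hs j).le)
  · exact norm_fraction_le hs hd hη (h.self_of_nhds j hj)

/-- The alternative `d j = 0` allows one term to be deleted, so the same lemma covers the regular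
part at a pole and the contradiction that makes all coefficients positive. -/
theorem analyticAt_simpleFractions {d s : ℕ → ℝ} (hs : ∀ j, 0 < s j)
    (hlim : Tendsto s atTop atTop) (hd : ∀ j, 0 ≤ d j) (hsum : Summable fun j => d j / s j) {w : ℂ}
    (hw : ∀ j, (s j : ℂ) + w ≠ 0 ∨ d j = 0) : AnalyticAt ℂ (simpleFractions d s) w := by
  obtain ⟨η, hη, h⟩ := exists_uniform_gap hs hlim w
  obtain ⟨U, hU, hUo, hwU⟩ := eventually_nhds_iff.1 h
  have : DifferentiableOn ℂ (simpleFractions d s) U := by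
    refine Complex.differentiableOn_tsum_of_summable_norm (u := fun j => η⁻¹ * (d j / s j))
      (hsum.mul_left η⁻¹) (fun j => ?_) hUo fun j v hv => ?_
    · rcases hw j with hj | hj
      · intro v hv
        have hne : (s j : ℂ) + v ≠ 0 := fun h0 => by
          have := hU v hv j hj
          rw [h0, norm_zero] at this
          exact absurd this (not_le.2 (mul_pos hη (hs j)))
        exact ((differentiableAt_const _).div (by fun_prop) hne).differentiableWithinAt
      · simp only [hj]; simp
    · rcases hw j with hj | hj
      · exact norm_fraction_le hs hd hη (hU v hv j hj)
      · simp [hj]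
  exact this.analyticAt (hUo.mem_nhds hwU)

/-- The data of the partial fraction expansion of `1 / (Θ - κ)`: simple poles at `± i σ j` with
coefficients `d j`, valid off the points `± 2 i (A + k)`. -/
structure IsExpansion (A : ℝ) (Θ : ℂ → ℂ) (κ : ℝ) (σ d : ℕ → ℝ) : Prop where
  base_pos : 0 < A
  pos : 0 < σ 0
  strictMono : StrictMono σ
  nat_le : ∀ j : ℕ, (j : ℝ) ≤ σ j
  coeff_pos : ∀ j, 0 < d j
  summable : Summable fun j => d j / σ j
  identity : ∀ z : ℂ, (∀ k : ℕ, z ^ 2 ≠ -((4 * (A + k) ^ 2 : ℝ) : ℂ)) →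
    (∀ j, z ^ 2 ≠ -((σ j ^ 2 : ℝ) : ℂ)) →
    (Θ z - κ) * (simpleFractions d σ (Complex.I * z) + simpleFractions d σ (-(Complex.I * z))) = 1

theorem eventually_sq_ne {s : ℕ → ℝ} (hs : ∀ j, 0 < s j) (hlim : Tendsto s atTop atTop) (z₀ : ℂ) :
    ∀ᶠ z in 𝓝[≠] z₀, ∀ j, z ^ 2 ≠ -((s j ^ 2 : ℝ) : ℂ) := by
  have key : ∀ u : ℂ, u ^ 2 = -1 → ∀ᶠ z in 𝓝[≠] z₀, ∀ j, (s j : ℂ) + u * z ≠ 0 := fun u hu => by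
    have hu0 : u ≠ 0 := fun h => by simp [h] at hu
    obtain ⟨η, hη, h⟩ := exists_uniform_gap hs hlim (u * z₀)
    have hc : Tendsto (fun z => u * z) (𝓝 z₀) (𝓝 (u * z₀)) :=
      (by fun_prop : Continuous fun z => u * z).tendsto z₀
    filter_upwards [nhdsWithin_le_nhds (hc.eventually h), self_mem_nhdsWithin] with z hz hne j h0
    by_cases hj : (s j : ℂ) + u * z₀ = 0
    · exact hne (mul_left_cancel₀ hu0 (by linear_combination h0 - hj))
    · have := hz j hj
      rw [h0, norm_zero] at this
      exact absurd this (not_le.2 (mul_pos hη (hs j)))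
  filter_upwards [key Complex.I Complex.I_sq, key (-Complex.I) (by rw [neg_sq, Complex.I_sq])]
    with z h1 h2 j h
  have : ((s j : ℂ) + Complex.I * z) * (s j + -Complex.I * z) = 0 := by
    push_cast at h
    linear_combination h - z ^ 2 * Complex.I_sq
  rcases mul_eq_zero.1 this with h | h
  exacts [h1 j h, h2 j h]

theorem poles_tendsto (A : ℝ) : Tendsto (fun k : ℕ => 2 * (A + k)) atTop atTop :=
  (tendsto_atTop_add_const_left _ _ tendsto_natCast_atTop_atTop).const_mul_atTop two_pos

theorem eventually_sq_ne_pole {A : ℝ} (hA : 0 < A) (z₀ : ℂ) :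
    ∀ᶠ z in 𝓝[≠] z₀, ∀ k : ℕ, z ^ 2 ≠ -((4 * (A + k) ^ 2 : ℝ) : ℂ) := by
  filter_upwards [eventually_sq_ne (s := fun k : ℕ => 2 * (A + k)) (fun k => by positivity)
    (poles_tendsto A) z₀] with z hz k h
  exact hz k (by rw [h]; push_cast; ring)

/-- If `y k ^ 2` were not a node, the identity would hold at the root `i y k` and read `0 = 1`;
disjointness of the gaps then forces the node `a k`. If the coefficient at `i y k` vanished, the sum
would be continuous there while `Θ - κ` tends to `0`, again a contradiction. -/
theorem exists_isExpansion {B γ κ : ℝ} (hB : 0 < B) (hγ : 0 < γ) (hγ1 : γ < 1)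
    (hA : 1 / 2 ≤ B + γ) (hκ : 0 ≤ κ) (hF : κ < (gammaQuot (B + γ) B γ 0).re) :
    ∃ σ d, IsExpansion (B + γ) (gammaQuot (B + γ) B γ) κ σ d := by
  obtain ⟨a, e, ha, he, hsum, hid⟩ := exists_expansion_nonneg hB hγ hγ1 hA hκ hF
  have hApos : 0 < B + γ := add_pos hB hγ
  choose y hy0 hly hyb hy using exists_symbol_root hB hγ hγ1 hκ hF
  have hlb := lowerEnd_lt hB hγ1 hApos
  have hbp := zero_lt_pole (B := B) hB hγ
  have hul := fun {i k : ℕ} (h : i < k) =>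
    upper_le_lower (l := lowerEnd (B + γ)) hlb hbp (fun k => rfl) h
  have hyp : ∀ j k : ℕ, y j ^ 2 ≠ 4 * (B + γ + k) ^ 2 := fun j k h => by
    rcases lt_or_ge k j with hkj | hkj
    · linarith [hul hkj, hly j]
    · have h1 : (j : ℝ) ≤ k := by exact_mod_cast hkj
      have h2 : 4 * (B + γ + j) ^ 2 ≤ 4 * (B + γ + k) ^ 2 := by gcongr
      linarith [hyb j, hbp j]
  have hsq : ∀ j, ((y j : ℂ) * Complex.I) ^ 2 = -((y j ^ 2 : ℝ) : ℂ) := fun j => by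
    rw [mul_pow, Complex.I_sq]; push_cast; ring
  have hreg : ∀ j, ∀ k : ℕ, ((y j : ℂ) * Complex.I) ^ 2 ≠
      -((4 * (B + γ + k) ^ 2 : ℝ) : ℂ) := fun j k h => by
    rw [hsq, neg_inj] at h
    exact hyp j k (by exact_mod_cast h)
  have hay : ∀ k, a k = y k ^ 2 := fun k => by
    by_contra hne
    have := hid (y k * Complex.I) (hreg k) fun j h => by
      rw [hsq, neg_inj] at h
      have h : y k ^ 2 = a j := by exact_mod_cast h
      rcases lt_trichotomy j k with hjk | hjk | hjk
      · linarith [hul hjk, hly k, (ha j).2, hbp j]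
      · exact hne (by rw [h, hjk])
      · linarith [hul hjk, hyb k, (ha j).1, hbp k]
    rw [hy, sub_self, zero_mul] at this
    exact zero_ne_one this
  have hmono : StrictMono y := strictMono_nat_of_lt_succ fun k => by
    refine lt_of_pow_lt_pow_left₀ 2 (hy0 _).le ?_
    linarith [hul (Nat.lt_succ_self k), hyb k, hly (k + 1), hbp k]
  have hnat : ∀ k : ℕ, (k : ℝ) ≤ y k := fun k =>
    le_of_sq_le_sq ((sq_le_lowerEnd hA k).trans (hly k).le) (hy0 k).le
  have hlim : Tendsto y atTop atTop := tendsto_atTop_mono hnat tendsto_natCast_atTop_atTop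
  -- From `y² e / (z² + y²) = d / (y + i z) + d / (y - i z)` with `d = e y / 2`.
  set d : ℕ → ℝ := fun k => e k * y k / 2 with hd
  have hd0 : ∀ k, 0 ≤ d k := fun k => by have := he k; have := hy0 k; simp only [hd]; positivity
  have hdsum : Summable fun k => d k / y k := by
    refine (hsum.div_const 2).congr fun k => ?_
    have := (hy0 k).ne'
    simp only [hd]; field_simp
  have hident : ∀ z : ℂ, (∀ k : ℕ, z ^ 2 ≠ -((4 * (B + γ + k) ^ 2 : ℝ) : ℂ)) →
      (∀ j, z ^ 2 ≠ -((y j ^ 2 : ℝ) : ℂ)) → (gammaQuot (B + γ) B γ z - κ) *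
      (simpleFractions d y (Complex.I * z) + simpleFractions d y (-(Complex.I * z))) = 1 := by
    intro z h1 h2
    rw [← hid z h1 fun j => by rw [hay]; exact h2 j]
    congr 1
    rw [simpleFractions, simpleFractions,
      ← (summable_fractions hy0 hlim hd0 hdsum _).tsum_add (summable_fractions hy0 hlim hd0 hdsum _)]
    refine tsum_congr fun j => ?_
    have hfac : ((y j : ℂ) + Complex.I * z) * (y j + -(Complex.I * z)) = z ^ 2 + a j := by
      rw [hay]; push_cast; linear_combination -z ^ 2 * Complex.I_sq
    have h0 : z ^ 2 + (a j : ℂ) ≠ 0 := fun h => h2 j (by rw [← hay]; linear_combination h)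
    rw [← hfac] at h0 ⊢
    rw [div_add_div _ _ (left_ne_zero_of_mul h0) (right_ne_zero_of_mul h0)]
    congr 1
    simp only [hd, hay]
    push_cast
    ring
  refine ⟨y, d, hApos, hy0 0, hmono, hnat, fun k => lt_of_le_of_ne (hd0 k) fun hdk => ?_,
    hdsum, hident⟩
  have hcont : ContinuousAt (fun z => simpleFractions d y (Complex.I * z) +
      simpleFractions d y (-(Complex.I * z))) (y k * Complex.I) := by
    refine ContinuousAt.add (ContinuousAt.comp (f := fun z : ℂ => Complex.I * z)
      (analyticAt_simpleFractions hy0 hlim hd0 hdsum fun j => ?_).continuousAt (by fun_prop))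
      (ContinuousAt.comp (f := fun z : ℂ => -(Complex.I * z))
      (analyticAt_simpleFractions hy0 hlim hd0 hdsum fun j => ?_).continuousAt (by fun_prop))
    · by_cases hjk : j = k
      · right; rw [hjk, hdk]
      · left
        have : (y j : ℂ) + Complex.I * (y k * Complex.I) = ((y j - y k : ℝ) : ℂ) := by
          push_cast; linear_combination (y k : ℂ) * Complex.I_sq
        rw [this, Complex.ofReal_ne_zero, sub_ne_zero]
        exact fun h => hjk (hmono.injective h)
    · left
      have : (y j : ℂ) + -(Complex.I * (y k * Complex.I)) = ((y j + y k : ℝ) : ℂ) := by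
        push_cast; linear_combination -(y k : ℂ) * Complex.I_sq
      rw [this, Complex.ofReal_ne_zero]
      exact (add_pos (hy0 j) (hy0 k)).ne'
  have h1 := ((continuousAt_gammaQuot (B := B) (γ := γ) (hreg k)).sub
    (continuousAt_const (y := (κ : ℂ)))).mul hcont
  have h2 := tendsto_nhds_unique_of_eventuallyEq
    (h1.tendsto.mono_left nhdsWithin_le_nhds) (tendsto_const_nhds (x := (1 : ℂ))
      (f := 𝓝[≠] ((y k : ℂ) * Complex.I))) (by
      filter_upwards [eventually_sq_ne_pole hApos _, eventually_sq_ne hy0 hlim _] with z hz1 hz2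
      exact hident z hz1 hz2)
  simp [hy] at h2

/-! ### Poles, orders and residues of the inverted symbol. -/

namespace IsExpansion

variable {A κ : ℝ} {Θ : ℂ → ℂ} {σ d : ℕ → ℝ}

theorem exponent_pos (H : IsExpansion A Θ κ σ d) (j : ℕ) : 0 < σ j :=
  H.pos.trans_le (H.strictMono.monotone (Nat.zero_le j))

theorem tendsto (H : IsExpansion A Θ κ σ d) : Tendsto σ atTop atTop :=
  tendsto_atTop_mono H.nat_le tendsto_natCast_atTop_atTop

theorem coeff_nonneg (H : IsExpansion A Θ κ σ d) (j : ℕ) : 0 ≤ d j := (H.coeff_pos j).le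

/-- The condition on `u` means `u = ± I`. The sum is symmetric in the sign, so both half-planes are
treated at once. -/
theorem eventually_eq (H : IsExpansion A Θ κ σ d) {u : ℂ} (hu : u ^ 2 = -1) (z₀ : ℂ) :
    (fun z => 1 / (Θ z - κ)) =ᶠ[𝓝[≠] z₀]
      fun z => simpleFractions d σ (u * z) + simpleFractions d σ (-(u * z)) := by
  filter_upwards [eventually_sq_ne_pole H.base_pos z₀,
    eventually_sq_ne H.exponent_pos H.tendsto z₀] with z h1 h2
  have h3 := H.identity z h1 h2
  rw [one_div, eq_comm]
  have h4 := (eq_inv_of_mul_eq_one_right h3)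
  have hu' : u = Complex.I ∨ u = -Complex.I := by
    rw [← sq_eq_sq_iff_eq_or_eq_neg, hu, Complex.I_sq]
  rcases hu' with rfl | rfl
  · exact h4
  · rw [neg_mul, neg_neg, add_comm]; exact h4

theorem analyticAt (H : IsExpansion A Θ κ σ d) {z : ℂ}
    (hz : ∀ j, z ^ 2 ≠ -((σ j ^ 2 : ℝ) : ℂ)) : AnalyticAt ℂ
      (fun z => simpleFractions d σ (Complex.I * z) + simpleFractions d σ (-(Complex.I * z))) z := by
  have key : ∀ u : ℂ, u ^ 2 = -1 → ∀ j, (σ j : ℂ) + u * z ≠ 0 := fun u hu j h => hz j (by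
    have : (σ j : ℂ) = -(u * z) := by linear_combination h
    push_cast; rw [this]; linear_combination z ^ 2 * hu)
  refine AnalyticAt.add (AnalyticAt.comp (f := fun z : ℂ => Complex.I * z)
    (analyticAt_simpleFractions H.exponent_pos H.tendsto H.coeff_nonneg H.summable fun j => ?_)
      (by fun_prop)) (AnalyticAt.comp (f := fun z : ℂ => -(Complex.I * z))
    (analyticAt_simpleFractions H.exponent_pos H.tendsto H.coeff_nonneg H.summable fun j => ?_)
      (by fun_prop))
  · exact Or.inl (key _ Complex.I_sq j)
  · rw [← neg_mul]; exact Or.inl (key (-Complex.I) (by rw [neg_sq, Complex.I_sq]) j)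

/-- The fraction of index `k` equals `d k / (u (z - z₀))`. Setting its coefficient to `0` leaves a
function analytic at `z₀`, since the `σ j` are distinct, and the opposite sum has no pole there
because `σ j + σ k > 0`. -/
theorem exists_polar_part (H : IsExpansion A Θ κ σ d) {u : ℂ} (hu : u ^ 2 = -1) {z₀ : ℂ} {k : ℕ}
    (hz : (σ k : ℂ) + u * z₀ = 0) : ∃ G : ℂ → ℂ, AnalyticAt ℂ G z₀ ∧ G z₀ = d k / u ∧
      ∀ z ≠ z₀, simpleFractions d σ (u * z) + simpleFractions d σ (-(u * z)) =
        (z - z₀)⁻¹ * G z := by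
  have hu0 : u ≠ 0 := fun h => by simp [h] at hu
  set d' : ℕ → ℝ := fun j => if j = k then 0 else d j with hd'
  have hd'0 : ∀ j, 0 ≤ d' j := fun j => by
    simp only [hd']; split_ifs
    exacts [le_rfl, H.coeff_nonneg j]
  have hd'sum : Summable fun j => d' j / σ j :=
    Summable.of_nonneg_of_le (fun j => div_nonneg (hd'0 j) (H.exponent_pos j).le) (fun j => by
      simp only [hd']; split_ifs
      · rw [zero_div]; exact div_nonneg (H.coeff_nonneg j) (H.exponent_pos j).le
      · exact le_rfl) H.summable
  have hsplit : ∀ w, simpleFractions d σ w = d k / (σ k + w) + simpleFractions d' σ w := fun w => by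
    rw [simpleFractions, (summable_fractions H.exponent_pos H.tendsto H.coeff_nonneg H.summable
      w).tsum_eq_add_tsum_ite k, simpleFractions]
    congr 1
    refine tsum_congr fun j => ?_
    simp only [hd']
    split_ifs <;> simp
  have hg1 : AnalyticAt ℂ (fun z => simpleFractions d' σ (u * z)) z₀ := by
    refine AnalyticAt.comp (f := fun z : ℂ => u * z)
      (analyticAt_simpleFractions H.exponent_pos H.tendsto hd'0 hd'sum fun j => ?_) (by fun_prop)
    by_cases hj : j = k
    · right; simp [hd', hj]
    · left
      intro h
      refine hj (H.strictMono.injective ?_)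
      have : (σ j : ℂ) = σ k := by linear_combination h - hz
      exact_mod_cast this
  have hg2 : AnalyticAt ℂ (fun z => simpleFractions d σ (-(u * z))) z₀ := by
    refine AnalyticAt.comp (f := fun z : ℂ => -(u * z))
      (analyticAt_simpleFractions H.exponent_pos H.tendsto H.coeff_nonneg H.summable fun j => ?_)
      (by fun_prop)
    left
    have : (σ j : ℂ) + -(u * z₀) = ((σ j + σ k : ℝ) : ℂ) := by
      push_cast; linear_combination -hz
    rw [this, Complex.ofReal_ne_zero]
    exact (add_pos (H.exponent_pos j) (H.exponent_pos k)).ne'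
  refine ⟨fun z => d k / u + (z - z₀) * (simpleFractions d' σ (u * z) +
    simpleFractions d σ (-(u * z))), ?_, by simp, fun z hz' => ?_⟩
  · exact analyticAt_const.add ((analyticAt_id.sub analyticAt_const).mul (hg1.add hg2))
  · have h1 : z - z₀ ≠ 0 := sub_ne_zero.2 hz'
    have h2 : (σ k : ℂ) + u * z = u * (z - z₀) := by linear_combination hz
    rw [hsplit (u * z), h2]
    field_simp
    ring

theorem order_neg (H : IsExpansion A Θ κ σ d) {u : ℂ} (hu : u ^ 2 = -1) {z₀ : ℂ} {k : ℕ}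
    (hz : (σ k : ℂ) + u * z₀ = 0) : MeromorphicAt (fun z => 1 / (Θ z - κ)) z₀ ∧
      meromorphicOrderAt (fun z => 1 / (Θ z - κ)) z₀ < 0 := by
  have hu0 : u ≠ 0 := fun h => by simp [h] at hu
  obtain ⟨G, hG, hG0, hGz⟩ := H.exists_polar_part hu hz
  have hev : (fun z => 1 / (Θ z - κ)) =ᶠ[𝓝[≠] z₀] fun z => (z - z₀)⁻¹ * G z := by
    filter_upwards [H.eventually_eq hu z₀, self_mem_nhdsWithin] with z h1 h2
    rw [h1, hGz z h2]
  have hmer : MeromorphicAt (fun z => (z - z₀)⁻¹ * G z) z₀ :=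
    ((MeromorphicAt.id z₀).sub (MeromorphicAt.const z₀ z₀)).inv.mul hG.meromorphicAt
  refine ⟨hmer.congr hev.symm, ?_⟩
  rw [meromorphicOrderAt_congr hev, (meromorphicOrderAt_eq_int_iff (n := -1) hmer).2
    ⟨G, hG, ?_, Eventually.of_forall fun z => by simp⟩]
  · exact_mod_cast (by norm_num : (-1 : ℤ) < 0)
  · rw [hG0]
    exact div_ne_zero (by exact_mod_cast (H.coeff_pos k).ne') hu0

theorem order_nonneg (H : IsExpansion A Θ κ σ d) {z : ℂ}
    (hz : ∀ j, z ^ 2 ≠ -((σ j ^ 2 : ℝ) : ℂ)) : MeromorphicAt (fun z => 1 / (Θ z - κ)) z ∧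
      0 ≤ meromorphicOrderAt (fun z => 1 / (Θ z - κ)) z := by
  have h1 := H.eventually_eq Complex.I_sq z
  have h2 := H.analyticAt hz
  refine ⟨h2.meromorphicAt.congr h1.symm, ?_⟩
  rw [meromorphicOrderAt_congr h1]
  exact h2.meromorphicOrderAt_nonneg

theorem sq_eq_iff {z : ℂ} {s : ℝ} : z ^ 2 = -((s ^ 2 : ℝ) : ℂ) ↔
    (s : ℂ) + Complex.I * z = 0 ∨ (s : ℂ) + -Complex.I * z = 0 := by
  rw [← mul_eq_zero]
  push_cast
  constructor <;> intro h
  · linear_combination h - z ^ 2 * Complex.I_sq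
  · linear_combination h + z ^ 2 * Complex.I_sq

theorem meromorphic (H : IsExpansion A Θ κ σ d) : Meromorphic (fun z => 1 / (Θ z - κ)) := fun z => by
  by_cases hz : ∀ j, z ^ 2 ≠ -((σ j ^ 2 : ℝ) : ℂ)
  · exact (H.order_nonneg hz).1
  · push Not at hz
    obtain ⟨j, hj⟩ := hz
    rcases sq_eq_iff.1 hj with h | h
    · exact (H.order_neg Complex.I_sq h).1
    · exact (H.order_neg (by rw [neg_sq, Complex.I_sq]) h).1

theorem order_neg_iff (H : IsExpansion A Θ κ σ d) (z : ℂ) :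
    meromorphicOrderAt (fun z => 1 / (Θ z - κ)) z < 0 ↔
      ∃ j, z = σ j * Complex.I ∨ z = -(σ j * Complex.I) := by
  have h1 : ∀ j, (σ j : ℂ) + Complex.I * z = 0 ↔ z = σ j * Complex.I := fun j => by
    constructor <;> intro h
    · linear_combination -Complex.I * h + z * Complex.I_sq
    · rw [h]; linear_combination (σ j : ℂ) * Complex.I_sq
  have h2 : ∀ j, (σ j : ℂ) + -Complex.I * z = 0 ↔ z = -(σ j * Complex.I) := fun j => by
    constructor <;> intro h
    · linear_combination Complex.I * h + z * Complex.I_sq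
    · rw [h]; linear_combination (σ j : ℂ) * Complex.I_sq
  constructor
  · intro h
    by_contra hne
    push Not at hne
    refine absurd (H.order_nonneg (z := z) fun j hj => ?_).2 (not_le.2 h)
    rcases sq_eq_iff.1 hj with h | h
    · exact (hne j).1 ((h1 j).1 h)
    · exact (hne j).2 ((h2 j).1 h)
  · rintro ⟨j, h | h⟩
    · exact (H.order_neg Complex.I_sq ((h1 j).2 h)).2
    · exact (H.order_neg (by rw [neg_sq, Complex.I_sq]) ((h2 j).2 h)).2

/-- On small circles the function is `(z - z₀)⁻¹ * G z`, so Cauchy's formula returns `G z₀`. -/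
theorem hasResidue (H : IsExpansion A Θ κ σ d) (k : ℕ) :
    HasResidue (fun z => 1 / (Θ z - κ)) (σ k * Complex.I) (d k / Complex.I) := by
  set z₀ : ℂ := σ k * Complex.I
  have hz : (σ k : ℂ) + Complex.I * z₀ = 0 := by
    simp only [z₀]; linear_combination (σ k : ℂ) * Complex.I_sq
  obtain ⟨G, hG, hG0, hGz⟩ := H.exists_polar_part Complex.I_sq hz
  obtain ⟨ε, hε, hε1⟩ := Metric.eventually_nhds_iff_ball.1
    (hG.eventually_analyticAt.and (eventually_nhdsWithin_iff.1 (H.eventually_eq Complex.I_sq z₀)))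
  filter_upwards [Ioo_mem_nhdsGT hε] with r hr
  have hsub : Metric.closedBall z₀ r ⊆ Metric.ball z₀ ε := Metric.closedBall_subset_ball hr.2
  rw [circleIntegral.integral_congr (g := fun z => (z - z₀)⁻¹ • G z) hr.1.le]
  · rw [DiffContOnCl.circleIntegral_sub_inv_smul _ (Metric.mem_ball_self hr.1), hG0, smul_eq_mul]
    refine DifferentiableOn.diffContOnCl fun z hz => ?_
    rw [closure_ball _ hr.1.ne'] at hz
    exact (hε1 z (hsub hz)).1.differentiableAt.differentiableWithinAt
  · intro z hzs
    have hne : z ≠ z₀ := Metric.ne_of_mem_sphere hzs hr.1.ne'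
    have := (hε1 z (hsub (Metric.sphere_subset_closedBall hzs))).2 hne
    simp only [smul_eq_mul]
    exact this.trans (hGz z hne)

end IsExpansion

/-! ### Sums of decaying exponentials -/

/-- The Dirichlet series `∑ d j exp (-s j t)`. -/
def expSum (d s : ℕ → ℝ) (t : ℝ) : ℝ := ∑' j, d j * Real.exp (-(s j * t))

section expSum

variable {d s : ℕ → ℝ}

/-- From `e^{-x} ≤ 1 / x`. Summability of `d j / s j`, rather than of `d j`, thus suffices for
convergence at every `t > 0`. -/
theorem exp_term_le (hd : ∀ j, 0 ≤ d j) (hs : ∀ j, 0 < s j) {t : ℝ} (ht : 0 < t) (j : ℕ) :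
    d j * Real.exp (-(s j * t)) ≤ d j / s j * t⁻¹ := by
  have h1 : 0 < s j * t := mul_pos (hs j) ht
  have h2 : Real.exp (-(s j * t)) ≤ (s j * t)⁻¹ := by
    rw [Real.exp_neg]
    exact inv_anti₀ h1 (by linarith [Real.add_one_le_exp (s j * t)])
  calc d j * Real.exp (-(s j * t)) ≤ d j * (s j * t)⁻¹ := mul_le_mul_of_nonneg_left h2 (hd j)
    _ = _ := by rw [mul_inv, div_eq_mul_inv]; ring

theorem summable_exp_terms (hd : ∀ j, 0 ≤ d j) (hs : ∀ j, 0 < s j)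
    (hsum : Summable fun j => d j / s j) {t : ℝ} (ht : 0 < t) :
    Summable fun j => d j * Real.exp (-(s j * t)) :=
  Summable.of_nonneg_of_le (fun j => mul_nonneg (hd j) (Real.exp_pos _).le)
    (exp_term_le hd hs ht) (hsum.mul_right _)

theorem expSum_nonneg (hd : ∀ j, 0 ≤ d j) (t : ℝ) : 0 ≤ expSum d s t :=
  tsum_nonneg fun j => mul_nonneg (hd j) (Real.exp_pos _).le

theorem expSum_antitoneOn (hd : ∀ j, 0 ≤ d j) (hs : ∀ j, 0 < s j)
    (hsum : Summable fun j => d j / s j) : AntitoneOn (expSum d s) (Set.Ioi 0) := by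
  intro x hx y hy hxy
  refine Summable.tsum_le_tsum (fun j => ?_) (summable_exp_terms hd hs hsum hy)
    (summable_exp_terms hd hs hsum hx)
  refine mul_le_mul_of_nonneg_left (Real.exp_le_exp.2 ?_) (hd j)
  have := mul_le_mul_of_nonneg_left hxy (hs j).le
  linarith

theorem exp_mul_expSum (c t : ℝ) :
    Real.exp (c * t) * expSum d s t = expSum d (fun j => s j - c) t := by
  rw [expSum, expSum, ← tsum_mul_left]
  refine tsum_congr fun j => ?_
  rw [mul_left_comm, ← Real.exp_add]
  ring_nf

/-- The series extends to a locally uniformly convergent series of holomorphic functions on `Re z >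
0`, so smoothness needs no termwise differentiation. -/
theorem contDiffOn_expSum (hd : ∀ j, 0 ≤ d j) (hs : ∀ j, 0 < s j)
    (hsum : Summable fun j => d j / s j) {n : WithTop ℕ∞} :
    ContDiffOn ℝ n (expSum d s) (Set.Ioi 0) := by
  set f : ℂ → ℂ := fun z => ∑' j, (d j : ℂ) * Complex.exp (-(s j * z)) with hf
  have hdiff : ∀ z : ℂ, 0 < z.re → AnalyticAt ℂ f z := fun z hz => by
    set U : Set ℂ := {w | z.re / 2 < w.re}
    have hU : IsOpen U := isOpen_lt continuous_const Complex.continuous_re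
    have : DifferentiableOn ℂ f U := by
      refine Complex.differentiableOn_tsum_of_summable_norm
        (summable_exp_terms hd hs hsum (half_pos hz)) (fun j => ?_) hU fun j w hw => ?_
      · fun_prop
      · rw [norm_mul, Complex.norm_real, Real.norm_of_nonneg (hd j), Complex.norm_exp]
        refine mul_le_mul_of_nonneg_left (Real.exp_le_exp.2 ?_) (hd j)
        have h1 : (-((s j : ℂ) * w)).re = -(s j * w.re) := by simp
        rw [h1]
        have := mul_le_mul_of_nonneg_left (le_of_lt hw : z.re / 2 ≤ w.re) (hs j).le
        linarith
    exact this.analyticAt (hU.mem_nhds (half_lt_self hz : z.re / 2 < z.re))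
  have heq : expSum d s = fun t : ℝ => (f t).re := by
    funext t
    have : f t = ((expSum d s t : ℝ) : ℂ) := by
      simp only [hf, expSum]
      push_cast
      rfl
    rw [this, Complex.ofReal_re]
  intro t ht
  have h1 : ContDiffAt ℝ n f (t : ℂ) :=
    ((hdiff t (by simpa using ht)).contDiffAt).restrict_scalars ℝ
  have h2 : ContDiffAt ℝ n (fun t : ℝ => f t) t :=
    ContDiffAt.comp t h1 Complex.ofRealCLM.contDiff.contDiffAt
  rw [heq]
  exact (Complex.reCLM.contDiff.contDiffAt.comp t h2).contDiffWithinAt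

theorem integral_exp_term {c : ℝ} (hc : 0 < c) :
    ∫ t in Set.Ioi (0 : ℝ), Real.exp (-(c * t)) = c⁻¹ := by
  have := integral_exp_mul_Ioi (neg_lt_zero.2 hc) 0
  simp only [neg_mul, mul_zero, Real.exp_zero] at this
  rw [this, neg_div_neg_eq, one_div]

theorem integrableOn_exp_term {c : ℝ} (hc : 0 < c) :
    IntegrableOn (fun t => Real.exp (-(c * t))) (Set.Ioi 0) := by
  simpa only [neg_mul] using integrableOn_exp_mul_Ioi (neg_lt_zero.2 hc) 0

/-- By Tonelli the integral is `∑ d j / s j`, although the function may be unbounded at `0`. -/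
theorem integrableOn_expSum (hd : ∀ j, 0 ≤ d j) (hs : ∀ j, 0 < s j)
    (hsum : Summable fun j => d j / s j) : IntegrableOn (expSum d s) (Set.Ioi 0) := by
  have hmeas : AEStronglyMeasurable (expSum d s) (volume.restrict (Set.Ioi 0)) :=
    ((contDiffOn_expSum hd hs hsum (n := 0)).continuousOn).aestronglyMeasurable measurableSet_Ioi
  refine ⟨hmeas, ?_⟩
  rw [hasFiniteIntegral_iff_ofReal (Eventually.of_forall fun t => expSum_nonneg hd t)]
  have h1 : ∫⁻ t in Set.Ioi (0 : ℝ), ENNReal.ofReal (expSum d s t) =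
      ∫⁻ t in Set.Ioi (0 : ℝ), ∑' j, ENNReal.ofReal (d j * Real.exp (-(s j * t))) :=
    setLIntegral_congr_fun measurableSet_Ioi fun t ht =>
      ENNReal.ofReal_tsum_of_nonneg (fun j => mul_nonneg (hd j) (Real.exp_pos _).le)
        (summable_exp_terms hd hs hsum ht)
  rw [h1, lintegral_tsum fun j => by fun_prop]
  have h2 : ∀ j, ∫⁻ t in Set.Ioi (0 : ℝ), ENNReal.ofReal (d j * Real.exp (-(s j * t))) =
      ENNReal.ofReal (d j / s j) := fun j => by
    rw [← ofReal_integral_eq_lintegral_ofReal ((integrableOn_exp_term (hs j)).const_mul _)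
      (Eventually.of_forall fun t => mul_nonneg (hd j) (Real.exp_pos _).le),
      integral_const_mul, integral_exp_term (hs j), div_eq_mul_inv]
  simp_rw [h2]
  rw [← ENNReal.ofReal_tsum_of_nonneg (fun j => div_nonneg (hd j) (hs j).le) hsum]
  exact ENNReal.ofReal_lt_top

/-- The Laplace transform of a sum of exponentials. -/
theorem laplace_expSum (hd : ∀ j, 0 ≤ d j) {w : ℂ} (hs : ∀ j, 0 < s j + w.re)
    (hsum : Summable fun j => d j / (s j + w.re)) :
    ∫ t in Set.Ioi (0 : ℝ), Complex.exp (-(w * t)) * (expSum d s t : ℂ) =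
      simpleFractions d s w := by
  have hF : ∀ (j : ℕ) (t : ℝ), Complex.exp (-(w * t)) * ((d j * Real.exp (-(s j * t)) : ℝ) : ℂ) =
      d j * Complex.exp (-(s j + w) * t) := fun j t => by
    push_cast
    rw [mul_left_comm, ← Complex.exp_add]
    ring_nf
  have hre : ∀ j, (-((s j : ℂ) + w)).re < 0 := fun j => by
    have := hs j
    simp only [Complex.neg_re, Complex.add_re, Complex.ofReal_re]
    linarith
  have hnorm : ∀ (j : ℕ) (t : ℝ), ‖(d j : ℂ) * Complex.exp (-(s j + w) * t)‖ =
      d j * Real.exp (-((s j + w.re) * t)) := fun j t => by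
    rw [norm_mul, Complex.norm_real, Real.norm_of_nonneg (hd j), Complex.norm_exp]
    congr 2
    simp
    ring
  have h := hasSum_integral_of_summable_integral_norm (μ := volume.restrict (Set.Ioi (0 : ℝ)))
    (F := fun j (t : ℝ) => (d j : ℂ) * Complex.exp (-(s j + w) * t))
    (fun j => (integrableOn_exp_mul_complex_Ioi (hre j) 0).const_mul _) (by
      refine hsum.congr fun j => ?_
      simp_rw [hnorm]
      rw [integral_const_mul, integral_exp_term (hs j), div_eq_mul_inv])
  rw [simpleFractions, setIntegral_congr_fun (g := fun t : ℝ =>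
    ∑' j, (d j : ℂ) * Complex.exp (-(s j + w) * t)) measurableSet_Ioi]
  · rw [← h.tsum_eq]
    refine tsum_congr fun j => ?_
    rw [integral_const_mul, integral_exp_mul_complex_Ioi (hre j)]
    simp only [Complex.ofReal_zero, mul_zero, Complex.exp_zero]
    rw [neg_div_neg_eq, mul_one_div]
  · intro t _
    simp only [expSum]
    rw [Complex.ofReal_tsum, ← tsum_mul_left]
    exact tsum_congr fun j => hF j t

end expSum

/-- The kernel attached to the strip above the first `n` poles. -/
def stripKernel (d σ : ℕ → ℝ) (n : ℕ) (t : ℝ) : ℝ :=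
  if 0 < t then expSum (fun j => d (n + j)) (fun j => σ (n + j)) t
  else expSum d σ (-t) - ∑ j ∈ Finset.range n, d j * Real.exp (-(σ j * t))

/-! ### Weighted integrability and Fourier transforms of the strip kernels. -/

namespace IsExpansion

variable {A κ : ℝ} {Θ : ℂ → ℂ} {σ d : ℕ → ℝ}

theorem summable_shift (H : IsExpansion A Θ κ σ d) (n : ℕ) {c : ℝ} (hc : 0 < σ n + c) :
    Summable fun j => d (n + j) / (σ (n + j) + c) := by
  have h := (summable_fractions H.exponent_pos H.tendsto H.coeff_nonneg H.summable c).norm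
  have h2 := h.comp_injective (add_right_injective n)
  refine h2.congr fun j => ?_
  have h3 : σ n ≤ σ (n + j) := H.strictMono.monotone (Nat.le_add_right n j)
  simp only [Function.comp]
  rw [← Complex.ofReal_add, ← Complex.ofReal_div, Complex.norm_real, Real.norm_of_nonneg
    (div_nonneg (H.coeff_nonneg _) (by linarith))]

theorem exponent_add_pos (H : IsExpansion A Θ κ σ d) (n : ℕ) {c : ℝ} (hc : 0 < σ n + c) (j : ℕ) :
    0 < σ (n + j) + c := by
  linarith [H.strictMono.monotone (Nat.le_add_right n j)]

theorem integrableOn_upper (H : IsExpansion A Θ κ σ d) (n : ℕ) {ϑ : ℝ} (hϑ : ϑ < σ n) :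
    IntegrableOn (fun t => Real.exp (ϑ * t) * expSum (fun j => d (n + j)) (fun j => σ (n + j)) t)
      (Set.Ioi 0) := by
  simp_rw [exp_mul_expSum]
  have hc : 0 < σ n + -ϑ := by linarith
  exact integrableOn_expSum (fun j => H.coeff_nonneg _)
    (fun j => by simpa [sub_eq_add_neg] using H.exponent_add_pos n hc j)
    (by simpa only [sub_eq_add_neg] using H.summable_shift n hc)

theorem integrableOn_all (H : IsExpansion A Θ κ σ d) {ϑ : ℝ} (hϑ : ϑ < σ 0) :
    IntegrableOn (fun t => Real.exp (ϑ * t) * expSum d σ t) (Set.Ioi 0) := by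
  simpa only [zero_add] using H.integrableOn_upper 0 hϑ

theorem integrableOn_lower (H : IsExpansion A Θ κ σ d) (n : ℕ) {ϑ : ℝ} (hϑ0 : -σ 0 < ϑ)
    (hlow : ∀ j < n, σ j < ϑ) : IntegrableOn (fun t => Real.exp (-(ϑ * t)) *
      (expSum d σ t - ∑ j ∈ Finset.range n, d j * Real.exp (σ j * t))) (Set.Ioi 0) := by
  simp_rw [mul_sub, Finset.mul_sum]
  refine Integrable.sub ?_ (integrable_finsetSum _ fun j hj => ?_)
  · simpa only [neg_mul, IntegrableOn] using H.integrableOn_all (neg_lt.1 hϑ0)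
  · have : ∀ t, Real.exp (-(ϑ * t)) * (d j * Real.exp (σ j * t)) =
        d j * Real.exp (-((ϑ - σ j) * t)) := fun t => by
      rw [mul_left_comm, ← Real.exp_add]; ring_nf
    simp_rw [this]
    exact (integrableOn_exp_term (sub_pos.2 (hlow j (Finset.mem_range.1 hj)))).const_mul _

theorem stripKernel_pos (n : ℕ) {t : ℝ} (ht : 0 < t) :
    stripKernel d σ n t = expSum (fun j => d (n + j)) (fun j => σ (n + j)) t := if_pos ht

theorem stripKernel_neg (n : ℕ) {t : ℝ} (ht : 0 < t) : stripKernel d σ n (-t) =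
    expSum d σ t - ∑ j ∈ Finset.range n, d j * Real.exp (σ j * t) := by
  rw [stripKernel, if_neg (by linarith), neg_neg]
  simp

/-- On `t > 0` only exponents above `ϑ` remain. On `t < 0` the series needs `ϑ > -σ 0`, and each
subtracted exponential needs `σ j < ϑ`. -/
theorem integrable_stripKernel (H : IsExpansion A Θ κ σ d) (n : ℕ) {ϑ : ℝ} (hϑ0 : -σ 0 < ϑ)
    (hlow : ∀ j < n, σ j < ϑ) (hϑ : ϑ < σ n) :
    Integrable (fun t => Real.exp (ϑ * t) * stripKernel d σ n t) := by
  rw [← integrableOn_univ, ← Set.Iic_union_Ioi (a := (0 : ℝ)), integrableOn_union,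
    integrableOn_Iic_iff_integrableOn_Iio]
  constructor
  · rw [← (Measure.measurePreserving_neg (volume : Measure ℝ)).integrableOn_comp_preimage
      (Homeomorph.neg ℝ).measurableEmbedding]
    have hpre : (Neg.neg ⁻¹' Set.Iio 0 : Set ℝ) = Set.Ioi 0 := by ext; simp
    rw [hpre]
    refine (H.integrableOn_lower n hϑ0 hlow).congr_fun (fun t ht => ?_) measurableSet_Ioi
    simp only [Function.comp]
    rw [stripKernel_neg n ht, mul_neg]
  · refine (H.integrableOn_upper n hϑ).congr_fun (fun t ht => ?_) measurableSet_Ioi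
    dsimp only
    rw [stripKernel_pos n ht]

/-- The Fourier transform of the kernel on the line `ℝ + i ϑ`. -/
theorem fourier_stripKernel (H : IsExpansion A Θ κ σ d) (n : ℕ) {z : ℂ} (hϑ0 : -σ 0 < z.im)
    (hlow : ∀ j < n, σ j < z.im) (hϑ : z.im < σ n) :
    ∫ t : ℝ, Complex.exp (-(Complex.I * z * t)) * (stripKernel d σ n t : ℂ) =
      simpleFractions d σ (Complex.I * z) + simpleFractions d σ (-(Complex.I * z)) := by
  have hexp : ∀ t : ℝ, ‖Complex.exp (-(Complex.I * z * t))‖ = Real.exp (z.im * t) := fun t => by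
    rw [Complex.norm_exp]; congr 1; simp
  have hint : Integrable fun t : ℝ =>
      Complex.exp (-(Complex.I * z * t)) * (stripKernel d σ n t : ℂ) := by
    have h := H.integrable_stripKernel n hϑ0 hlow hϑ
    refine h.norm.mono' ?_ (Eventually.of_forall fun t => ?_)
    · have hm : AEStronglyMeasurable (stripKernel d σ n) volume := by
        have h2 : AEStronglyMeasurable (fun t => Real.exp (-(z.im * t)) *
            (Real.exp (z.im * t) * stripKernel d σ n t)) volume :=
          (by fun_prop : Continuous fun t => Real.exp (-(z.im * t))).aestronglyMeasurable.mul
            h.aestronglyMeasurable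
        refine h2.congr (Eventually.of_forall fun t => ?_)
        dsimp only
        rw [← mul_assoc, ← Real.exp_add, neg_add_cancel, Real.exp_zero, one_mul]
      exact (by fun_prop : Continuous fun t : ℝ =>
        Complex.exp (-(Complex.I * z * t))).aestronglyMeasurable.mul
        (Complex.continuous_ofReal.comp_aestronglyMeasurable hm)
    · rw [norm_mul, hexp, norm_mul, Complex.norm_real, Real.norm_of_nonneg (Real.exp_pos _).le]
  have hreI : (Complex.I * z).re = -z.im := by simp
  have hlowpos : 0 < σ 0 + z.im := by linarith
  have hup : 0 < σ n + -z.im := by linarith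
  rw [← integral_add_compl (measurableSet_Ioi (a := (0 : ℝ))) hint, Set.compl_Ioi]
  have h1 : ∫ t in Set.Ioi (0 : ℝ), Complex.exp (-(Complex.I * z * t)) * (stripKernel d σ n t : ℂ) =
      simpleFractions (fun j => d (n + j)) (fun j => σ (n + j)) (Complex.I * z) := by
    rw [← laplace_expSum (fun j => H.coeff_nonneg _)
      (fun j => by rw [hreI]; exact H.exponent_add_pos n hup j)
      (by rw [hreI]; exact H.summable_shift n hup)]
    exact setIntegral_congr_fun measurableSet_Ioi fun t ht => by
      rw [stripKernel_pos n ht]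
  -- The subtracted exponentials, integrated over the left half-line, supply precisely the `n`
  -- fractions missing from the right half-line.
  have h2 : ∫ t in Set.Iic (0 : ℝ), Complex.exp (-(Complex.I * z * t)) * (stripKernel d σ n t : ℂ) =
      simpleFractions d σ (-(Complex.I * z)) +
        ∑ j ∈ Finset.range n, (d j : ℂ) / (σ j + Complex.I * z) := by
    have h3 := integral_comp_neg_Ioi (0 : ℝ) fun t : ℝ =>
      Complex.exp (-(Complex.I * z * t)) * (stripKernel d σ n t : ℂ)
    rw [neg_zero] at h3
    rw [← h3]
    have h4 : ∀ t ∈ Set.Ioi (0 : ℝ), Complex.exp (-(Complex.I * z * ((-t : ℝ) : ℂ))) *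
        (stripKernel d σ n (-t) : ℂ) =
        Complex.exp (-(-(Complex.I * z) * t)) * (expSum d σ t : ℂ) -
          ∑ j ∈ Finset.range n, (d j : ℂ) * Complex.exp ((σ j + Complex.I * z) * t) := fun t ht => by
      rw [stripKernel_neg n ht]
      push_cast
      rw [mul_sub, Finset.mul_sum]
      congr 1
      · congr 2; ring
      · refine Finset.sum_congr rfl fun j _ => ?_
        rw [mul_left_comm, ← Complex.exp_add]
        ring_nf
    have hre : ∀ j ∈ Finset.range n, ((σ j : ℂ) + Complex.I * z).re < 0 := fun j hj => by
      have := hlow j (Finset.mem_range.1 hj)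
      rw [Complex.add_re, hreI, Complex.ofReal_re]
      linarith
    have hterm : ∀ j ∈ Finset.range n, IntegrableOn (fun t : ℝ =>
        (d j : ℂ) * Complex.exp ((σ j + Complex.I * z) * t)) (Set.Ioi 0) := fun j hj =>
      (integrableOn_exp_mul_complex_Ioi (hre j hj) 0).const_mul _
    have hre2 : (-(Complex.I * z)).re = z.im := by simp
    have hmain : IntegrableOn (fun t : ℝ => Complex.exp (-(-(Complex.I * z) * t)) *
        (expSum d σ t : ℂ)) (Set.Ioi 0) := by
      have h5 := H.integrableOn_all (ϑ := -z.im) (by linarith)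
      have hm : AEStronglyMeasurable (expSum d σ) (volume.restrict (Set.Ioi 0)) :=
        ((contDiffOn_expSum H.coeff_nonneg H.exponent_pos H.summable
          (n := 0)).continuousOn).aestronglyMeasurable measurableSet_Ioi
      refine h5.mono' ((by fun_prop : Continuous fun t : ℝ =>
        Complex.exp (-(-(Complex.I * z) * t))).aestronglyMeasurable.mul
        (Complex.continuous_ofReal.comp_aestronglyMeasurable hm))
        (Eventually.of_forall fun t => le_of_eq ?_)
      rw [norm_mul, Complex.norm_exp, Complex.norm_real,
        Real.norm_of_nonneg (expSum_nonneg H.coeff_nonneg t)]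
      congr 2
      simp
    rw [setIntegral_congr_fun measurableSet_Ioi h4,
      integral_sub hmain (integrable_finsetSum _ hterm), integral_finsetSum _ hterm,
      laplace_expSum H.coeff_nonneg (fun j => by
        rw [hre2]; simpa using H.exponent_add_pos 0 hlowpos j) (by
        rw [hre2]; simpa using H.summable_shift 0 hlowpos), sub_eq_add_neg,
      ← Finset.sum_neg_distrib]
    congr 1
    refine Finset.sum_congr rfl fun j hj => ?_
    rw [integral_const_mul, integral_exp_mul_complex_Ioi (hre j hj)]
    simp only [Complex.ofReal_zero, mul_zero, Complex.exp_zero]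
    rw [neg_div, mul_neg, neg_neg, mul_one_div]
  have h3 := (summable_fractions H.exponent_pos H.tendsto H.coeff_nonneg H.summable
    (Complex.I * z)).sum_add_tsum_nat_add n
  have h4 : simpleFractions (fun j => d (n + j)) (fun j => σ (n + j)) (Complex.I * z) =
      ∑' j, (d (j + n) : ℂ) / (σ (j + n) + Complex.I * z) :=
    tsum_congr fun j => by beta_reduce; rw [add_comm n j]
  rw [h1, h2, h4]
  have h5 : simpleFractions d σ (Complex.I * z) = _ := h3.symm
  rw [h5]
  ring

theorem contDiffOn_stripKernel (H : IsExpansion A Θ κ σ d) (n : ℕ) {m : WithTop ℕ∞} :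
    ContDiffOn ℝ m (stripKernel d σ n) {0}ᶜ := by
  intro t ht
  refine ContDiffAt.contDiffWithinAt ?_
  rcases lt_or_gt_of_ne (ht : t ≠ 0) with h | h
  · have h1 : ContDiffAt ℝ m (expSum d σ) (-t) :=
      (contDiffOn_expSum H.coeff_nonneg H.exponent_pos H.summable).contDiffAt
        (Ioi_mem_nhds (neg_pos.2 h))
    have h2 : ContDiffAt ℝ m (fun t => expSum d σ (-t)) t :=
      ContDiffAt.comp t h1 contDiff_neg.contDiffAt
    have h3 : ContDiffAt ℝ m
        (fun t => ∑ j ∈ Finset.range n, d j * Real.exp (-(σ j * t))) t := by fun_prop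
    refine (h2.sub h3).congr_of_eventuallyEq ?_
    filter_upwards [Iio_mem_nhds h] with x hx
    rw [stripKernel, if_neg (not_lt.2 (le_of_lt hx))]
  · have hsum := H.summable_shift n (c := 0) (by simpa using H.exponent_pos n)
    simp only [add_zero] at hsum
    have h1 := (contDiffOn_expSum (fun j => H.coeff_nonneg (n + j))
      (fun j => H.exponent_pos (n + j)) hsum (n := m)).contDiffAt (Ioi_mem_nhds h)
    refine h1.congr_of_eventuallyEq ?_
    filter_upwards [Ioi_mem_nhds h] with x hx
    exact stripKernel_pos n hx

end IsExpansion

/-! ### Convolution with an integrable kernel -/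

/-- Sums of an integrable and of a bounded function. -/
def IsSumL1Linf (g : ℝ → ℂ) : Prop :=
  ∃ g₁ g₂ : ℝ → ℂ, (∀ t, g t = g₁ t + g₂ t) ∧ Integrable g₁ ∧
    AEStronglyMeasurable g₂ volume ∧ ∃ C, ∀ t, ‖g₂ t‖ ≤ C

section convolution

variable {g K ψ : ℝ → ℂ}

theorem IsSumL1Linf.integrable_mul (hg : IsSumL1Linf g) (hψ : Integrable ψ) {M : ℝ}
    (hM : ∀ t, ‖ψ t‖ ≤ M) : Integrable fun t => g t * ψ t := by
  obtain ⟨g₁, g₂, hsum, h1, h2, C, hC⟩ := hg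
  simp_rw [hsum, add_mul]
  refine Integrable.add ?_ ?_
  · exact h1.mul_bdd hψ.aestronglyMeasurable (Eventually.of_forall hM)
  · exact hψ.bdd_mul h2 (Eventually.of_forall hC)

/-- This justifies every use of Fubini below. The integrable part of `g` is convolved with `K` and
multiplied by the bounded `ψ`; for the bounded part the roles change, `ψ` being convolved with the
reflected kernel. -/
theorem IsSumL1Linf.integrable_prod (hg : IsSumL1Linf g) (hK : Integrable K) (hψ : Integrable ψ)
    {M : ℝ} (hM : ∀ t, ‖ψ t‖ ≤ M) :
    Integrable (fun p : ℝ × ℝ => g p.2 * K (p.1 - p.2) * ψ p.1) (volume.prod volume) := by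
  obtain ⟨g₁, g₂, hsum, h1, h2, C, hC⟩ := hg
  simp_rw [hsum, add_mul]
  refine Integrable.add ?_ ?_
  · have := h1.convolution_integrand (ContinuousLinearMap.mul ℂ ℂ) hK
    simp only [ContinuousLinearMap.mul_apply'] at this
    exact this.mul_bdd (hψ.aestronglyMeasurable.comp_fst)
      (Eventually.of_forall fun p => hM p.1)
  · have := (hψ.convolution_integrand (ContinuousLinearMap.mul ℂ ℂ) hK.comp_neg).swap
    simp only [ContinuousLinearMap.mul_apply'] at this
    have h3 := this.bdd_mul (c := C) (f := fun p : ℝ × ℝ => g₂ p.2)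
      (h2.comp_snd) (Eventually.of_forall fun p => hC p.2)
    refine h3.congr (Eventually.of_forall fun p => ?_)
    simp only [Function.comp, Prod.swap, neg_sub]
    ring

theorem IsSumL1Linf.ae_integrable (hg : IsSumL1Linf g) (hK : Integrable K) :
    ∀ᵐ t, Integrable fun s => g s * K (t - s) := by
  obtain ⟨g₁, g₂, hsum, h1, h2, C, hC⟩ := hg
  have := (h1.convolution_integrand (ContinuousLinearMap.mul ℂ ℂ) hK).prod_right_ae
  filter_upwards [this] with t ht
  simp only [ContinuousLinearMap.mul_apply'] at ht
  simp_rw [hsum, add_mul]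
  exact ht.add ((hK.comp_sub_left t).bdd_mul h2 (Eventually.of_forall hC))

theorem IsSumL1Linf.integrable_conv_mul (hg : IsSumL1Linf g) (hK : Integrable K)
    (hψ : Integrable ψ) {M : ℝ} (hM : ∀ t, ‖ψ t‖ ≤ M) :
    Integrable fun t => (∫ s, g s * K (t - s)) * ψ t := by
  have := (hg.integrable_prod hK hψ hM).integral_prod_left
  refine this.congr (Eventually.of_forall fun t => ?_)
  exact integral_mul_const (ψ t) fun s => g s * K (t - s)

theorem IsSumL1Linf.integrable_mul_inner (hg : IsSumL1Linf g) (hK : Integrable K)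
    (hψ : Integrable ψ) {M : ℝ} (hM : ∀ t, ‖ψ t‖ ≤ M) :
    Integrable fun s => g s * ∫ t, K (t - s) * ψ t := by
  have := (hg.integrable_prod hK hψ hM).integral_prod_right
  refine this.congr (Eventually.of_forall fun s => ?_)
  simp only [mul_assoc]
  exact integral_const_mul _ _

theorem IsSumL1Linf.integral_conv_mul (hg : IsSumL1Linf g) (hK : Integrable K)
    (hψ : Integrable ψ) {M : ℝ} (hM : ∀ t, ‖ψ t‖ ≤ M) :
    ∫ t, (∫ s, g s * K (t - s)) * ψ t = ∫ s, g s * ∫ t, K (t - s) * ψ t := by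
  simp_rw [← integral_mul_const, ← integral_const_mul]
  rw [integral_integral_swap (f := fun t s => g s * K (t - s) * ψ t)
    (hg.integrable_prod hK hψ hM)]
  simp only [mul_assoc]

theorem fourierHat_eq (φ : 𝓢(ℝ, ℂ)) (ξ : ℝ) :
    fourierHat φ ξ = ((1 / √(2 * Real.pi) : ℝ) : ℂ) *
      (FourierTransform.fourier φ : 𝓢(ℝ, ℂ)) (ξ / (2 * Real.pi)) := by
  rw [fourierHat, SchwartzMap.fourier_coe, Real.fourier_real_eq_integral_exp_smul]
  congr 1
  refine integral_congr_ae (Eventually.of_forall fun t => ?_)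
  dsimp only
  rw [smul_eq_mul]
  congr 2
  have : (Real.pi : ℂ) ≠ 0 := by exact_mod_cast Real.pi_ne_zero
  push_cast
  field_simp

theorem integrable_fourierHat (φ : 𝓢(ℝ, ℂ)) : Integrable (fourierHat φ) := by
  have := ((FourierTransform.fourier φ : 𝓢(ℝ, ℂ)).integrable (μ := volume)).comp_div
    (R := 2 * Real.pi) (by positivity)
  exact (this.const_mul ((1 / √(2 * Real.pi) : ℝ) : ℂ)).congr
    (Eventually.of_forall fun ξ => (fourierHat_eq φ ξ).symm)

theorem schwartz_bounded (φ : 𝓢(ℝ, ℂ)) : ∃ M, ∀ t, ‖φ t‖ ≤ M :=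
  ⟨_, fun t => SchwartzMap.norm_le_seminorm ℝ φ t⟩

theorem fourierHat_bounded (φ : 𝓢(ℝ, ℂ)) : ∃ M, ∀ t, ‖fourierHat φ t‖ ≤ M := by
  obtain ⟨M, hM⟩ := schwartz_bounded (FourierTransform.fourier φ : 𝓢(ℝ, ℂ))
  refine ⟨‖((1 / √(2 * Real.pi) : ℝ) : ℂ)‖ * M, fun t => ?_⟩
  rw [fourierHat_eq, norm_mul]
  exact mul_le_mul_of_nonneg_left (hM _) (norm_nonneg _)

/-- Convolving a Fourier transform with the reflected kernel multiplies by the Fourier transform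
of the kernel. -/
theorem integral_kernel_mul_fourierHat (hK : Integrable K) (χ : 𝓢(ℝ, ℂ)) (s : ℝ) :
    ∫ t, K (t - s) * fourierHat χ t =
      fourierHat (fun ξ => χ ξ * ∫ t : ℝ, Complex.exp (-(Complex.I * ξ * t)) * K t) s := by
  have h1 := integral_add_right_eq_self (μ := volume) (fun t => K (t - s) * fourierHat χ t) s
  rw [← h1]
  simp only [add_sub_cancel_right, fourierHat, mul_left_comm (K _)]
  rw [integral_const_mul]
  congr 1
  simp_rw [← integral_const_mul]
  rw [integral_integral_swap]
  · refine integral_congr_ae (Eventually.of_forall fun ξ => ?_)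
    dsimp only
    refine integral_congr_ae (Eventually.of_forall fun u => ?_)
    dsimp only
    have : Complex.exp (-(Complex.I * ((u + s : ℝ) : ℂ) * ξ)) =
        Complex.exp (-(Complex.I * s * ξ)) * Complex.exp (-(Complex.I * ξ * u)) := by
      rw [← Complex.exp_add]; push_cast; ring_nf
    rw [this]; ring
  · have h2 := hK.mul_prod (χ.integrable (μ := volume))
    have h3 : Continuous fun p : ℝ × ℝ => Complex.exp (-(Complex.I * ((p.1 + s : ℝ) : ℂ) * p.2)) := by
      fun_prop
    refine (h2.bdd_mul (c := 1) h3.aestronglyMeasurable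
      (Eventually.of_forall fun p => le_of_eq ?_)).congr (Eventually.of_forall fun p => ?_)
    · rw [Complex.norm_exp]; simp
    · simp only [Function.uncurry]; ring

/-- The convolution equation in Fourier variables. -/
theorem integral_conv_mul_fourierHat (hg : IsSumL1Linf g) (hK : Integrable K) (κ : ℂ)
    (φ χ : 𝓢(ℝ, ℂ)) (h : ∀ᵐ ξ : ℝ, χ ξ * (∫ t : ℝ, Complex.exp (-(Complex.I * ξ * t)) * K t) =
      φ ξ + κ * (φ ξ * ∫ t : ℝ, Complex.exp (-(Complex.I * ξ * t)) * K t)) :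
    ∫ t, (∫ s, g s * K (t - s)) * fourierHat χ t =
      ∫ t, (κ * (∫ s, g s * K (t - s)) + g t) * fourierHat φ t := by
  obtain ⟨M, hM⟩ := fourierHat_bounded χ
  obtain ⟨M', hM'⟩ := fourierHat_bounded φ
  have hφ := integrable_fourierHat φ
  have hKb : ∀ ξ : ℝ, ‖∫ t : ℝ, Complex.exp (-(Complex.I * ξ * t)) * K t‖ ≤ ∫ t, ‖K t‖ := fun ξ => by
    refine (norm_integral_le_integral_norm _).trans (le_of_eq ?_)
    refine integral_congr_ae (Eventually.of_forall fun t => ?_)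
    dsimp only
    rw [norm_mul, Complex.norm_exp]
    simp
  have hKm : AEStronglyMeasurable (fun ξ : ℝ => ∫ t : ℝ, Complex.exp (-(Complex.I * ξ * t)) * K t)
      volume := by
    refine AEStronglyMeasurable.integral_prod_right' (μ := volume)
      (f := fun p : ℝ × ℝ => Complex.exp (-(Complex.I * p.1 * p.2)) * K p.2) ?_
    exact (by fun_prop : Continuous fun p : ℝ × ℝ =>
      Complex.exp (-(Complex.I * p.1 * p.2))).aestronglyMeasurable.mul
      hK.aestronglyMeasurable.comp_snd
  -- The equation transposed to the test functions, to be paired with `g` afterwards.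
  have hinner : ∀ s, ∫ t, K (t - s) * fourierHat χ t =
      fourierHat φ s + κ * ∫ t, K (t - s) * fourierHat φ t := fun s => by
    rw [integral_kernel_mul_fourierHat hK χ s, integral_kernel_mul_fourierHat hK φ s]
    simp only [fourierHat]
    rw [mul_left_comm κ, ← mul_add]
    congr 1
    have hexp : ∀ ξ : ℝ, ‖Complex.exp (-(Complex.I * s * ξ))‖ ≤ 1 := fun ξ => by
      rw [Complex.norm_exp]; simp
    have hec : Continuous fun ξ : ℝ => Complex.exp (-(Complex.I * s * ξ)) := by fun_prop
    have hi : Integrable fun ξ : ℝ => φ ξ * ∫ t : ℝ, Complex.exp (-(Complex.I * ξ * t)) * K t :=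
      (φ.integrable (μ := volume)).mul_bdd hKm (Eventually.of_forall hKb)
    rw [← integral_const_mul κ, ← integral_add
      ((φ.integrable (μ := volume)).bdd_mul hec.aestronglyMeasurable (Eventually.of_forall hexp))
      ((hi.bdd_mul hec.aestronglyMeasurable (Eventually.of_forall hexp)).const_mul κ)]
    refine integral_congr_ae ?_
    filter_upwards [h] with ξ hξ
    rw [hξ]; ring
  rw [hg.integral_conv_mul hK (integrable_fourierHat χ) hM]
  simp_rw [hinner, mul_add, add_mul]
  rw [integral_add (hg.integrable_mul hφ hM')
    ((hg.integrable_mul_inner hK hφ hM').const_mul κ |>.congr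
      (Eventually.of_forall fun s => by dsimp only; ring)),
    integral_add ((hg.integrable_conv_mul hK hφ hM').const_mul κ |>.congr
      (Eventually.of_forall fun s => by dsimp only; ring)) (hg.integrable_mul hφ hM'), add_comm]
  congr 1
  simp_rw [mul_left_comm (g _) κ, mul_assoc κ]
  rw [integral_const_mul, integral_const_mul, hg.integral_conv_mul hK hφ hM']

end convolution

/-- A locally integrable function that is bounded near `± ∞`. -/
theorem isSumL1Linf_of_isBigO {g : ℝ → ℝ} (hg : LocallyIntegrable g)
    (htop : g =O[atTop] fun _ => (1 : ℝ)) (hbot : g =O[atBot] fun _ => (1 : ℝ)) :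
    IsSumL1Linf fun t => (g t : ℂ) := by
  obtain ⟨C₁, h₁⟩ := htop.bound
  obtain ⟨C₂, h₂⟩ := hbot.bound
  obtain ⟨a, ha⟩ := eventually_atTop.1 h₁
  obtain ⟨b, hb⟩ := eventually_atBot.1 h₂
  have hgC : AEStronglyMeasurable (fun t => (g t : ℂ)) volume :=
    Complex.continuous_ofReal.comp_aestronglyMeasurable hg.aestronglyMeasurable
  refine ⟨(Set.Icc b a).indicator fun t => (g t : ℂ), (Set.Icc b a)ᶜ.indicator fun t => (g t : ℂ),
    fun t => (Set.indicator_self_add_compl_apply (Set.Icc b a) (fun t => (g t : ℂ)) t).symm, ?_,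
    hgC.indicator measurableSet_Icc.compl, max (max C₁ C₂) 0, fun t => ?_⟩
  · rw [integrable_indicator_iff measurableSet_Icc]
    exact Complex.ofRealCLM.integrable_comp (hg.integrableOn_isCompact isCompact_Icc)
  · by_cases ht : t ∈ Set.Icc b a
    · rw [Set.indicator_of_notMem (by simpa using ht), norm_zero]
      exact le_max_right _ _
    · rw [Set.indicator_of_mem ht, Complex.norm_real]
      refine le_trans ?_ (le_max_left _ _)
      rcases le_total a t with h | h
      · exact (by simpa using ha t h : ‖g t‖ ≤ C₁).trans (le_max_left _ _)
      · have : t ≤ b := by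
          by_contra hlt
          exact ht ⟨(not_le.1 hlt).le, h⟩
        exact (by simpa using hb t this : ‖g t‖ ≤ C₂).trans (le_max_right _ _)

theorem exp_mul_convolve (h k : ℝ → ℝ) (ϑ t : ℝ) : Real.exp (ϑ * t) * convolve h k t =
    ∫ s, (Real.exp (ϑ * s) * h s) * (Real.exp (ϑ * (t - s)) * k (t - s)) := by
  rw [convolve, ← integral_const_mul]
  refine integral_congr_ae (Eventually.of_forall fun s => ?_)
  have : Real.exp (ϑ * t) = Real.exp (ϑ * s) * Real.exp (ϑ * (t - s)) := by
    rw [← Real.exp_add]; ring_nf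
  dsimp only
  rw [this]; ring

theorem ae_integrable_convolve {h k : ℝ → ℝ} {ϑ : ℝ}
    (hg : IsSumL1Linf fun t => ((Real.exp (ϑ * t) * h t : ℝ) : ℂ))
    (hK : Integrable fun t => Real.exp (ϑ * t) * k t) :
    ∀ᵐ t : ℝ, Integrable fun s => h s * k (t - s) := by
  filter_upwards [hg.ae_integrable (Complex.ofRealCLM.integrable_comp hK)] with t ht
  have := (Complex.reCLM.integrable_comp ht).const_mul (Real.exp (-(ϑ * t)))
  refine this.congr (Eventually.of_forall fun s => ?_)
  have h1 : Real.exp (-(ϑ * t)) * (Real.exp (ϑ * s) * Real.exp (ϑ * (t - s))) = 1 := by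
    rw [← Real.exp_add, ← Real.exp_add, ← Real.exp_zero]; ring_nf
  simp only [Complex.ofRealCLM_apply, Complex.reCLM_apply, ← Complex.ofReal_mul,
    Complex.ofReal_re]
  linear_combination (h s * k (t - s)) * h1

/-- The weight `e^{ϑ t}` distributes over a convolution, which reduces the line `ℝ + iϑ` to the real
line with weighted data. Multiplying `hF` by a test function gives the hypothesis of
`integral_conv_mul_fourierHat`. -/
theorem isSolution_convolve {N m : ℕ} {γ κ ϑ : ℝ} {h k : ℝ → ℝ}
    (hg : IsSumL1Linf fun t => ((Real.exp (ϑ * t) * h t : ℝ) : ℂ))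
    (hK : Integrable fun t => Real.exp (ϑ * t) * k t)
    (hF : ∀ᵐ ξ : ℝ, (symbol N γ m (ξ + ϑ * Complex.I) - κ) *
      ∫ t : ℝ, Complex.exp (-(Complex.I * ((ξ : ℂ) + ϑ * Complex.I) * t)) * (k t : ℂ) = 1) :
    IsSolution N γ m κ ϑ (convolve h k) h := by
  have hKC : Integrable fun t => ((Real.exp (ϑ * t) * k t : ℝ) : ℂ) :=
    Complex.ofRealCLM.integrable_comp hK
  have hw : ∀ t, ((Real.exp (ϑ * t) * convolve h k t : ℝ) : ℂ) =
      ∫ s, ((Real.exp (ϑ * s) * h s : ℝ) : ℂ) *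
        ((Real.exp (ϑ * (t - s)) * k (t - s) : ℝ) : ℂ) := fun t => by
    rw [exp_mul_convolve, ← integral_complex_ofReal]
    simp only [Complex.ofReal_mul]
  have hwt : ∀ ψ : 𝓢(ℝ, ℂ), Integrable fun t =>
      ((Real.exp (ϑ * t) * convolve h k t : ℝ) : ℂ) * ψ t := fun ψ => by
    obtain ⟨M, hM⟩ := schwartz_bounded ψ
    refine (hg.integrable_conv_mul hKC (ψ.integrable (μ := volume)) hM).congr
      (Eventually.of_forall fun t => ?_)
    beta_reduce
    rw [hw]
  have hsplit : ∀ t, ((Real.exp (ϑ * t) * (κ * convolve h k t + h t) : ℝ) : ℂ) =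
      κ * ((Real.exp (ϑ * t) * convolve h k t : ℝ) : ℂ) + ((Real.exp (ϑ * t) * h t : ℝ) : ℂ) :=
    fun t => by push_cast; ring
  refine ⟨hwt, fun ψ => ?_, fun φ χ hχ => ?_⟩
  · obtain ⟨M, hM⟩ := schwartz_bounded ψ
    refine (((hwt ψ).const_mul (κ : ℂ)).add
      (hg.integrable_mul (ψ.integrable (μ := volume)) hM)).congr (Eventually.of_forall fun t => ?_)
    beta_reduce
    rw [hsplit, Pi.add_apply]
    ring
  · simp_rw [hsplit, hw]
    refine integral_conv_mul_fourierHat (g := fun t => ((Real.exp (ϑ * t) * h t : ℝ) : ℂ))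
      (K := fun t => ((Real.exp (ϑ * t) * k t : ℝ) : ℂ)) hg hKC κ φ χ ?_
    filter_upwards [hF, hχ] with ξ h1 h2
    have h3 : ∫ t : ℝ, Complex.exp (-(Complex.I * ξ * t)) * ((Real.exp (ϑ * t) * k t : ℝ) : ℂ) =
        ∫ t : ℝ, Complex.exp (-(Complex.I * ((ξ : ℂ) + ϑ * Complex.I) * t)) * (k t : ℂ) := by
      refine integral_congr_ae (Eventually.of_forall fun t => ?_)
      dsimp only
      push_cast
      rw [← mul_assoc, ← Complex.exp_add]
      congr 2
      linear_combination (ϑ * t : ℂ) * Complex.I_sq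
    rw [h3, h2]
    linear_combination φ ξ * h1

/-! ### Exponential weights and growth at infinity -/

section growth

variable {h : ℝ → ℝ} {δ δ₀ : ℝ}

theorem locallyIntegrable_exp_mul (hh : LocallyIntegrable h) (c : ℝ) :
    LocallyIntegrable fun t => Real.exp (c * t) * h t :=
  hh.continuous_mul (by fun_prop)

theorem exp_mul_isBigO {l : Filter ℝ} {a : ℝ} (ho : h =O[l] fun t => Real.exp (a * t)) (c : ℝ) :
    (fun t => Real.exp (c * t) * h t) =O[l] fun t => Real.exp ((c + a) * t) := by
  refine ((isBigO_refl (fun t => Real.exp (c * t)) l).mul ho).congr_right fun t => ?_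
  rw [← Real.exp_add]; ring_nf

theorem exp_isBigO_one_atTop {c : ℝ} (hc : c ≤ 0) :
    (fun t : ℝ => Real.exp (c * t)) =O[atTop] fun _ => (1 : ℝ) := by
  refine IsBigO.of_bound 1 ?_
  filter_upwards [eventually_ge_atTop 0] with t ht
  rw [Real.norm_of_nonneg (Real.exp_pos _).le, norm_one, one_mul]
  exact Real.exp_le_one_iff.2 (mul_nonpos_of_nonpos_of_nonneg hc ht)

theorem exp_isBigO_one_atBot {c : ℝ} (hc : 0 ≤ c) :
    (fun t : ℝ => Real.exp (c * t)) =O[atBot] fun _ => (1 : ℝ) := by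
  refine IsBigO.of_bound 1 ?_
  filter_upwards [eventually_le_atBot 0] with t ht
  rw [Real.norm_of_nonneg (Real.exp_pos _).le, norm_one, one_mul]
  exact Real.exp_le_one_iff.2 (mul_nonpos_of_nonneg_of_nonpos hc ht)

theorem isSumL1Linf_exp_mul (hh : LocallyIntegrable h)
    (htop : h =O[atTop] fun t => Real.exp (-(δ * t)))
    (hbot : h =O[atBot] fun t => Real.exp (δ₀ * t)) {ϑ : ℝ} (h1 : -δ₀ ≤ ϑ) (h2 : ϑ ≤ δ) :
    IsSumL1Linf fun t => ((Real.exp (ϑ * t) * h t : ℝ) : ℂ) := by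
  simp_rw [← neg_mul] at htop
  exact isSumL1Linf_of_isBigO (locallyIntegrable_exp_mul hh ϑ)
    ((exp_mul_isBigO htop ϑ).trans (exp_isBigO_one_atTop (by linarith)))
    ((exp_mul_isBigO hbot ϑ).trans (exp_isBigO_one_atBot (by linarith)))

theorem integrableOn_Ioi_exp_mul (hh : LocallyIntegrable h)
    (htop : h =O[atTop] fun t => Real.exp (-(δ * t))) {c : ℝ} (hc : c < δ) (t : ℝ) :
    IntegrableOn (fun s => Real.exp (c * s) * h s) (Set.Ioi t) := by
  simp_rw [← neg_mul] at htop
  refine IntegrableOn.mono_set ?_ Set.Ioi_subset_Ici_self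
  refine ((locallyIntegrable_exp_mul hh c).locallyIntegrableOn _).integrableOn_of_isBigO_atTop
    (exp_mul_isBigO htop c) ⟨Set.Ioi 0, Ioi_mem_atTop 0, ?_⟩
  exact integrableOn_exp_mul_Ioi (by linarith) 0

theorem integrable_exp_mul (hh : LocallyIntegrable h)
    (htop : h =O[atTop] fun t => Real.exp (-(δ * t)))
    (hbot : h =O[atBot] fun t => Real.exp (δ₀ * t)) {c : ℝ} (hc : c < δ) (hc0 : 0 < c + δ₀) :
    Integrable fun s => Real.exp (c * s) * h s := by
  simp_rw [← neg_mul] at htop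
  refine (locallyIntegrable_exp_mul hh c).integrable_of_isBigO_atBot_atTop
    (exp_mul_isBigO hbot c) ⟨Set.Iic 0, Iic_mem_atBot 0, integrableOn_exp_mul_Iic hc0 0⟩
    (exp_mul_isBigO htop c) ⟨Set.Ioi 0, Ioi_mem_atTop 0, integrableOn_exp_mul_Ioi (by linarith) 0⟩

/-- The convolution of a function bounded near `± ∞` with an integrable kernel that is bounded on
`[1, ∞)` is bounded near `+ ∞`. -/
theorem isBigO_convolve_atTop {g K : ℝ → ℝ} (hg : LocallyIntegrable g)
    (htop : g =O[atTop] fun _ => (1 : ℝ)) (hbot : g =O[atBot] fun _ => (1 : ℝ))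
    (hK : Integrable K) {M : ℝ} (hM : ∀ u, 1 ≤ u → |K u| ≤ M) :
    (fun t => ∫ s, g s * K (t - s)) =O[atTop] fun _ => (1 : ℝ) := by
  obtain ⟨C₁, h₁⟩ := htop.bound
  obtain ⟨C₂, h₂⟩ := hbot.bound
  obtain ⟨a, ha⟩ := eventually_atTop.1 h₁
  obtain ⟨b, hb⟩ := eventually_atBot.1 h₂
  set C := max (max C₁ C₂) 0
  have hM0 : 0 ≤ M := (abs_nonneg _).trans (hM 1 le_rfl)
  -- On the window `[b, a]` the kernel is bounded, as `t - s ≥ 1`, and `g` is integrable; outside it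
  -- `g` is bounded and the kernel integrable.
  have hint : Integrable ((Set.Icc b a).indicator fun s => |g s|) :=
    (integrable_indicator_iff measurableSet_Icc).2 (hg.integrableOn_isCompact isCompact_Icc).abs
  refine IsBigO.of_bound (C * (∫ u, |K u|) +
    M * ∫ s, (Set.Icc b a).indicator (fun s => |g s|) s) ?_
  filter_upwards [eventually_ge_atTop (a + 1)] with t ht
  rw [norm_one, mul_one]
  have hb1 : Integrable fun s => C * |K (t - s)| := (hK.comp_sub_left t).abs.const_mul C
  have hb2 : Integrable fun s => M * (Set.Icc b a).indicator (fun s => |g s|) s :=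
    hint.const_mul M
  refine (norm_integral_le_of_norm_le (hb1.add hb2) (Eventually.of_forall fun s => ?_)).trans
    (le_of_eq ?_)
  · rw [norm_mul, Real.norm_eq_abs, Real.norm_eq_abs, Pi.add_apply]
    have hnn1 : 0 ≤ C * |K (t - s)| := mul_nonneg (le_max_right _ _) (abs_nonneg _)
    by_cases hs : s ∈ Set.Icc b a
    · rw [Set.indicator_of_mem hs]
      have := mul_le_mul_of_nonneg_left (hM (t - s) (by linarith [hs.2])) (abs_nonneg (g s))
      linarith
    · rw [Set.indicator_of_notMem hs, mul_zero, add_zero]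
      refine mul_le_mul_of_nonneg_right (le_trans ?_ (le_max_left _ _)) (abs_nonneg _)
      rcases le_total a s with h | h
      · exact (by simpa using ha s h : |g s| ≤ C₁).trans (le_max_left _ _)
      · have : s ≤ b := by
          by_contra hlt
          exact hs ⟨(not_le.1 hlt).le, h⟩
        exact (by simpa using hb s this : |g s| ≤ C₂).trans (le_max_right _ _)
  · rw [integral_add' hb1 hb2, integral_const_mul, integral_const_mul,
      integral_sub_left_eq_self (fun u => |K u|)]

/-- Pointwise existence near `- ∞` of a convolution with a kernel that is bounded on
`(-∞, -1]`. -/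
theorem integrable_convolve_atBot {g K : ℝ → ℝ} (hg : LocallyIntegrable g)
    (htop : g =O[atTop] fun _ => (1 : ℝ)) (hbot : g =O[atBot] fun _ => (1 : ℝ))
    (hK : Integrable K) {M : ℝ} (hM : ∀ u, u ≤ -1 → |K u| ≤ M) :
    ∀ᶠ t in atBot, Integrable fun s => g s * K (t - s) := by
  obtain ⟨C₁, h₁⟩ := htop.bound
  obtain ⟨C₂, h₂⟩ := hbot.bound
  obtain ⟨a, ha⟩ := eventually_atTop.1 h₁
  obtain ⟨b, hb⟩ := eventually_atBot.1 h₂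
  set C := max (max C₁ C₂) 0
  have hM0 : 0 ≤ M := (abs_nonneg _).trans (hM (-1) le_rfl)
  have hint : Integrable ((Set.Icc b a).indicator fun s => |g s|) :=
    (integrable_indicator_iff measurableSet_Icc).2 (hg.integrableOn_isCompact isCompact_Icc).abs
  filter_upwards [eventually_le_atBot (b - 1)] with t ht
  have hb1 : Integrable fun s => C * |K (t - s)| := (hK.comp_sub_left t).abs.const_mul C
  have hb2 : Integrable fun s => M * (Set.Icc b a).indicator (fun s => |g s|) s :=
    hint.const_mul M
  refine (hb1.add hb2).mono' (hg.aestronglyMeasurable.mul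
    (hK.comp_sub_left t).aestronglyMeasurable) (Eventually.of_forall fun s => ?_)
  rw [norm_mul, Real.norm_eq_abs, Real.norm_eq_abs, Pi.add_apply]
  have hnn1 : 0 ≤ C * |K (t - s)| := mul_nonneg (le_max_right _ _) (abs_nonneg _)
  by_cases hs : s ∈ Set.Icc b a
  · rw [Set.indicator_of_mem hs]
    have := mul_le_mul_of_nonneg_left (hM (t - s) (by linarith [hs.1])) (abs_nonneg (g s))
    linarith
  · rw [Set.indicator_of_notMem hs, mul_zero, add_zero]
    refine mul_le_mul_of_nonneg_right (le_trans ?_ (le_max_left _ _)) (abs_nonneg _)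
    rcases le_total a s with h | h
    · exact (by simpa using ha s h : |g s| ≤ C₁).trans (le_max_left _ _)
    · have : s ≤ b := by
        by_contra hlt
        exact hs ⟨(not_le.1 hlt).le, h⟩
      exact (by simpa using hb s this : |g s| ≤ C₂).trans (le_max_right _ _)

end growth

/-! ### Pointwise bounds of the kernels and decay of the convolution at `+∞`. -/

namespace IsExpansion

variable {A κ : ℝ} {Θ : ℂ → ℂ} {σ d : ℕ → ℝ}

theorem summable_exp (H : IsExpansion A Θ κ σ d) (n : ℕ) {t : ℝ} (ht : 0 < t) :
    Summable fun j => d (n + j) * Real.exp (-(σ (n + j) * t)) := by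
  have hsum := H.summable_shift n (c := 0) (by simpa using H.exponent_pos n)
  simp only [add_zero] at hsum
  exact summable_exp_terms (fun j => H.coeff_nonneg _) (fun j => H.exponent_pos _) hsum ht

/-- Decay of the tail of the series, with the rate of its first exponent. -/
theorem expSum_shift_le (H : IsExpansion A Θ κ σ d) (n : ℕ) {v : ℝ} (hv : 1 ≤ v) :
    expSum (fun j => d (n + j)) (fun j => σ (n + j)) v ≤
      Real.exp (σ n) * expSum (fun j => d (n + j)) (fun j => σ (n + j)) 1 *
        Real.exp (-(σ n * v)) := by
  rw [expSum, expSum, mul_right_comm, ← tsum_mul_left]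
  refine Summable.tsum_le_tsum (fun j => ?_) (H.summable_exp n (by linarith))
    ((H.summable_exp n one_pos).mul_left _)
  rw [mul_left_comm]
  refine mul_le_mul_of_nonneg_left ?_ (H.coeff_nonneg _)
  rw [← Real.exp_add, ← Real.exp_add, Real.exp_le_exp]
  nlinarith [mul_nonneg (sub_nonneg.2 (H.strictMono.monotone (Nat.le_add_right n j)))
    (sub_nonneg.2 hv)]

theorem expSum_le (H : IsExpansion A Θ κ σ d) {v : ℝ} (hv : 1 ≤ v) :
    expSum d σ v ≤ Real.exp (σ 0) * expSum d σ 1 * Real.exp (-(σ 0 * v)) := by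
  simpa only [zero_add] using H.expSum_shift_le 0 hv

/-- Only `∑ d j / σ j` is known to converge, so the kernel is bounded away from `0` only; this is
all that the convolution estimates use. -/
theorem weighted_kernel_bound_pos (H : IsExpansion A Θ κ σ d) (n : ℕ) {δ : ℝ} (hδ : δ < σ n) :
    ∃ M, ∀ u, 1 ≤ u → |Real.exp (δ * u) * stripKernel d σ n u| ≤ M := by
  refine ⟨Real.exp (σ n) * expSum (fun j => d (n + j)) (fun j => σ (n + j)) 1, fun u hu => ?_⟩
  have hnn := expSum_nonneg (d := fun j => d (n + j)) (s := fun j => σ (n + j))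
    (fun j => H.coeff_nonneg _)
  rw [stripKernel_pos n (by linarith), abs_of_nonneg (mul_nonneg (Real.exp_pos _).le (hnn u))]
  calc _ ≤ Real.exp (δ * u) * (Real.exp (σ n) *
          expSum (fun j => d (n + j)) (fun j => σ (n + j)) 1 * Real.exp (-(σ n * u))) :=
        mul_le_mul_of_nonneg_left (H.expSum_shift_le n hu) (Real.exp_pos _).le
    _ = Real.exp ((δ - σ n) * u) * (Real.exp (σ n) *
          expSum (fun j => d (n + j)) (fun j => σ (n + j)) 1) := by
        rw [mul_left_comm, ← Real.exp_add, mul_comm]; ring_nf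
    _ ≤ 1 * _ := by
        refine mul_le_mul_of_nonneg_right (Real.exp_le_one_iff.2 ?_)
          (mul_nonneg (Real.exp_pos _).le (hnn 1))
        nlinarith
    _ = _ := one_mul _

theorem weighted_kernel_bound_neg (H : IsExpansion A Θ κ σ d) (n : ℕ) {δ : ℝ} (hδ0 : 0 ≤ δ)
    (hlow : ∀ j < n, σ j < δ) :
    ∃ M, ∀ u, u ≤ -1 → |Real.exp (δ * u) * stripKernel d σ n u| ≤ M := by
  refine ⟨expSum d σ 1 + ∑ j ∈ Finset.range n, d j, fun u hu => ?_⟩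
  have h1 := stripKernel_neg (d := d) (σ := σ) n (t := -u) (by linarith)
  rw [neg_neg] at h1
  rw [h1, mul_sub, Finset.mul_sum]
  refine (abs_sub _ _).trans (add_le_add ?_ ?_)
  · rw [abs_of_nonneg (mul_nonneg (Real.exp_pos _).le (expSum_nonneg H.coeff_nonneg _))]
    have h2 : expSum d σ (-u) ≤ expSum d σ 1 :=
      expSum_antitoneOn H.coeff_nonneg H.exponent_pos H.summable (Set.mem_Ioi.2 one_pos)
        (Set.mem_Ioi.2 (by linarith)) (by linarith)
    have h3 : Real.exp (δ * u) ≤ 1 := Real.exp_le_one_iff.2 (by nlinarith)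
    nlinarith [expSum_nonneg H.coeff_nonneg (s := σ) (-u)]
  · refine (Finset.abs_sum_le_sum_abs _ _).trans (Finset.sum_le_sum fun j hj => ?_)
    rw [mul_left_comm, ← Real.exp_add, abs_of_nonneg (mul_nonneg (H.coeff_nonneg j)
      (Real.exp_pos _).le)]
    have := hlow j (Finset.mem_range.1 hj)
    exact mul_le_of_le_one_right (H.coeff_nonneg j) (Real.exp_le_one_iff.2 (by nlinarith))

section strip

variable {h : ℝ → ℝ} {δ δ₀ : ℝ} {n : ℕ}

theorem convolve_isBigO_atTop (H : IsExpansion A Θ κ σ d) (hh : LocallyIntegrable h)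
    (htop : h =O[atTop] fun t => Real.exp (-(δ * t)))
    (hbot : h =O[atBot] fun t => Real.exp (δ₀ * t)) (hδδ : 0 ≤ δ + δ₀) (hδ0 : 0 ≤ δ)
    (hlow : ∀ j < n, σ j < δ) (hδ : δ < σ n) :
    convolve h (stripKernel d σ n) =O[atTop] fun t => Real.exp (-(δ * t)) := by
  obtain ⟨M, hM⟩ := H.weighted_kernel_bound_pos n hδ
  simp_rw [← neg_mul] at htop
  have h1 := isBigO_convolve_atTop (locallyIntegrable_exp_mul hh δ)
    ((exp_mul_isBigO htop δ).trans (exp_isBigO_one_atTop (by linarith)))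
    ((exp_mul_isBigO hbot δ).trans (exp_isBigO_one_atBot (by linarith)))
    (H.integrable_stripKernel n (by linarith [H.pos]) hlow hδ) hM
  simp_rw [← exp_mul_convolve] at h1
  have h2 := (isBigO_refl (fun t => Real.exp (-(δ * t))) atTop).mul h1
  refine (h2.congr_left fun t => ?_).congr_right fun t => mul_one _
  rw [← mul_assoc, ← Real.exp_add, neg_add_cancel, Real.exp_zero, one_mul]

theorem eventually_integrable (H : IsExpansion A Θ κ σ d) (hh : LocallyIntegrable h)
    (htop : h =O[atTop] fun t => Real.exp (-(δ * t)))
    (hbot : h =O[atBot] fun t => Real.exp (δ₀ * t)) (hδδ : 0 ≤ δ + δ₀) (hδ0 : 0 ≤ δ)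
    (hlow : ∀ j < n, σ j < δ) (hδ : δ < σ n) :
    ∀ᶠ t in atBot, Integrable fun s => h s * stripKernel d σ n (t - s) := by
  obtain ⟨M, hM⟩ := H.weighted_kernel_bound_neg n hδ0 hlow
  simp_rw [← neg_mul] at htop
  filter_upwards [integrable_convolve_atBot (locallyIntegrable_exp_mul hh δ)
    ((exp_mul_isBigO htop δ).trans (exp_isBigO_one_atTop (by linarith)))
    ((exp_mul_isBigO hbot δ).trans (exp_isBigO_one_atBot (by linarith)))
    (H.integrable_stripKernel n (by linarith [H.pos]) hlow hδ) hM] with t ht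
  refine (ht.const_mul (Real.exp (-(δ * t)))).congr (Eventually.of_forall fun s => ?_)
  have h1 : Real.exp (-(δ * t)) * (Real.exp (δ * s) * Real.exp (δ * (t - s))) = 1 := by
    rw [← Real.exp_add, ← Real.exp_add, ← Real.exp_zero]; ring_nf
  dsimp only
  linear_combination (h s * stripKernel d σ n (t - s)) * h1

end strip

end IsExpansion

/-! ### The multipole expansion -/

/-- The kernel of the remainder in the multipole expansion. -/
def remainderKernel (d σ : ℕ → ℝ) (n : ℕ) (u : ℝ) : ℝ :=
  if 0 < u then expSum (fun j => d (n + j)) (fun j => σ (n + j)) u else expSum d σ (-u)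

namespace IsExpansion

variable {A κ : ℝ} {Θ : ℂ → ℂ} {σ d : ℕ → ℝ} {h : ℝ → ℝ} {δ δ₀ : ℝ} {n : ℕ}

/-- An exact identity: on `u ≤ 0` the two kernels differ by `∑ d j e^{-σ j u}` over `j < n`, whose
convolution with `h` over `s ≥ t` factors into the multipole terms. -/
theorem convolve_add_multipoles (hint : ∀ j < n, ∀ t,
      IntegrableOn (fun s => Real.exp (σ j * s) * h s) (Set.Ioi t)) {t : ℝ}
    (ht : Integrable fun s => h s * stripKernel d σ n (t - s)) :
    convolve h (stripKernel d σ n) t + ∑ j ∈ Finset.range n,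
      d j * (∫ s in Set.Ioi t, Real.exp (σ j * s) * h s) * Real.exp (-(σ j * t)) =
      ∫ s, h s * remainderKernel d σ n (t - s) := by
  have hterm : ∀ j, ∀ s, (Set.Ici t).indicator (fun s => d j * Real.exp (-(σ j * t)) *
      (Real.exp (σ j * s) * h s)) s =
      h s * if 0 < t - s then 0 else d j * Real.exp (-(σ j * (t - s))) := fun j s => by
    by_cases hs : t ≤ s
    · rw [Set.indicator_of_mem (Set.mem_Ici.2 hs), if_neg (by linarith)]
      have : Real.exp (-(σ j * (t - s))) = Real.exp (-(σ j * t)) * Real.exp (σ j * s) := by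
        rw [← Real.exp_add]; ring_nf
      rw [this]; ring
    · rw [Set.indicator_of_notMem (fun hmem => hs (Set.mem_Ici.1 hmem)),
        if_pos (by linarith [not_le.1 hs]), mul_zero]
  have hi : ∀ j ∈ Finset.range n, Integrable fun s =>
      h s * if 0 < t - s then 0 else d j * Real.exp (-(σ j * (t - s))) := fun j hj => by
    simp_rw [← hterm j]
    rw [integrable_indicator_iff measurableSet_Ici, integrableOn_Ici_iff_integrableOn_Ioi]
    exact (hint j (Finset.mem_range.1 hj) t).const_mul _
  have hsum : ∀ j ∈ Finset.range n,
      d j * (∫ s in Set.Ioi t, Real.exp (σ j * s) * h s) * Real.exp (-(σ j * t)) =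
      ∫ s, h s * if 0 < t - s then 0 else d j * Real.exp (-(σ j * (t - s))) := fun j _ => by
    simp_rw [← hterm j]
    rw [integral_indicator measurableSet_Ici, integral_Ici_eq_integral_Ioi, integral_const_mul]
    ring
  rw [Finset.sum_congr rfl hsum, ← integral_finsetSum _ hi, convolve,
    ← integral_add ht (integrable_finsetSum _ hi)]
  refine integral_congr_ae (Eventually.of_forall fun s => ?_)
  dsimp only
  rw [← Finset.mul_sum, ← mul_add, stripKernel, remainderKernel]
  split_ifs with h0
  · simp
  · rw [sub_add_cancel]

/-- The integral splits into four regions. For `s < t` the tail kernel weighted by `e^{-δ₀ u}` is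
integrable because `-δ₀ < σ n`. For `t < s ≤ b` with `s - t ≤ 1`, `h s` is bounded by a multiple of
`e^{δ₀ t}` and the kernel is integrable. For `t < s ≤ b` with `s - t ≥ 1` the kernel decays at rate
`σ 0`, which leaves the explicit integral. For `s > b` the same rate acts on an integrable weight of
`h`; there `t ≤ b - 1` ensures `s - t ≥ 1`. -/
theorem remainder_bound (H : IsExpansion A Θ κ σ d) (hh : LocallyIntegrable h)
    (htop : h =O[atTop] fun t => Real.exp (-(δ * t)))
    (hbot : h =O[atBot] fun t => Real.exp (δ₀ * t)) (hδ : 0 < δ) (hδ₀ : -δ₀ < σ n) :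
    ∃ K₁ K₂ K₃ b : ℝ, 0 ≤ K₃ ∧ ∀ t ≤ b - 1, |∫ s, h s * remainderKernel d σ n (t - s)| ≤
      K₁ * Real.exp (δ₀ * t) + K₂ * Real.exp (σ 0 * t) +
        K₃ * (Real.exp (σ 0 * t) * ∫ s in Set.Ioc t b, Real.exp ((δ₀ - σ 0) * s)) := by
  obtain ⟨C, hC0, hC⟩ := hbot.exists_pos
  obtain ⟨b, hb⟩ := eventually_atBot.1 hC.bound
  have hb' : ∀ s ≤ b, |h s| ≤ C * Real.exp (δ₀ * s) := fun s hs => by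
    simpa [Real.norm_of_nonneg (Real.exp_pos _).le] using hb s hs
  set E := Real.exp (σ 0) * expSum d σ 1 with hE
  have hnn := expSum_nonneg (s := σ) H.coeff_nonneg
  have hnn' := expSum_nonneg (d := fun j => d (n + j)) (s := fun j => σ (n + j))
    fun j => H.coeff_nonneg _
  have hE0 : 0 ≤ E := mul_nonneg (Real.exp_pos _).le (hnn 1)
  set F₁ : ℝ → ℝ := (Set.Ioi 0).indicator fun u =>
    Real.exp (-δ₀ * u) * expSum (fun j => d (n + j)) (fun j => σ (n + j)) u with hF₁
  set F₂ : ℝ → ℝ := (Set.Ioi 0).indicator (expSum d σ) with hF₂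
  set F₄ : ℝ → ℝ := (Set.Ioi b).indicator fun s => |Real.exp (-σ 0 * s) * h s| with hF₄
  have hi₁ : Integrable F₁ :=
    (integrable_indicator_iff measurableSet_Ioi).2 (H.integrableOn_upper n hδ₀)
  have hi₂ : Integrable F₂ := (integrable_indicator_iff measurableSet_Ioi).2
    (integrableOn_expSum H.coeff_nonneg H.exponent_pos H.summable)
  have hi₄ : Integrable F₄ := (integrable_indicator_iff measurableSet_Ioi).2
    (integrableOn_Ioi_exp_mul hh htop (by linarith [H.pos]) b).abs
  have hp₁ : ∀ u, 0 ≤ F₁ u := Set.indicator_nonneg fun u _ =>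
    mul_nonneg (Real.exp_pos _).le (hnn' u)
  have hp₂ : ∀ u, 0 ≤ F₂ u := Set.indicator_nonneg fun u _ => hnn u
  have hp₄ : ∀ u, 0 ≤ F₄ u := Set.indicator_nonneg fun u _ => abs_nonneg _
  refine ⟨C * (∫ u, F₁ u) + C * Real.exp |δ₀| * ∫ u, F₂ u, E * ∫ s, F₄ s, C * E, b,
    mul_nonneg hC0.le hE0, fun t ht => ?_⟩
  set F₃ : ℝ → ℝ := (Set.Ioc t b).indicator fun s => Real.exp ((δ₀ - σ 0) * s) with hF₃
  have hi₃ : Integrable F₃ := by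
    rw [hF₃, integrable_indicator_iff measurableSet_Ioc]
    exact ((by fun_prop : Continuous fun s : ℝ =>
      Real.exp ((δ₀ - σ 0) * s)).integrableOn_Icc).mono_set Set.Ioc_subset_Icc_self
  have hp₃ : ∀ u, 0 ≤ F₃ u := Set.indicator_nonneg fun u _ => (Real.exp_pos _).le
  have hI₁ := (hi₁.comp_sub_left t).const_mul (C * Real.exp (δ₀ * t))
  have hI₂ := (hi₂.comp_sub_right t).const_mul (C * Real.exp |δ₀| * Real.exp (δ₀ * t))
  have hI₃ := hi₃.const_mul (C * E * Real.exp (σ 0 * t))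
  have hI₄ := hi₄.const_mul (E * Real.exp (σ 0 * t))
  rw [← Real.norm_eq_abs]
  refine (norm_integral_le_of_norm_le ((hI₁.add hI₂).add (hI₃.add hI₄)) ?_).trans (le_of_eq ?_)
  · have hne : ∀ᵐ s : ℝ, s ≠ t := by simp [ae_iff]
    filter_upwards [hne] with s hs
    simp only [Pi.add_apply]
    have n₁ : 0 ≤ C * Real.exp (δ₀ * t) * F₁ (t - s) :=
      mul_nonneg (mul_nonneg hC0.le (Real.exp_pos _).le) (hp₁ _)
    have n₂ : 0 ≤ C * Real.exp |δ₀| * Real.exp (δ₀ * t) * F₂ (s - t) :=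
      mul_nonneg (mul_nonneg (mul_nonneg hC0.le (Real.exp_pos _).le) (Real.exp_pos _).le) (hp₂ _)
    have n₃ : 0 ≤ C * E * Real.exp (σ 0 * t) * F₃ s :=
      mul_nonneg (mul_nonneg (mul_nonneg hC0.le hE0) (Real.exp_pos _).le) (hp₃ _)
    have n₄ : 0 ≤ E * Real.exp (σ 0 * t) * F₄ s :=
      mul_nonneg (mul_nonneg hE0 (Real.exp_pos _).le) (hp₄ _)
    rw [norm_mul, Real.norm_eq_abs, Real.norm_eq_abs, remainderKernel]
    rcases lt_or_gt_of_ne hs with hst | hst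
    · rw [if_pos (by linarith), abs_of_nonneg (hnn' _)]
      have h1 : |h s| * expSum (fun j => d (n + j)) (fun j => σ (n + j)) (t - s) ≤
          C * Real.exp (δ₀ * t) * F₁ (t - s) := by
        rw [hF₁, Set.indicator_of_mem (Set.mem_Ioi.2 (by linarith : 0 < t - s)), mul_assoc,
          ← mul_assoc (Real.exp _) (Real.exp _), ← mul_assoc, ← Real.exp_add]
        refine mul_le_mul_of_nonneg_right ((hb' s (by linarith)).trans (le_of_eq ?_)) (hnn' _)
        congr 2
        ring
      linarith
    · rw [if_neg (by linarith), neg_sub, abs_of_nonneg (hnn _)]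
      rcases le_or_gt s b with hsb | hsb
      · rcases le_total (s - t) 1 with hv | hv
        · have h1 : |h s| * expSum d σ (s - t) ≤
              C * Real.exp |δ₀| * Real.exp (δ₀ * t) * F₂ (s - t) := by
            rw [hF₂, Set.indicator_of_mem (Set.mem_Ioi.2 (by linarith : 0 < s - t))]
            refine mul_le_mul_of_nonneg_right ((hb' s hsb).trans ?_) (hnn _)
            rw [mul_assoc, ← Real.exp_add]
            refine mul_le_mul_of_nonneg_left (Real.exp_le_exp.2 ?_) hC0.le
            nlinarith [le_abs_self δ₀, abs_nonneg δ₀]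
          linarith
        · have h1 : |h s| * expSum d σ (s - t) ≤ C * E * Real.exp (σ 0 * t) * F₃ s := by
            rw [hF₃, Set.indicator_of_mem (Set.mem_Ioc.2 ⟨hst, hsb⟩)]
            refine (mul_le_mul (hb' s hsb) (H.expSum_le hv) (hnn _)
              (mul_nonneg hC0.le (Real.exp_pos _).le)).trans (le_of_eq ?_)
            have : Real.exp (δ₀ * s) * Real.exp (-(σ 0 * (s - t))) =
                Real.exp (σ 0 * t) * Real.exp ((δ₀ - σ 0) * s) := by
              rw [← Real.exp_add, ← Real.exp_add]; ring_nf
            rw [← hE]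
            linear_combination C * E * this
          linarith
      · have h1 : |h s| * expSum d σ (s - t) ≤ E * Real.exp (σ 0 * t) * F₄ s := by
          rw [hF₄, Set.indicator_of_mem (Set.mem_Ioi.2 hsb), abs_mul,
            abs_of_nonneg (Real.exp_pos _).le]
          refine (mul_le_mul_of_nonneg_left (H.expSum_le (by linarith : 1 ≤ s - t))
            (abs_nonneg _)).trans (le_of_eq ?_)
          have : Real.exp (-(σ 0 * (s - t))) = Real.exp (σ 0 * t) * Real.exp (-σ 0 * s) := by
            rw [← Real.exp_add]; ring_nf
          rw [← hE, this]
          ring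
        linarith
  · rw [integral_add' (hI₁.add hI₂) (hI₃.add hI₄), integral_add' hI₁ hI₂, integral_add' hI₃ hI₄,
      integral_const_mul, integral_const_mul, integral_const_mul, integral_const_mul,
      integral_sub_left_eq_self F₁, integral_sub_right_eq_self F₂, hF₃,
      integral_indicator measurableSet_Ioc]
    ring

theorem integral_Ioc_exp_neg_le {c : ℝ} (hc : c < 0) (t b : ℝ) :
    ∫ s in Set.Ioc t b, Real.exp (c * s) ≤ (-c)⁻¹ * Real.exp (c * t) := by
  have h1 := integral_exp_mul_Ioi hc t
  calc _ ≤ ∫ s in Set.Ioi t, Real.exp (c * s) :=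
        setIntegral_mono_set (integrableOn_exp_mul_Ioi hc t)
          (Eventually.of_forall fun s => (Real.exp_pos _).le)
          (Eventually.of_forall Set.Ioc_subset_Ioi_self)
    _ = _ := by rw [h1, inv_neg]; ring

theorem integral_Ioc_exp_pos_le {c : ℝ} (hc : 0 < c) (t b : ℝ) :
    ∫ s in Set.Ioc t b, Real.exp (c * s) ≤ c⁻¹ * Real.exp (c * b) := by
  have h1 := integral_exp_mul_Iic hc b
  calc _ ≤ ∫ s in Set.Iic b, Real.exp (c * s) :=
        setIntegral_mono_set (integrableOn_exp_mul_Iic hc b)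
          (Eventually.of_forall fun s => (Real.exp_pos _).le)
          (Eventually.of_forall Set.Ioc_subset_Iic_self)
    _ = _ := by rw [h1]; ring

/-- The integral of `e^{(δ₀ - σ 0) s}` over `(t, b]` is dominated by its left end, equals `b - t`,
or stays bounded, according to the sign of `δ₀ - σ 0`. The factor `|t|` is the resonance of equal
rates. -/
theorem remainder_isBigO (H : IsExpansion A Θ κ σ d) (hh : LocallyIntegrable h)
    (htop : h =O[atTop] fun t => Real.exp (-(δ * t)))
    (hbot : h =O[atBot] fun t => Real.exp (δ₀ * t)) (hδ : 0 < δ) (hδ₀ : -δ₀ < σ n) :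
    (fun t => ∫ s, h s * remainderKernel d σ n (t - s)) =O[atBot] (fun t =>
      if δ₀ < σ 0 then Real.exp (δ₀ * t)
      else if δ₀ = σ 0 then |t| * Real.exp (σ 0 * t)
      else Real.exp (σ 0 * t)) := by
  obtain ⟨K₁, K₂, K₃, b, hK₃, hb⟩ := H.remainder_bound (n := n) hh htop hbot hδ hδ₀
  rcases lt_trichotomy δ₀ (σ 0) with hc | hc | hc
  · simp only [if_pos hc]
    refine IsBigO.of_bound (|K₁| + |K₂| + K₃ * (-(δ₀ - σ 0))⁻¹) ?_
    filter_upwards [eventually_le_atBot (b - 1), eventually_le_atBot 0] with t ht ht0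
    rw [Real.norm_eq_abs, Real.norm_of_nonneg (Real.exp_pos _).le]
    refine (hb t ht).trans ?_
    have h1 := mul_le_mul_of_nonneg_left (integral_Ioc_exp_neg_le (sub_neg.2 hc) t b)
      (Real.exp_pos (σ 0 * t)).le
    have h2 : Real.exp (σ 0 * t) * Real.exp ((δ₀ - σ 0) * t) = Real.exp (δ₀ * t) := by
      rw [← Real.exp_add]; ring_nf
    rw [mul_left_comm, h2] at h1
    have h3 := mul_le_mul_of_nonneg_left h1 hK₃
    have h4 : Real.exp (σ 0 * t) ≤ Real.exp (δ₀ * t) := Real.exp_le_exp.2 (by nlinarith)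
    have h5 : K₁ * Real.exp (δ₀ * t) ≤ |K₁| * Real.exp (δ₀ * t) :=
      mul_le_mul_of_nonneg_right (le_abs_self _) (Real.exp_pos _).le
    have h6 : K₂ * Real.exp (σ 0 * t) ≤ |K₂| * Real.exp (δ₀ * t) :=
      mul_le_mul (le_abs_self _) h4 (Real.exp_pos _).le (abs_nonneg _)
    linarith
  · simp only [if_neg hc.not_lt, if_pos hc]
    refine IsBigO.of_bound (|K₁| + |K₂| + K₃ * 2) ?_
    filter_upwards [eventually_le_atBot (b - 1), eventually_le_atBot (-1),
      eventually_le_atBot (-|b|)] with t ht ht1 htb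
    have hbb := le_abs_self b
    rw [Real.norm_eq_abs, norm_mul, Real.norm_of_nonneg (Real.exp_pos _).le, Real.norm_eq_abs,
      abs_abs, abs_of_nonpos (by linarith : t ≤ 0)]
    refine (hb t ht).trans ?_
    have h1 : ∫ s in Set.Ioc t b, Real.exp ((δ₀ - σ 0) * s) = b - t := by
      rw [hc]
      simp [Real.volume_real_Ioc, max_eq_left (by linarith : 0 ≤ b - t)]
    have he := Real.exp_pos (σ 0 * t)
    rw [h1, hc]
    have h4 : Real.exp (σ 0 * t) ≤ -t * Real.exp (σ 0 * t) := by nlinarith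
    have h5 : K₁ * Real.exp (σ 0 * t) ≤ |K₁| * (-t * Real.exp (σ 0 * t)) :=
      mul_le_mul (le_abs_self _) h4 he.le (abs_nonneg _)
    have h6 : K₂ * Real.exp (σ 0 * t) ≤ |K₂| * (-t * Real.exp (σ 0 * t)) :=
      mul_le_mul (le_abs_self _) h4 he.le (abs_nonneg _)
    have h7 : K₃ * (Real.exp (σ 0 * t) * (b - t)) ≤ K₃ * (Real.exp (σ 0 * t) * (2 * -t)) :=
      mul_le_mul_of_nonneg_left (mul_le_mul_of_nonneg_left (by linarith) he.le) hK₃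
    linarith
  · simp only [if_neg hc.not_gt, if_neg hc.ne']
    refine IsBigO.of_bound (|K₁| + |K₂| + K₃ * ((δ₀ - σ 0)⁻¹ * Real.exp ((δ₀ - σ 0) * b))) ?_
    filter_upwards [eventually_le_atBot (b - 1), eventually_le_atBot 0] with t ht ht0
    rw [Real.norm_eq_abs, Real.norm_of_nonneg (Real.exp_pos _).le]
    refine (hb t ht).trans ?_
    have h1 := mul_le_mul_of_nonneg_left (integral_Ioc_exp_pos_le (sub_pos.2 hc) t b)
      (Real.exp_pos (σ 0 * t)).le
    have h3 := mul_le_mul_of_nonneg_left h1 hK₃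
    have h4 : Real.exp (δ₀ * t) ≤ Real.exp (σ 0 * t) := Real.exp_le_exp.2 (by nlinarith)
    have h5 : K₁ * Real.exp (δ₀ * t) ≤ |K₁| * Real.exp (σ 0 * t) :=
      mul_le_mul (le_abs_self _) h4 (Real.exp_pos _).le (abs_nonneg _)
    have h6 : K₂ * Real.exp (σ 0 * t) ≤ |K₂| * Real.exp (σ 0 * t) :=
      mul_le_mul_of_nonneg_right (le_abs_self _) (Real.exp_pos _).le
    linarith

end IsExpansion

/-! ### The symbol of the conjugated fractional Laplacian -/

theorem sphereEigenvalue_nonneg {N : ℕ} (hN : 2 ≤ N) (m : ℕ) : 0 ≤ sphereEigenvalue N m := by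
  have h1 : (2 : ℝ) ≤ N := by exact_mod_cast hN
  have h2 : (0 : ℝ) ≤ harmonicDegree N m := Nat.cast_nonneg _
  exact mul_nonneg h2 (by linarith)

theorem constA_eq (N : ℕ) (γ : ℝ) (m : ℕ) : constA N γ m = constB N γ m + γ := by
  rw [constA, constB]; ring

theorem symbol_eq_gammaQuot (N : ℕ) (γ : ℝ) (m : ℕ) :
    symbol N γ m = gammaQuot (constB N γ m + γ) (constB N γ m) γ := by
  rw [← constA_eq]; rfl

theorem le_constB {N : ℕ} (hN : 2 ≤ N) (γ : ℝ) (m : ℕ) : ((N : ℝ) - 2 * γ) / 4 ≤ constB N γ m := by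
  have h1 : (N : ℝ) / 2 - 1 ≤ √(((N : ℝ) / 2 - 1) ^ 2 + sphereEigenvalue N m) :=
    Real.le_sqrt_of_sq_le (by linarith [sphereEigenvalue_nonneg hN m])
  rw [constB]
  linarith

/-- `Λ` is the value at `0` of the quotient with `B = (N - 2γ) / 4`, and `constB` is at least this
number because the square root is at least `N / 2 - 1`. -/
theorem lt_gammaQuot_zero {N : ℕ} (hN : 2 ≤ N) {γ : ℝ} (hγ0 : 0 < γ) (hγ1 : γ < 1) (m : ℕ) {κ : ℝ}
    (hκ : κ < hardyConst N γ) :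
    κ < (gammaQuot (constB N γ m + γ) (constB N γ m) γ 0).re := by
  have h1 : (2 : ℝ) ≤ N := by exact_mod_cast hN
  have h2 := gammaQuot_zero_mono (B := ((N : ℝ) - 2 * γ) / 4) (by linarith) hγ0.le (le_constB hN γ m)
  refine (hκ.trans_eq ?_).trans_le h2
  rw [gammaQuot_zero, Complex.ofReal_re, hardyConst]
  congr 4
  ring

theorem exists_isExpansion_symbol {N : ℕ} (hN : 2 ≤ N) {γ : ℝ} (hγ0 : 0 < γ) (hγ1 : γ < 1) (m : ℕ)
    {κ : ℝ} (hκ0 : 0 ≤ κ) (hκ : κ < hardyConst N γ) :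
    ∃ A σ d, IsExpansion A (symbol N γ m) κ σ d := by
  have hB : 1 / 2 - γ / 2 ≤ constB N γ m := by
    rw [constB]
    have := Real.sqrt_nonneg (((N : ℝ) / 2 - 1) ^ 2 + sphereEigenvalue N m)
    linarith
  rw [symbol_eq_gammaQuot]
  exact ⟨_, exists_isExpansion (by linarith) hγ0 hγ1 (by linarith) hκ0
    (lt_gammaQuot_zero hN hγ0 hγ1 m hκ)⟩

/-! ### Green's functions -/

theorem mode_zero (σ d : ℕ → ℝ) (j : ℕ) (t : ℝ) :
    mode (fun _ => 0) σ d (fun _ => 0) j t = d j * Real.exp (-(σ j * t)) := by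
  simp [mode, mul_comm]

/-- The series need not converge at `0`, so kernels are compared off this null point throughout. -/
theorem convolve_congr {h k k' : ℝ → ℝ} (hk : ∀ t ≠ 0, k t = k' t) : convolve h k = convolve h k' := by
  funext t
  refine integral_congr_ae ?_
  have hne : ∀ᵐ s : ℝ, s ≠ t := by simp [ae_iff]
  filter_upwards [hne] with s hs
  rw [hk _ (sub_ne_zero.2 hs.symm)]

namespace IsExpansion

variable {A κ : ℝ} {Θ : ℂ → ℂ} {σ d : ℕ → ℝ}

theorem green_eq_expSum (H : IsExpansion A Θ κ σ d) {t : ℝ} (ht : t ≠ 0) :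
    green (fun _ => 0) σ d (fun _ => 0) t = expSum d σ |t| := by
  have h := H.summable_exp 0 (abs_pos.2 ht)
  simp only [zero_add] at h
  simp only [green, mode_zero, expSum]
  exact h.tsum_eq_zero_add.symm

theorem green_eq_stripKernel (H : IsExpansion A Θ κ σ d) {t : ℝ} (ht : t ≠ 0) :
    green (fun _ => 0) σ d (fun _ => 0) t = stripKernel d σ 0 t := by
  rw [H.green_eq_expSum ht, stripKernel]
  split_ifs with h
  · simp only [zero_add, abs_of_pos h]
  · rw [abs_of_nonpos (not_lt.1 h), Finset.range_zero, Finset.sum_empty, sub_zero]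

theorem shiftedGreen_eq_stripKernel (H : IsExpansion A Θ κ σ d) (J : ℕ) {t : ℝ} (ht : t ≠ 0) :
    shiftedGreen (fun _ => 0) σ d (fun _ => 0) J t = stripKernel d σ (J + 1) t := by
  rw [shiftedGreen, stripKernel]
  simp only [mode_zero]
  split_ifs with h
  · rfl
  · rw [H.green_eq_expSum ht, abs_of_nonpos (not_lt.1 h)]

theorem hasSum_stripKernel (H : IsExpansion A Θ κ σ d) (n : ℕ) {t : ℝ} (ht : 0 < t) :
    HasSum (fun j => d (n + j) * Real.exp (-(σ (n + j) * t))) (stripKernel d σ n t) := by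
  rw [stripKernel_pos n ht]
  exact (H.summable_exp n ht).hasSum

/-- Singularities require `z²` to be real and negative. This is excluded on the real line, and on a
shifted line at every point off the imaginary axis, hence almost everywhere. -/
theorem line_identity (H : IsExpansion A Θ κ σ d) {ξ ϑ : ℝ} (h : ξ ≠ 0 ∨ ϑ = 0) :
    (Θ (ξ + ϑ * Complex.I) - κ) * (simpleFractions d σ (Complex.I * (ξ + ϑ * Complex.I)) +
      simpleFractions d σ (-(Complex.I * (ξ + ϑ * Complex.I)))) = 1 := by
  have key : ∀ r : ℝ, 0 < r → ((ξ : ℂ) + ϑ * Complex.I) ^ 2 ≠ -(r : ℂ) := fun r hr heq => by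
    have him := congrArg Complex.im heq
    have hre := congrArg Complex.re heq
    simp [pow_two] at him hre
    rcases h with h | h
    · have : ϑ = 0 := by
        have h2 : ξ * ϑ = 0 := by linarith
        exact (mul_eq_zero.1 h2).resolve_left h
      rw [this] at hre
      nlinarith [mul_self_nonneg ξ]
    · rw [h] at hre
      nlinarith [mul_self_nonneg ξ]
  have hA := H.base_pos
  exact H.identity _ (fun k => key _ (by positivity)) fun j => key _ (pow_pos (H.exponent_pos j) 2)

theorem line_resolvent (H : IsExpansion A Θ κ σ d) {ξ ϑ : ℝ} (h : ξ ≠ 0 ∨ ϑ = 0) :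
    simpleFractions d σ (Complex.I * (ξ + ϑ * Complex.I)) +
      simpleFractions d σ (-(Complex.I * (ξ + ϑ * Complex.I))) =
      1 / (Θ (ξ + ϑ * Complex.I) - κ) := by
  rw [one_div]
  exact eq_inv_of_mul_eq_one_right (H.line_identity h)

theorem fourier_on_line (H : IsExpansion A Θ κ σ d) (n : ℕ) {ϑ : ℝ} (hϑ0 : -σ 0 < ϑ)
    (hlow : ∀ j < n, σ j < ϑ) (hϑ : ϑ < σ n) (ξ : ℝ) :
    ∫ t : ℝ, Complex.exp (-(Complex.I * ((ξ : ℂ) + ϑ * Complex.I) * t)) *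
        (stripKernel d σ n t : ℂ) =
      simpleFractions d σ (Complex.I * (ξ + ϑ * Complex.I)) +
        simpleFractions d σ (-(Complex.I * (ξ + ϑ * Complex.I))) := by
  have him : ((ξ : ℂ) + ϑ * Complex.I).im = ϑ := by simp
  exact H.fourier_stripKernel n (by rwa [him]) (by rwa [him]) (by rwa [him])

theorem isSolution_stripKernel {N m : ℕ} {γ : ℝ} (H : IsExpansion A (symbol N γ m) κ σ d) (n : ℕ)
    {ϑ : ℝ} (hϑ0 : -σ 0 < ϑ) (hlow : ∀ j < n, σ j < ϑ) (hϑ : ϑ < σ n) {h : ℝ → ℝ}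
    (hg : IsSumL1Linf fun t => ((Real.exp (ϑ * t) * h t : ℝ) : ℂ)) :
    IsSolution N γ m κ ϑ (convolve h (stripKernel d σ n)) h := by
  refine isSolution_convolve hg (H.integrable_stripKernel n hϑ0 hlow hϑ) ?_
  have hne : ∀ᵐ ξ : ℝ, ξ ≠ 0 := by simp [ae_iff]
  filter_upwards [hne] with ξ hξ
  rw [H.fourier_on_line n hϑ0 hlow hϑ]
  exact H.line_identity (Or.inl hξ)

end IsExpansion

theorem multipole_real (σ d : ℕ → ℝ) (h : ℝ → ℝ) (j : ℕ) (t : ℝ) :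
    multipole (fun _ => 0) σ d (fun _ => 0) h j t =
      -(d j * ∫ s in Set.Ioi t, Real.exp (σ j * s) * h s) := by
  simp [multipole]

end HardyCylinder

end

/-! ### The theorem. -/

open HardyCylinder

theorem theorem5p2 (N : ℕ) (hN : 2 ≤ N) (γ : ℝ) (hγ0 : 0 < γ) (hγ1 : γ < 1) (m : ℕ)
    (κ : ℝ) (hκ0 : 0 ≤ κ) (hκ : κ < HardyCylinder.hardyConst N γ) :
    ∃ τ σ d d' : ℕ → ℝ,
      -- (i) the poles
      (Meromorphic (HardyCylinder.resolventSymbol N γ m κ) ∧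
        {z : ℂ | meromorphicOrderAt (HardyCylinder.resolventSymbol N γ m κ) z < 0} =
          {z : ℂ | ∃ j : ℕ,
            z = (τ j : ℂ) + σ j * Complex.I ∨ z = (τ j : ℂ) - σ j * Complex.I ∨
            z = -(τ j : ℂ) + σ j * Complex.I ∨ z = -(τ j : ℂ) - σ j * Complex.I} ∧
        Function.Injective (fun j => (τ j, σ j)) ∧ Monotone σ ∧
        0 < σ 0 ∧ (∀ j, 1 ≤ j → σ 0 < σ j) ∧ (∀ j, 0 ≤ τ j) ∧ τ 0 = 0 ∧
        (∃ j₀ : ℕ, (∀ j, j₀ ≤ j → τ j = 0) ∧ StrictMonoOn σ (Set.Ici j₀)) ∧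
        Tendsto σ atTop atTop) ∧
      -- the constants, through the residues at the poles of the upper half-plane
      (∀ j, ∃ ρ : ℂ,
        HardyCylinder.HasResidue (HardyCylinder.resolventSymbol N γ m κ)
          ((τ j : ℂ) + σ j * Complex.I) ρ ∧
        (d j : ℂ) - d' j * Complex.I = (if τ j = 0 then 1 else 2) * Complex.I * ρ) ∧
      -- (ii) the Green's function and the solution that it gives
      ((∀ t : ℝ, t ≠ 0 → Summable (fun j : ℕ => HardyCylinder.mode τ σ d d' (j + 1) |t|)) ∧
        (∀ t : ℝ, HardyCylinder.green τ σ d d' (-t) = HardyCylinder.green τ σ d d' t) ∧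
        ContDiffOn ℝ ((⊤ : ℕ∞) : WithTop ℕ∞) (HardyCylinder.green τ σ d d') {0}ᶜ ∧
        Integrable (HardyCylinder.green τ σ d d') ∧
        (∀ ξ : ℝ,
          ∫ t : ℝ, Complex.exp (-(Complex.I * ξ * t)) * (HardyCylinder.green τ σ d d' t : ℂ) =
            HardyCylinder.resolventSymbol N γ m κ ξ) ∧
        ∀ (h : ℝ → ℝ) (δ δ₀ : ℝ), LocallyIntegrable h →
          h =O[atTop] (fun t => Real.exp (-(δ * t))) →
          h =O[atBot] (fun t => Real.exp (δ₀ * t)) →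
          0 < δ → 0 ≤ δ₀ →
          (∀ᵐ t : ℝ, Integrable (fun s => h s * HardyCylinder.green τ σ d d' (t - s))) ∧
          HardyCylinder.IsSolution N γ m κ 0
            (HardyCylinder.convolve h (HardyCylinder.green τ σ d d')) h) ∧
      -- (iii) the shifted Green's functions and the multipole expansion
      (∀ J : ℕ,
        (∀ t : ℝ, 0 < t → HasSum (fun j : ℕ => HardyCylinder.mode τ σ d d' (J + 1 + j) t)
          (HardyCylinder.shiftedGreen τ σ d d' J t)) ∧
        ContDiffOn ℝ ((⊤ : ℕ∞) : WithTop ℕ∞) (HardyCylinder.shiftedGreen τ σ d d' J) {0}ᶜ ∧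
        (∀ ϑ : ℝ, σ J < ϑ → ϑ < σ (J + 1) →
          Integrable (fun t => Real.exp (ϑ * t) * HardyCylinder.shiftedGreen τ σ d d' J t) ∧
          ∀ᵐ ξ : ℝ,
            ∫ t : ℝ, Complex.exp (-(Complex.I * ((ξ : ℂ) + ϑ * Complex.I) * t)) *
                (HardyCylinder.shiftedGreen τ σ d d' J t : ℂ) =
              HardyCylinder.resolventSymbol N γ m κ ((ξ : ℂ) + ϑ * Complex.I)) ∧
        ∀ (h : ℝ → ℝ) (δ δ₀ : ℝ), LocallyIntegrable h →
          h =O[atTop] (fun t => Real.exp (-(δ * t))) →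
          h =O[atBot] (fun t => Real.exp (δ₀ * t)) →
          0 ≤ δ + δ₀ → σ J < δ → δ < σ (J + 1) →
          (∀ᵐ t : ℝ,
            Integrable (fun s => h s * HardyCylinder.shiftedGreen τ σ d d' J (t - s))) ∧
          (∀ ϑ : ℝ, σ J < ϑ → ϑ < σ (J + 1) → -δ₀ ≤ ϑ → ϑ ≤ δ →
            HardyCylinder.IsSolution N γ m κ ϑ
              (HardyCylinder.convolve h (HardyCylinder.shiftedGreen τ σ d d' J)) h) ∧
          HardyCylinder.convolve h (HardyCylinder.shiftedGreen τ σ d d' J)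
            =O[atTop] (fun t => Real.exp (-(δ * t))) ∧
          (∀ j, j ≤ J → ∀ t : ℝ, IntegrableOn (fun s => Real.exp (σ j * s) * h s) (Set.Ioi t)) ∧
          (fun t => HardyCylinder.convolve h (HardyCylinder.shiftedGreen τ σ d d' J) t -
              ∑ j ∈ Finset.range (J + 1),
                HardyCylinder.multipole τ σ d d' h j t * Real.exp (-(σ j * t)))
            =O[atBot] (fun t =>
              if δ₀ < σ 0 then Real.exp (δ₀ * t)
              else if δ₀ = σ 0 then |t| * Real.exp (σ 0 * t)
              else Real.exp (σ 0 * t)) ∧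
          (∀ j, j ≤ J → 0 < σ j + δ₀ → Integrable (fun s => Real.exp (σ j * s) * h s)) ∧
          (∀ j, j ≤ J → τ j = 0 → Integrable (fun s => Real.exp (σ j * s) * h s) →
            Tendsto (HardyCylinder.multipole τ σ d d' h j) atBot
              (𝓝 (-(d j * ∫ s : ℝ, Real.exp (σ j * s) * h s))))) := by
  obtain ⟨A, σ, d, H⟩ := exists_isExpansion_symbol hN hγ0 hγ1 m hκ0 hκ
  have hae : ∀ᵐ t : ℝ, t ≠ 0 := by simp [ae_iff]
  have hneg0 : -σ 0 < 0 := neg_lt_zero.2 H.pos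
  -- All poles are simple and imaginary, so `τ = 0`; the residues `d j / I` give real constants, so
  -- `d' = 0`.
  refine ⟨fun _ => 0, σ, d, fun _ => 0, ⟨H.meromorphic, ?_, ?_, H.strictMono.monotone, H.pos,
    fun j hj => H.strictMono hj, fun _ => le_rfl, rfl,
    ⟨0, fun _ _ => rfl, H.strictMono.strictMonoOn _⟩, H.tendsto⟩, fun j => ?_,
    ⟨fun t ht => ?_, fun t => ?_, ?_, ?_, fun ξ => ?_, fun h δ δ₀ hh htop hbot hδ hδ₀ => ?_⟩,
    fun J => ?_⟩
  · ext z
    refine (H.order_neg_iff z).trans (exists_congr fun j => ?_)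
    simp only [Complex.ofReal_zero, neg_zero, zero_add, zero_sub]
    tauto
  · exact fun i j hij => H.strictMono.injective (congrArg Prod.snd hij)
  · refine ⟨d j / Complex.I, ?_, ?_⟩
    · have h1 : HasResidue (resolventSymbol N γ m κ) (σ j * Complex.I) (d j / Complex.I) :=
        H.hasResidue j
      simpa only [Complex.ofReal_zero, zero_add] using h1
    · have := Complex.I_ne_zero
      simp only [if_true, Complex.ofReal_zero, zero_mul, sub_zero, one_mul]
      field_simp
  · simp_rw [mode_zero]
    simpa only [add_comm 1] using H.summable_exp 1 (abs_pos.2 ht)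
  · simp only [green, abs_neg]
  · exact H.contDiffOn_stripKernel 0 |>.congr fun t ht => H.green_eq_stripKernel ht
  · have h1 := H.integrable_stripKernel 0 (ϑ := 0) hneg0 (by simp) H.pos
    refine h1.congr ?_
    filter_upwards [hae] with t ht
    rw [H.green_eq_stripKernel ht]
    simp
  · have h1 := H.fourier_on_line 0 (ϑ := 0) hneg0 (by simp) H.pos ξ
    rw [H.line_resolvent (Or.inr rfl)] at h1
    simp only [Complex.ofReal_zero, zero_mul, add_zero] at h1
    refine Eq.trans (integral_congr_ae ?_) h1
    filter_upwards [hae] with t ht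
    rw [H.green_eq_stripKernel ht]
  · have hg := isSumL1Linf_exp_mul hh htop hbot (ϑ := 0) (by linarith) hδ.le
    have hK := H.integrable_stripKernel 0 (ϑ := 0) hneg0 (by simp) H.pos
    rw [convolve_congr fun t ht => H.green_eq_stripKernel ht]
    refine ⟨?_, H.isSolution_stripKernel 0 hneg0 (by simp) H.pos hg⟩
    filter_upwards [ae_integrable_convolve hg hK] with t ht
    refine ht.congr ?_
    have hne : ∀ᵐ s : ℝ, s ≠ t := by simp [ae_iff]
    filter_upwards [hne] with s hs
    rw [H.green_eq_stripKernel (sub_ne_zero.2 hs.symm)]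
  · have hlow : ∀ {ϑ : ℝ}, σ J < ϑ → ∀ j < J + 1, σ j < ϑ := fun hϑ j hj =>
      (H.strictMono.monotone (Nat.le_of_lt_succ hj)).trans_lt hϑ
    have hpos : ∀ {ϑ : ℝ}, σ J < ϑ → 0 < ϑ := fun hϑ => (H.exponent_pos J).trans hϑ
    have hK : ∀ ϑ : ℝ, σ J < ϑ → ϑ < σ (J + 1) →
        Integrable fun t => Real.exp (ϑ * t) * stripKernel d σ (J + 1) t := fun ϑ h1 h2 =>
      H.integrable_stripKernel (J + 1) (hneg0.trans (hpos h1)) (hlow h1) h2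
    refine ⟨fun t ht => ?_, ?_, fun ϑ h1 h2 => ⟨?_, ?_⟩,
      fun h δ δ₀ hh htop hbot hδδ hδ1 hδ2 => ?_⟩
    · rw [H.shiftedGreen_eq_stripKernel J ht.ne']
      simp_rw [mode_zero]
      exact H.hasSum_stripKernel (J + 1) ht
    · exact (H.contDiffOn_stripKernel (J + 1)).congr fun t ht => H.shiftedGreen_eq_stripKernel J ht
    · refine (hK ϑ h1 h2).congr ?_
      filter_upwards [hae] with t ht
      rw [H.shiftedGreen_eq_stripKernel J ht]
    · filter_upwards [hae] with ξ hξ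
      refine Eq.trans (integral_congr_ae ?_) ((H.fourier_on_line (J + 1) (hneg0.trans (hpos h1))
        (hlow h1) h2 ξ).trans (H.line_resolvent (Or.inl hξ)))
      filter_upwards [hae] with t ht
      rw [H.shiftedGreen_eq_stripKernel J ht]
    · have hint : ∀ j < J + 1, ∀ t : ℝ,
          IntegrableOn (fun s => Real.exp (σ j * s) * h s) (Set.Ioi t) := fun j hj t =>
        integrableOn_Ioi_exp_mul hh htop (hlow hδ1 j hj) t
      have hg : ∀ ϑ : ℝ, -δ₀ ≤ ϑ → ϑ ≤ δ →
          IsSumL1Linf fun t => ((Real.exp (ϑ * t) * h t : ℝ) : ℂ) := fun ϑ h1 h2 =>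
        isSumL1Linf_exp_mul hh htop hbot h1 h2
      rw [convolve_congr fun t ht => H.shiftedGreen_eq_stripKernel J ht]
      refine ⟨?_, fun ϑ h1 h2 h3 h4 => H.isSolution_stripKernel (J + 1) (hneg0.trans (hpos h1))
        (hlow h1) h2 (hg ϑ h3 h4), H.convolve_isBigO_atTop hh htop hbot hδδ (hpos hδ1).le
        (hlow hδ1) hδ2, fun j hj => hint j (Nat.lt_succ_of_le hj), ?_, fun j hj hpos' =>
        integrable_exp_mul hh htop hbot (hlow hδ1 j (Nat.lt_succ_of_le hj)) hpos',
        fun j hj _ hI => ?_⟩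
      · filter_upwards [ae_integrable_convolve (hg δ (by linarith) le_rfl) (hK δ hδ1 hδ2)] with t ht
        refine ht.congr ?_
        have hne : ∀ᵐ s : ℝ, s ≠ t := by simp [ae_iff]
        filter_upwards [hne] with s hs
        rw [H.shiftedGreen_eq_stripKernel J (sub_ne_zero.2 hs.symm)]
      -- The tail kernel is integrable against the growth of `h` because `-δ₀ ≤ δ < σ (J + 1)`. The
      -- identity holds only where the convolution converges absolutely, which is everywhere near
      -- `-∞`.
      · refine (H.remainder_isBigO (n := J + 1) hh htop hbot (hpos hδ1) (by linarith)).congr' ?_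
          EventuallyEq.rfl
        filter_upwards [H.eventually_integrable hh htop hbot hδδ (hpos hδ1).le (hlow hδ1) hδ2]
          with t ht
        rw [← IsExpansion.convolve_add_multipoles hint ht, ← sub_neg_eq_add,
          ← Finset.sum_neg_distrib]
        congr 1
        refine Finset.sum_congr rfl fun j _ => ?_
        rw [multipole_real]
        ring
      -- With `τ = 0` the coefficient is a constant times an integral over `(t, ∞)`, and these
      -- half-lines exhaust the line as `t → -∞`.
      · have h1 := (aecover_Ioi (μ := (volume : Measure ℝ)) tendsto_id
          (l := atBot)).integral_tendsto_of_countably_generated hI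
        refine ((h1.const_mul (d j)).neg).congr fun t => ?_
        rw [multipole_real]
        rfl
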